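/- Let $Z_-\in\mathbb R$, $h>0$ and $E>2|Z_-|$, and put $\gamma_1=Z_- /h^2$, $\gamma_2=E/(2h^2)$. For $\beta\in\mathbb C$ consider the eigenvalue problem $$-\psi''(\eta)+\bigl(\gamma_1\cos\eta+\gamma_2\cos 2\eta+\beta\,(1+\cos 2\eta)\bigr)\psi(\eta)=\lambda\,\psi(\eta),\qquad \eta\in[0,\pi],$$ with either Dirichlet conditions $\psi(0)=\psi(\pi)=0$ or Neumann conditions $\psi'(0)=\psi'(\pi)=0$. For $\beta=0$ let $\lambda_n$ denote the $n$-th (real) eigenvalue in increasing order, numbered by $n\ge 1$ in the Dirichlet case and by $n\ge 0$ in the Neumann case. Then, for each of the two boundary conditions and each such $n$, there is exactly one power series in $\beta$ that is the Taylor series at $\beta=0$ of an analytic function $\lambda_n(\beta)$ with $\lambda_n(0)=\lambda_n$ and $\lambda_n(\beta)$ an eigenvalue of the problem for all complex $\beta$ near $0$; and the convergence radii $\rho_n^{D}$ (Dirichlet) and $\rho_n^{N}$ (Neumann) of these series satisfy $$\liminf_{n\to\infty}\frac{\rho_n^{D}}{n^2}\ \ge\ \frac{6}{13},\qquad \liminf_{n\to\infty}\frac{\rho_n^{N}}{n^2}\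 \ge\ \frac{6}{13}.$$ -/

import Mathlib

open Filter Topology
open scoped ENNReal

namespace AngularHill

/-- The two types of separated boundary conditions on the half period `[0, π]`. -/
inductive BoundaryCondition where
  | dirichlet
  | neumann

/-- The boundary condition for a function `ψ` with derivative `dψ` on `[0, π]`. -/
def BoundaryCondition.Holds : BoundaryCondition → (ℝ → ℂ) → (ℝ → ℂ) → Prop
  | .dirichlet, ψ, _ => ψ 0 = 0 ∧ ψ Real.pi = 0
  | .neumann, _, dψ => dψ 0 = 0 ∧ dψ Real.pi = 0

/-- The eigenvalues are numbered from `1` in the Dirichlet case and from `0` in the Neumann case,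
so that the `n`-th eigenvalue of `-∂²` is `n²` in both cases. -/
def BoundaryCondition.firstIndex : BoundaryCondition → ℕ
  | .dirichlet => 1
  | .neumann => 0

/-- The potential `γ₁ cos η + γ₂ cos 2η + β (1 + cos 2η)`. -/
noncomputable def potential (γ₁ γ₂ : ℝ) (β : ℂ) (η : ℝ) : ℂ :=
  ((γ₁ * Real.cos η + γ₂ * Real.cos (2 * η) : ℝ) : ℂ) + β * ((1 + Real.cos (2 * η) : ℝ) : ℂ)

/-- `lam` is an eigenvalue of
`-ψ'' + (γ₁ cos η + γ₂ cos 2η + β (1 + cos 2η)) ψ = lam ψ` on `[0, π]` with the given boundary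
condition: there is a nonzero classical solution `ψ` (with derivative `dψ`; derivatives at the end
points are one-sided). -/
def IsEigenvalue (bc : BoundaryCondition) (γ₁ γ₂ : ℝ) (β lam : ℂ) : Prop :=
  ∃ ψ dψ : ℝ → ℂ,
    (∀ η ∈ Set.Icc 0 Real.pi, HasDerivWithinAt ψ (dψ η) (Set.Icc 0 Real.pi) η) ∧
    (∀ η ∈ Set.Icc 0 Real.pi,
      HasDerivWithinAt dψ ((potential γ₁ γ₂ β η - lam) * ψ η) (Set.Icc 0 Real.pi) η) ∧
    bc.Holds ψ dψ ∧
    ∃ η ∈ Set.Icc 0 Real.pi, ψ η ≠ 0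

/-- `lam` is the `n`-th eigenvalue, in increasing order, of the unperturbed (`β = 0`) self-adjoint
problem. The eigenvalues of this problem are real and simple. -/
def IsNthEigenvalue (bc : BoundaryCondition) (γ₁ γ₂ : ℝ) (n : ℕ) (lam : ℝ) : Prop :=
  IsEigenvalue bc γ₁ γ₂ 0 (lam : ℂ) ∧
    {ν : ℝ | ν < lam ∧ IsEigenvalue bc γ₁ γ₂ 0 (ν : ℂ)}.encard + (bc.firstIndex : ℕ∞) = (n : ℕ∞)

/-- `p` is the perturbation series in `β` of the `n`-th eigenvalue: the Taylor series at `β = 0` of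
an analytic function `Λ` that starts at the `n`-th eigenvalue of the unperturbed problem, and
whose value at `β` is an eigenvalue of the perturbed problem for all `β ∈ ℂ` near `0`. -/
def IsPerturbationSeries (bc : BoundaryCondition) (γ₁ γ₂ : ℝ) (n : ℕ)
    (p : FormalMultilinearSeries ℂ ℂ ℂ) : Prop :=
  ∃ Λ : ℂ → ℂ, HasFPowerSeriesAt Λ p 0 ∧
    (∃ lam : ℝ, IsNthEigenvalue bc γ₁ γ₂ n lam ∧ Λ 0 = (lam : ℂ)) ∧
    ∀ᶠ β in 𝓝 (0 : ℂ), IsEigenvalue bc γ₁ γ₂ β (Λ β)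

/-- The convergence radius `ρ_n ∈ [0, ∞]` of the perturbation series of the `n`-th eigenvalue.
The supremum is over a single series whenever the series exists and is unique
(it would be `0` if there were none). -/
noncomputable def convergenceRadius (bc : BoundaryCondition) (γ₁ γ₂ : ℝ) (n : ℕ) : ℝ≥0∞ :=
  ⨆ (p : FormalMultilinearSeries ℂ ℂ ℂ) (_ : IsPerturbationSeries bc γ₁ γ₂ n p), p.radius

end AngularHill

/-! Write `λ = β + μ` and `e = β / μ`. The equation becomes `ψ'' = (V - μ (1 - e cos 2η)) ψ` with `V
= γ₁ cos η + γ₂ cos 2η`, so a perturbation of size `β ~ n²` is a bounded deformation of the leading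
part. For `|e| < 0.51` the radicand `A = 1 - e cos 2η` stays away from zero near the real axis, and
the Liouville transformation applies: with `M(e)` the mean of `√A` over `[0, π]`, `t = M⁻¹ ∫₀^η √A`
and `Y = A^{1/4} ψ`, one gets `Y'' = -(k² + R_e(t)) Y`, where `k² = M² μ` and `R_e` is bounded
uniformly in `e`. The interval `[0, π]` is preserved, and so are both boundary conditions, because
`A'` vanishes at the end points.

After normalization the characteristic function of this model equation is `sin(kπ) + O(1/k)`,
uniformly in `e`. For large `n` it has exactly one zero `k = n + τ(e)` with `|τ| ≤ 1/4`, holomorphic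
in `e` (`eventually_exists_phaseShift`). It remains to solve `β = k² e / M(e)²` for `e`, that is `e
= β M(e)² / (n + τ(e))²`. For `|β| < 6n²/13` the right side is a contraction of the disc `|e| ≤
0.505` (`exists_inverse_param`), since `|M|² ≤ 1.045²` and `(6/13) · 1.045² < 0.505`. Hence `Λ(β) =
β + k²/M²` is holomorphic on the disc of radius `6n²/13`, which bounds the convergence radius from
below.

For complex `e` the inverse phase leaves the real line. It is built as `t + ξ_e(t)` with `|ξ| ≤ 1/3`
by a contraction argument (`exists_displacement`), which makes `R_e` a holomorphic family. The
eigenfunction itself is pulled back only for real `e` (`isEigenvalue_of_charFn_liouville`); the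
identity theorem extends the resulting equation to the whole disc.

The series must belong to the eigenvalue of the prescribed index. The Prüfer rotation number of a
real problem is continuous and strictly increasing in `λ`, and it is an integer exactly at
eigenvalues; its value there is the index (`isNthEigenvalue_iff`). A homotopy from the zero
potential shows that `√λ_n` is within `1/4` of `n`, so it is the zero `n + τ(0)`. Existence and
uniqueness of the series for every admissible `n` are separate: a real eigenvalue is a simple zero
of the characteristic function, which gives a unique local branch (`exists_local_branch`). -/

namespace AngularHill

/-! ### Volterra operators and the initial value problem on `[0, π]` -/

/-- The half period. -/
abbrev HalfPeriod : Type := Set.Icc (0 : ℝ) Real.pi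

/-- Continuous complex functions on the half period. -/
abbrev Coeff : Type := C(HalfPeriod, ℂ)

noncomputable instance : Module ℂ Coeff := inferInstance
noncomputable instance : NormedCommRing Coeff := inferInstance
noncomputable instance : NormedAlgebra ℂ Coeff := inferInstance
noncomputable instance : NormedRing (Coeff →L[ℂ] Coeff) := inferInstance

/-- Extension of a continuous function on `[0, π]` by constants. -/
noncomputable def ext (f : Coeff) : C(ℝ, ℂ) := f.IccExtend Real.pi_pos.le

lemma ext_apply (f : Coeff) {x : ℝ} (hx : x ∈ Set.Icc 0 Real.pi) : ext f x = f ⟨x, hx⟩ := by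
  simp [ext, ContinuousMap.coe_IccExtend, Set.IccExtend_of_mem, hx]

lemma ext_coe (f : Coeff) (x : HalfPeriod) : ext f x = f x := ext_apply f x.2

lemma norm_ext_le (f : Coeff) (x : ℝ) : ‖ext f x‖ ≤ ‖f‖ := by
  simp only [ext, ContinuousMap.coe_IccExtend, Set.IccExtend, Function.comp_apply]
  exact f.norm_coe_le_norm _

/-- A bound for the integral of a function on `[0, x]`, `x ≤ π`. -/
lemma norm_integral_ext_le (f : Coeff) (x : HalfPeriod) :
    ‖∫ s in (0 : ℝ)..x, ext f s‖ ≤ Real.pi * ‖f‖ := by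
  have h := intervalIntegral.norm_integral_le_of_norm_le_const (a := 0) (b := (x : ℝ))
    (f := ext f) (C := ‖f‖) (fun s _ => norm_ext_le f s)
  have hx : |(x : ℝ) - 0| ≤ Real.pi := by
    rw [sub_zero, abs_of_nonneg x.2.1]; exact x.2.2
  calc _ ≤ ‖f‖ * |(x : ℝ) - 0| := h
    _ ≤ ‖f‖ * Real.pi := by gcongr
    _ = _ := mul_comm _ _

lemma continuous_primitive_ext (f : Coeff) : Continuous fun x : ℝ => ∫ s in (0 : ℝ)..x, ext f s :=
  intervalIntegral.continuous_primitive (fun a b => (ext f).continuous.intervalIntegrable a b) 0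

/-- The primitive that vanishes at `0`, as a bounded operator on `C([0, π])`. -/
noncomputable def primitiveL : Coeff →L[ℂ] Coeff :=
  LinearMap.mkContinuous
    { toFun := fun f => ⟨fun x => ∫ s in (0 : ℝ)..x, ext f s,
        (continuous_primitive_ext f).comp continuous_subtype_val⟩
      map_add' := fun f g => by
        ext x
        simp only [ContinuousMap.coe_mk, ContinuousMap.add_apply]
        rw [← intervalIntegral.integral_add ((ext f).continuous.intervalIntegrable _ _)
          ((ext g).continuous.intervalIntegrable _ _)]
        rfl
      map_smul' := fun c f => by
        ext x
        simp only [ContinuousMap.coe_mk, ContinuousMap.smul_apply, RingHom.id_apply]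
        rw [← intervalIntegral.integral_smul]
        rfl }
    Real.pi
    (fun f => (ContinuousMap.norm_le _ (by positivity)).2 fun x => norm_integral_ext_le f x)

lemma primitiveL_apply (f : Coeff) (x : HalfPeriod) :
    primitiveL f x = ∫ s in (0 : ℝ)..x, ext f s := rfl

/-- Multiplication by an exponential weight. -/
noncomputable def weight (c : ℝ) : Coeff :=
  ⟨fun x => (Real.exp (c * x) : ℂ), by fun_prop⟩

lemma weight_mul_weight (c : ℝ) : weight c * weight (-c) = 1 := by
  ext x
  simp only [weight, ContinuousMap.mul_apply, ContinuousMap.coe_mk, ContinuousMap.one_apply]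
  rw [← Complex.ofReal_mul, ← Real.exp_add]
  simp

/-- Multiplication operators. -/
noncomputable abbrev mulL : Coeff →L[ℂ] Coeff →L[ℂ] Coeff := ContinuousLinearMap.mul ℂ Coeff

/-- The primitive operator conjugated by an exponential weight. -/
noncomputable def weightedPrimitive (c : ℝ) : Coeff →L[ℂ] Coeff :=
  mulL (weight (-c)) * primitiveL * mulL (weight c)

/-- The weight discounts the past: `e^{-cx} ∫₀ˣ e^{cs} ds ≤ 1/c`. A large `c` thus makes Volterra
operators small. -/
lemma norm_weightedPrimitive_le {c : ℝ} (hc : 0 < c) : ‖weightedPrimitive c‖ ≤ 1 / c := by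
  refine ContinuousLinearMap.opNorm_le_bound _ (by positivity) fun f => ?_
  refine (ContinuousMap.norm_le _ (by positivity)).2 fun x => ?_
  have h1 : weightedPrimitive c f x
      = (Real.exp (-c * x) : ℂ) * ∫ s in (0 : ℝ)..x, ext (weight c * f) s := rfl
  rw [h1, norm_mul]
  have h2 : ‖∫ s in (0 : ℝ)..x, ext (weight c * f) s‖
      ≤ ∫ s in (0 : ℝ)..x, ‖f‖ * Real.exp (c * s) := by
    refine intervalIntegral.norm_integral_le_of_norm_le x.2.1 ?_ ?_
    · refine Filter.Eventually.of_forall fun s hs => ?_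
      have hs' : s ∈ Set.Icc 0 Real.pi := ⟨hs.1.le, hs.2.trans x.2.2⟩
      rw [ext_apply _ hs', ContinuousMap.mul_apply, norm_mul, mul_comm]
      gcongr
      · exact f.norm_coe_le_norm _
      · simp only [weight, ContinuousMap.coe_mk, Complex.norm_real]
        rw [Real.norm_of_nonneg (Real.exp_pos _).le]
    · exact (by fun_prop : Continuous fun s : ℝ => ‖f‖ * Real.exp (c * s)).intervalIntegrable _ _
  have h3 : ∫ s in (0 : ℝ)..x, ‖f‖ * Real.exp (c * s) = ‖f‖ * ((Real.exp (c * x) - 1) / c) := by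
    rw [intervalIntegral.integral_const_mul]
    congr 1
    rw [intervalIntegral.integral_comp_mul_left (fun s => Real.exp s) hc.ne', integral_exp]
    simp [div_eq_inv_mul]
  rw [h3] at h2
  rw [Complex.norm_real, Real.norm_of_nonneg (Real.exp_pos _).le]
  calc Real.exp (-c * x) * ‖∫ s in (0 : ℝ)..x, ext (weight c * f) s‖
      ≤ Real.exp (-c * x) * (‖f‖ * ((Real.exp (c * x) - 1) / c)) := by gcongr
    _ = ‖f‖ / c * (Real.exp (-c * x) * Real.exp (c * x) - Real.exp (-c * x)) := by ring
    _ = ‖f‖ / c * (1 - Real.exp (-c * x)) := by rw [← Real.exp_add]; simp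
    _ ≤ ‖f‖ / c * 1 := by
        gcongr; linarith [Real.exp_pos (-c * x)]
    _ = 1 / c * ‖f‖ := by ring

/-- The second order Volterra operator `f ↦ ∫₀ˣ ∫₀ˢ q f`. -/
noncomputable def volterra : Coeff →L[ℂ] (Coeff →L[ℂ] Coeff) :=
  (ContinuousLinearMap.compL ℂ Coeff Coeff Coeff (primitiveL * primitiveL)).comp mulL

lemma volterra_apply (q : Coeff) : volterra q = primitiveL * primitiveL * mulL q := rfl

/-- Conjugation by the weight `e^{cx}` does not affect invertibility and reduces the norm of the
Volterra operator to at most `‖q‖ / c²`. For `c = ‖q‖ + 1` this is below `1`, and the Neumann series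
applies. -/
lemma isUnit_one_sub_volterra (q : Coeff) : IsUnit (1 - volterra q) := by
  obtain ⟨c, hc, hcq⟩ : ∃ c : ℝ, 0 < c ∧ ‖q‖ < c * c :=
    ⟨‖q‖ + 1, by positivity, by nlinarith [norm_nonneg q]⟩
  have hmul : ∀ f g : Coeff, mulL f * mulL g = mulL (f * g) := fun f g => by
    ext1 u; simp [ContinuousLinearMap.mul_apply', mul_assoc]
  have hone : mulL (1 : Coeff) = 1 := by ext1 u; simp
  have h1 : mulL (weight c) * mulL (weight (-c)) = 1 := by
    rw [hmul, weight_mul_weight, hone]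
  have h2 : mulL (weight (-c)) * mulL (weight c) = 1 := by
    rw [hmul, mul_comm, weight_mul_weight, hone]
  let w : (Coeff →L[ℂ] Coeff)ˣ := ⟨mulL (weight c), mulL (weight (-c)), h1, h2⟩
  have hconj : (w⁻¹ : (Coeff →L[ℂ] Coeff)ˣ) * (1 - volterra q) * (w : Coeff →L[ℂ] Coeff)
      = 1 - weightedPrimitive c * weightedPrimitive c * mulL q := by
    change mulL (weight (-c)) * (1 - volterra q) * mulL (weight c) = _
    rw [mul_sub, sub_mul, mul_one, h2, volterra_apply, weightedPrimitive]
    congr 1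
    calc mulL (weight (-c)) * (primitiveL * primitiveL * mulL q) * mulL (weight c)
        = mulL (weight (-c)) * primitiveL * 1 * primitiveL * (mulL q * mulL (weight c)) := by
          simp only [mul_assoc, one_mul]
      _ = mulL (weight (-c)) * primitiveL * (mulL (weight c) * mulL (weight (-c))) * primitiveL
            * (mulL (weight c) * mulL q) := by
          rw [h1, hmul q, hmul _ q, mul_comm q]
      _ = _ := by simp only [mul_assoc]
  have hnorm : ‖weightedPrimitive c * weightedPrimitive c * mulL q‖ < 1 := by
    have hw := norm_weightedPrimitive_le hc
    have hq : ‖mulL q‖ ≤ ‖q‖ := by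
      simp
    calc _ ≤ ‖weightedPrimitive c‖ * ‖weightedPrimitive c‖ * ‖mulL q‖ :=
          (norm_mul_le _ _).trans (by exact mul_le_mul_of_nonneg_right (norm_mul_le _ _) (norm_nonneg _))
      _ ≤ (1 / c) * (1 / c) * ‖q‖ := by gcongr
      _ = ‖q‖ / (c * c) := by field_simp
      _ < 1 := by rw [div_lt_one (by positivity)]; exact hcq
  have hunit := isUnit_one_sub_of_norm_lt_one hnorm
  rw [← hconj] at hunit
  have := (w.isUnit.mul hunit).mul w⁻¹.isUnit
  simpa [mul_assoc] using this

/-- The coordinate function. -/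
noncomputable def coord : Coeff := ⟨fun x => ((x : ℝ) : ℂ), by fun_prop⟩

/-- The affine function with value `a` and slope `b` at `0`. -/
noncomputable def affine (a b : ℂ) : Coeff := a • 1 + b • coord

/-- The solution of `u'' = q u`, `u(0) = a`, `u'(0) = b`. -/
noncomputable def ivp (a b : ℂ) (q : Coeff) : Coeff := Ring.inverse (1 - volterra q) (affine a b)

/-- The derivative of the solution of the initial value problem. -/
noncomputable def ivpDeriv (a b : ℂ) (q : Coeff) : Coeff := b • 1 + primitiveL (q * ivp a b q)

/-- The coefficient enters linearly through `volterra`, and inversion is smooth at units. Class `C¹`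
rather than differentiability is recorded because the local branch of eigenvalues needs a strict
derivative. -/
lemma contDiff_ivp (a b : ℂ) : ContDiff ℂ 1 (ivp a b) := by
  rw [contDiff_iff_contDiffAt]
  intro q
  have h1 : ContDiffAt ℂ 1 (fun q : Coeff => 1 - volterra q) q :=
    contDiffAt_const.sub volterra.contDiff.contDiffAt
  obtain ⟨u, hu⟩ := isUnit_one_sub_volterra q
  have h0 : ContDiffAt ℂ 1 Ring.inverse (1 - volterra q) := hu ▸ contDiffAt_ringInverse ℂ u
  have h2 : ContDiffAt ℂ 1 (fun q : Coeff => Ring.inverse (1 - volterra q)) q :=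
    ContDiffAt.comp (g := Ring.inverse) q h0 h1
  exact h2.clm_apply contDiffAt_const

lemma contDiff_ivpDeriv (a b : ℂ) : ContDiff ℂ 1 (ivpDeriv a b) :=
  contDiff_const.add (primitiveL.contDiff.comp (contDiff_id.mul (contDiff_ivp a b)))

lemma differentiable_ivp (a b : ℂ) : Differentiable ℂ (ivp a b) :=
  (contDiff_ivp a b).differentiable one_ne_zero

lemma differentiable_ivpDeriv (a b : ℂ) : Differentiable ℂ (ivpDeriv a b) :=
  (contDiff_ivpDeriv a b).differentiable one_ne_zero

lemma one_sub_volterra_ivp (a b : ℂ) (q : Coeff) : (1 - volterra q) (ivp a b q) = affine a b := by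
  have := Ring.mul_inverse_cancel _ (isUnit_one_sub_volterra q)
  exact DFunLike.congr_fun this (affine a b)

lemma primitiveL_one (b : ℂ) : primitiveL (b • 1) = b • coord := by
  ext x
  rw [primitiveL_apply]
  have : ∀ s, ext (b • 1) s = b := fun s => by
    simp [ext, ContinuousMap.coe_IccExtend, Set.IccExtend]
  simp [this, coord, mul_comm]

lemma ivp_eq (a b : ℂ) (q : Coeff) : ivp a b q = a • 1 + primitiveL (ivpDeriv a b q) := by
  have h := one_sub_volterra_ivp a b q
  have h' : ivp a b q - primitiveL (primitiveL (q * ivp a b q)) = a • 1 + b • coord := h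
  rw [ivpDeriv, map_add, primitiveL_one]
  rw [sub_eq_iff_eq_add] at h'
  rw [← add_assoc, ← h']

/-- Uniqueness for the integral equation. -/
lemma eq_ivp_of_integral {a b : ℂ} {q u : Coeff}
    (h : u = a • 1 + primitiveL (b • 1 + primitiveL (q * u))) : u = ivp a b q := by
  have h1 : (1 - volterra q) u = affine a b := by
    change u - primitiveL (primitiveL (q * u)) = a • 1 + b • coord
    rw [sub_eq_iff_eq_add]
    conv_lhs => rw [h]
    rw [map_add, primitiveL_one, add_assoc]
  have h2 : Ring.inverse (1 - volterra q) ((1 - volterra q) u) = u :=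
    DFunLike.congr_fun (Ring.inverse_mul_cancel _ (isUnit_one_sub_volterra q)) u
  rw [← h2, h1, ivp]

/-- The solution as a function on the line (only its values on `[0, π]` matter). -/
noncomputable def sol (a b : ℂ) (q : Coeff) (x : ℝ) : ℂ :=
  a + ∫ s in (0 : ℝ)..x, ext (ivpDeriv a b q) s

/-- The derivative of `sol`. -/
noncomputable def dsol (a b : ℂ) (q : Coeff) (x : ℝ) : ℂ :=
  b + ∫ s in (0 : ℝ)..x, ext (q * ivp a b q) s

lemma sol_coe (a b : ℂ) (q : Coeff) (x : HalfPeriod) : sol a b q x = ivp a b q x := by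
  rw [ivp_eq]; simp [sol, primitiveL_apply]

lemma dsol_coe (a b : ℂ) (q : Coeff) (x : HalfPeriod) : dsol a b q x = ivpDeriv a b q x := by
  rw [ivpDeriv]; simp [dsol, primitiveL_apply]

lemma sol_zero (a b : ℂ) (q : Coeff) : sol a b q 0 = a := by simp [sol]

lemma dsol_zero (a b : ℂ) (q : Coeff) : dsol a b q 0 = b := by simp [dsol]

lemma hasDerivAt_sol (a b : ℂ) (q : Coeff) {x : ℝ} (hx : x ∈ Set.Icc 0 Real.pi) :
    HasDerivAt (sol a b q) (dsol a b q x) x := by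
  have h := ((ext (ivpDeriv a b q)).continuous.integral_hasStrictDerivAt 0 x).hasDerivAt
  rw [ext_apply _ hx, ← dsol_coe] at h
  exact h.const_add a

lemma hasDerivAt_dsol (a b : ℂ) (q : Coeff) {x : ℝ} (hx : x ∈ Set.Icc 0 Real.pi) :
    HasDerivAt (dsol a b q) (ext q x * sol a b q x) x := by
  have h := ((ext (q * ivp a b q)).continuous.integral_hasStrictDerivAt 0 x).hasDerivAt
  rw [ext_apply _ hx, ContinuousMap.mul_apply, ← sol_coe, ← ext_apply q hx] at h
  exact h.const_add b

lemma continuous_sol (a b : ℂ) (q : Coeff) : Continuous (sol a b q) :=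
  continuous_const.add (continuous_primitive_ext _)

/-- Fundamental theorem of calculus with one-sided derivatives at the end points. -/
lemma eq_add_integral_of_hasDerivWithinAt {f f' : ℝ → ℂ}
    (hf : ∀ x ∈ Set.Icc 0 Real.pi, HasDerivWithinAt f (f' x) (Set.Icc 0 Real.pi) x)
    (g : Coeff) (hg : ∀ x : HalfPeriod, g x = f' x) (x : HalfPeriod) :
    f x = f 0 + ∫ s in (0 : ℝ)..x, ext g s := by
  have hsub : Set.Icc (0 : ℝ) x ⊆ Set.Icc 0 Real.pi := Set.Icc_subset_Icc_right x.2.2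
  have h := intervalIntegral.integral_eq_sub_of_hasDerivAt_of_le (f := f) (f' := ext g) x.2.1
    (fun y hy => ((hf y (hsub hy)).continuousWithinAt).mono hsub)
    (fun y hy => by
      have hy' : y ∈ Set.Icc 0 Real.pi := hsub (Set.Ioo_subset_Icc_self hy)
      rw [ext_apply g hy', hg]
      exact (hf y hy').hasDerivAt (Icc_mem_nhds hy.1 (hy.2.trans_le x.2.2)))
    ((ext g).continuous.intervalIntegrable _ _)
  rw [h]; ring

/-- Uniqueness for the initial value problem. -/
lemma eq_sol_of_hasDerivWithinAt {q : Coeff} {f f' : ℝ → ℂ}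
    (hf : ∀ x ∈ Set.Icc 0 Real.pi, HasDerivWithinAt f (f' x) (Set.Icc 0 Real.pi) x)
    (hf' : ∀ x ∈ Set.Icc 0 Real.pi,
      HasDerivWithinAt f' (ext q x * f x) (Set.Icc 0 Real.pi) x) :
    ∀ x ∈ Set.Icc 0 Real.pi, f x = sol (f 0) (f' 0) q x ∧ f' x = dsol (f 0) (f' 0) q x := by
  let u : Coeff := ⟨fun x => f x, continuousOn_iff_continuous_domRestrict.1
    fun x hx => (hf x hx).continuousWithinAt⟩
  let v : Coeff := ⟨fun x => f' x, continuousOn_iff_continuous_domRestrict.1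
    fun x hx => (hf' x hx).continuousWithinAt⟩
  have hu : u = f 0 • 1 + primitiveL v := by
    ext x
    have := eq_add_integral_of_hasDerivWithinAt hf v (fun _ => rfl) x
    change f x = f 0 * 1 + _
    rw [mul_one]; exact this
  have hv : v = f' 0 • 1 + primitiveL (q * u) := by
    ext x
    have := eq_add_integral_of_hasDerivWithinAt hf' (q * u)
      (fun y => by rw [ext_coe]; rfl) x
    change f' x = f' 0 * 1 + _
    rw [mul_one]; exact this
  have hu' : u = ivp (f 0) (f' 0) q := eq_ivp_of_integral (by rw [← hv, ← hu])
  intro x hx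
  constructor
  · rw [sol_coe _ _ _ ⟨x, hx⟩, ← hu']; rfl
  · rw [dsol_coe _ _ _ ⟨x, hx⟩, ivpDeriv, ← hu', ← hv]; rfl

/-! ### Characteristic functions of the boundary value problems -/

/-- Initial value selected by a boundary condition. -/
def BoundaryCondition.initVal : BoundaryCondition → ℂ
  | .dirichlet => 0
  | .neumann => 1

/-- Initial slope selected by a boundary condition. -/
def BoundaryCondition.initSlope : BoundaryCondition → ℂ
  | .dirichlet => 1
  | .neumann => 0

/-- The solution satisfying the boundary condition at `0`. -/
noncomputable abbrev bsol (bc : BoundaryCondition) : Coeff → ℝ → ℂ := sol bc.initVal bc.initSlope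

/-- The derivative of `bsol`. -/
noncomputable abbrev dbsol (bc : BoundaryCondition) : Coeff → ℝ → ℂ := dsol bc.initVal bc.initSlope

/-- The characteristic function of the boundary value problem `u'' = q u`. -/
noncomputable def charFn : BoundaryCondition → Coeff → ℂ
  | .dirichlet, q => bsol .dirichlet q Real.pi
  | .neumann, q => dbsol .neumann q Real.pi

lemma contDiff_charFn (bc : BoundaryCondition) : ContDiff ℂ 1 (charFn bc) := by
  let e : Coeff →L[ℂ] ℂ := ContinuousMap.evalCLM ℂ (⟨Real.pi, Real.pi_pos.le, le_rfl⟩ : HalfPeriod)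
  cases bc with
  | dirichlet =>
    have : charFn .dirichlet = fun q => e (ivp 0 1 q) := by
      funext q; exact sol_coe 0 1 q ⟨Real.pi, Real.pi_pos.le, le_rfl⟩
    rw [this]
    exact e.contDiff.comp (contDiff_ivp 0 1)
  | neumann =>
    have : charFn .neumann = fun q => e (ivpDeriv 1 0 q) := by
      funext q; exact dsol_coe 1 0 q ⟨Real.pi, Real.pi_pos.le, le_rfl⟩
    rw [this]
    exact e.contDiff.comp (contDiff_ivpDeriv 1 0)

lemma differentiable_charFn (bc : BoundaryCondition) : Differentiable ℂ (charFn bc) :=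
  (contDiff_charFn bc).differentiable one_ne_zero

lemma mul_ivp (a b c : ℂ) (q : Coeff) : c • ivp a b q = ivp (c * a) (c * b) q := by
  rw [ivp, ivp, ← map_smul]
  congr 1
  rw [affine, affine, smul_add, smul_smul, smul_smul]

lemma mul_sol (a b c : ℂ) (q : Coeff) (x : HalfPeriod) :
    c * sol a b q x = sol (c * a) (c * b) q x := by
  rw [sol_coe, sol_coe, ← mul_ivp]; rfl

lemma mul_dsol (a b c : ℂ) (q : Coeff) (x : HalfPeriod) :
    c * dsol a b q x = dsol (c * a) (c * b) q x := by
  rw [dsol_coe, dsol_coe, ivpDeriv, ivpDeriv, ← mul_ivp, mul_smul_comm, map_smul]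
  simp [mul_add]

/-- If the solution vanished identically, the integral equation would reduce to `a + b x = 0`, but
one of the two initial data is `1`. -/
lemma exists_bsol_ne_zero (bc : BoundaryCondition) (q : Coeff) :
    ∃ η ∈ Set.Icc 0 Real.pi, bsol bc q η ≠ 0 := by
  by_contra! hz
  have hi : ivp bc.initVal bc.initSlope q = 0 := by
    ext x; rw [← sol_coe]; exact hz x x.2
  have ha : bc.initVal = 0 := by
    rw [← sol_zero bc.initVal bc.initSlope q]; exact hz 0 ⟨le_rfl, Real.pi_pos.le⟩
  have hb : bc.initSlope = 0 := by
    have h1 := ivp_eq bc.initVal bc.initSlope q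
    rw [ivpDeriv, hi, ha, mul_zero, map_zero, add_zero, primitiveL_one, zero_smul,
      zero_add] at h1
    have h2 := DFunLike.congr_fun h1 (⟨Real.pi, Real.pi_pos.le, le_rfl⟩ : HalfPeriod)
    simpa [coord, Real.pi_ne_zero] using h2.symm
  cases bc with
  | dirichlet => exact one_ne_zero hb
  | neumann => exact one_ne_zero ha

/-- The boundary value problem `u'' = q u` has a nontrivial solution iff `charFn` vanishes. -/
lemma charFn_eq_zero_iff (bc : BoundaryCondition) (q : Coeff) :
    charFn bc q = 0 ↔ ∃ ψ dψ : ℝ → ℂ,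
      (∀ η ∈ Set.Icc 0 Real.pi, HasDerivWithinAt ψ (dψ η) (Set.Icc 0 Real.pi) η) ∧
      (∀ η ∈ Set.Icc 0 Real.pi,
        HasDerivWithinAt dψ (ext q η * ψ η) (Set.Icc 0 Real.pi) η) ∧
      bc.Holds ψ dψ ∧ ∃ η ∈ Set.Icc 0 Real.pi, ψ η ≠ 0 := by
  have h0 : (0 : ℝ) ∈ Set.Icc 0 Real.pi := ⟨le_rfl, Real.pi_pos.le⟩
  have hpi : Real.pi ∈ Set.Icc 0 Real.pi := ⟨Real.pi_pos.le, le_rfl⟩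
  constructor
  · intro h
    refine ⟨bsol bc q, dbsol bc q, fun η hη => (hasDerivAt_sol _ _ _ hη).hasDerivWithinAt,
      fun η hη => (hasDerivAt_dsol _ _ _ hη).hasDerivWithinAt, ?_, ?_⟩
    · cases bc with
      | dirichlet => exact ⟨sol_zero _ _ _, h⟩
      | neumann => exact ⟨dsol_zero _ _ _, h⟩
    · exact exists_bsol_ne_zero bc q
  · rintro ⟨ψ, dψ, h1, h2, hbc, η, hη, hne⟩
    have hu := eq_sol_of_hasDerivWithinAt h1 h2
    cases bc with
    | dirichlet =>
      have hc : ψ Real.pi = dψ 0 * charFn .dirichlet q := by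
        rw [(hu _ hpi).1, hbc.1]
        have := mul_sol 0 1 (dψ 0) q ⟨Real.pi, hpi⟩
        rw [mul_zero, mul_one] at this
        exact this.symm
      rw [hbc.2] at hc
      rcases mul_eq_zero.1 hc.symm with h | h
      · exfalso; apply hne
        rw [(hu _ hη).1, hbc.1, h]
        have := mul_sol 0 0 0 q ⟨η, hη⟩
        simpa using this.symm
      · exact h
    | neumann =>
      have hc : dψ Real.pi = ψ 0 * charFn .neumann q := by
        rw [(hu _ hpi).2, hbc.1]
        have := mul_dsol 1 0 (ψ 0) q ⟨Real.pi, hpi⟩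
        rw [mul_zero, mul_one] at this
        exact this.symm
      rw [hbc.2] at hc
      rcases mul_eq_zero.1 hc.symm with h | h
      · exfalso; apply hne
        rw [(hu _ hη).1, hbc.1, h]
        have := mul_sol 0 0 0 q ⟨η, hη⟩
        simpa using this.symm
      · exact h

/-- The unperturbed potential `γ₁ cos η + γ₂ cos 2η`. -/
noncomputable def basePot (γ₁ γ₂ : ℝ) : Coeff :=
  ⟨fun x => ((γ₁ * Real.cos x + γ₂ * Real.cos (2 * x) : ℝ) : ℂ), by fun_prop⟩

/-- The perturbing potential `1 + cos 2η`. -/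
noncomputable def pertPot : Coeff := ⟨fun x => ((1 + Real.cos (2 * x) : ℝ) : ℂ), by fun_prop⟩

/-- The coefficient of `ψ` in `ψ'' = (V - λ) ψ`. -/
noncomputable def hillCoeff (γ₁ γ₂ : ℝ) (β lam : ℂ) : Coeff :=
  basePot γ₁ γ₂ + β • pertPot - lam • 1

lemma hillCoeff_apply (γ₁ γ₂ : ℝ) (β lam : ℂ) (x : HalfPeriod) :
    hillCoeff γ₁ γ₂ β lam x = potential γ₁ γ₂ β x - lam := by
  simp [hillCoeff, basePot, pertPot, potential]

lemma isEigenvalue_iff (bc : BoundaryCondition) (γ₁ γ₂ : ℝ) (β lam : ℂ) :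
    IsEigenvalue bc γ₁ γ₂ β lam ↔ charFn bc (hillCoeff γ₁ γ₂ β lam) = 0 := by
  rw [charFn_eq_zero_iff, IsEigenvalue]
  have : ∀ η ∈ Set.Icc 0 Real.pi, ext (hillCoeff γ₁ γ₂ β lam) η = potential γ₁ γ₂ β η - lam :=
    fun η hη => by rw [ext_apply _ hη, hillCoeff_apply]
  constructor
  · rintro ⟨ψ, dψ, h1, h2, h3⟩
    exact ⟨ψ, dψ, h1, fun η hη => by rw [this η hη]; exact h2 η hη, h3⟩
  · rintro ⟨ψ, dψ, h1, h2, h3⟩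
    exact ⟨ψ, dψ, h1, fun η hη => by rw [← this η hη]; exact h2 η hη, h3⟩

/-! ### Holomorphic families -/

/-- A continuous family of continuous functions that is pointwise holomorphic is holomorphic. -/
lemma differentiableOn_continuousMap {K : Type*} [TopologicalSpace K] [CompactSpace K] {U : Set ℂ}
    (hU : IsOpen U) {F : ℂ → C(K, ℂ)} (hF : ContinuousOn F U)
    (hd : ∀ t, DifferentiableOn ℂ (fun e => F e t) U) : DifferentiableOn ℂ F U := by
  intro e₀ he₀
  obtain ⟨R, hR, hball⟩ := Metric.isOpen_iff.1 hU e₀ he₀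
  let r : NNReal := ⟨R / 2, by positivity⟩
  have hr : 0 < r := by change (0 : ℝ) < R / 2; positivity
  have hsub : Metric.closedBall e₀ (r : ℝ) ⊆ U :=
    (Metric.closedBall_subset_ball (by change R / 2 < R; linarith)).trans hball
  have hci : CircleIntegrable F e₀ r :=
    (hF.mono (Metric.sphere_subset_closedBall.trans hsub)).circleIntegrable r.2
  have hps := hasFPowerSeriesOn_cauchy_integral hci hr
  -- The vector-valued Cauchy integral is analytic in `w` for any `F` continuous on the circle.
  -- Evaluation at `t` commutes with the integral, so the scalar Cauchy formula identifies it with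
  -- `F w` point by point.
  have heq : ∀ w ∈ Metric.ball e₀ (r : ℝ),
      (2 * ↑Real.pi * Complex.I)⁻¹ • ∮ z in C(e₀, r), (z - w)⁻¹ • F z = F w := by
    intro w hw
    ext t
    let ev : C(K, ℂ) →L[ℂ] ℂ := ContinuousMap.evalCLM ℂ t
    have h1 : ev (∮ z in C(e₀, r), (z - w)⁻¹ • F z) = ∮ z in C(e₀, r), (z - w)⁻¹ • F z t := by
      have hcont : ContinuousOn (fun z => (z - w)⁻¹ • F z) (Metric.sphere e₀ r) := by
        refine ContinuousOn.smul (ContinuousOn.inv₀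
          (continuous_id.sub continuous_const).continuousOn fun z hz => ?_)
          (hF.mono (Metric.sphere_subset_closedBall.trans hsub))
        intro h0
        rw [sub_eq_zero.1 (show z - w = 0 from h0)] at hz
        exact absurd hw (by rw [Metric.mem_ball, Metric.mem_sphere.1 hz]; exact lt_irrefl _)
      have hint : CircleIntegrable (fun z => (z - w)⁻¹ • F z) e₀ r := hcont.circleIntegrable r.2
      rw [circleIntegral, ← ContinuousLinearMap.intervalIntegral_comp_comm ev hint.out]
      simp [circleIntegral, ev]
    have h2 : DiffContOnCl ℂ (fun e => F e t) (Metric.ball e₀ r) :=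
      ((hd t).mono hsub).diffContOnCl_ball le_rfl
    have h3 := h2.two_pi_i_inv_smul_circleIntegral_sub_inv_smul hw
    have h4 : ev ((2 * ↑Real.pi * Complex.I)⁻¹ • ∮ z in C(e₀, r), (z - w)⁻¹ • F z) = F w t := by
      rw [map_smul, h1]
      exact h3
    exact h4
  have han : DifferentiableAt ℂ
      (fun w => (2 * ↑Real.pi * Complex.I)⁻¹ • ∮ z in C(e₀, r), (z - w)⁻¹ • F z) e₀ :=
    hps.analyticAt.differentiableAt
  refine (han.congr_of_eventuallyEq ?_).differentiableWithinAt
  filter_upwards [Metric.ball_mem_nhds e₀ (show (0 : ℝ) < r from hr)] with w hw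
  exact (heq w hw).symm

/-- Joint continuity gives continuity of the curried map. -/
lemma continuousOn_continuousMap {K P : Type*} [TopologicalSpace K] [TopologicalSpace P]
    {U : Set P} {F : P → C(K, ℂ)} (hc : ContinuousOn (fun p : P × K => F p.1 p.2) (U ×ˢ Set.univ)) : ContinuousOn F U := by
  rw [continuousOn_iff_continuous_domRestrict]
  refine ContinuousMap.continuous_of_continuous_uncurry _ ?_
  exact hc.comp_continuous (f := fun p : U × K => ((p.1 : P), p.2)) (by fun_prop)
    fun p => ⟨p.1.2, trivial⟩

/-- A jointly continuous, pointwise holomorphic function is a holomorphic family. -/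
lemma differentiableOn_continuousMap_of_joint {K : Type*} [TopologicalSpace K] [CompactSpace K]
    {U : Set ℂ} (hU : IsOpen U) {F : ℂ → C(K, ℂ)}
    (hc : ContinuousOn (fun p : ℂ × K => F p.1 p.2) (U ×ˢ Set.univ))
    (hd : ∀ t, DifferentiableOn ℂ (fun e => F e t) U) : DifferentiableOn ℂ F U :=
  differentiableOn_continuousMap hU (continuousOn_continuousMap hc) hd

/-- The fixed point of a holomorphic family of contractions is holomorphic. -/
lemma exists_holomorphic_fixedPoint {E : Type*} [NormedAddCommGroup E] [NormedSpace ℂ E]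
    [CompleteSpace E] {S : Set ℂ} (hS : IsOpen S) {T : ℂ → E → E} {c : E} {r κ : ℝ} (hr : 0 ≤ r)
    (hκ : κ < 1)
    (hmaps : ∀ u ∈ S, ∀ x ∈ Metric.closedBall c r, T u x ∈ Metric.closedBall c r)
    (hlip : ∀ u ∈ S, ∀ x ∈ Metric.closedBall c r, ∀ y ∈ Metric.closedBall c r,
      dist (T u x) (T u y) ≤ κ * dist x y)
    (hhol : ∀ g : ℂ → E, DifferentiableOn ℂ g S → Set.MapsTo g S (Metric.closedBall c r) →
      DifferentiableOn ℂ (fun u => T u (g u)) S) :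
    ∃ g : ℂ → E, DifferentiableOn ℂ g S ∧ Set.MapsTo g S (Metric.closedBall c r) ∧
      ∀ u ∈ S, T u (g u) = g u := by
  -- Only `κ < 1` is assumed; a negative constant may be replaced by `0`, after which the powers of
  -- `κ` tend to zero.
  wlog hκ0 : 0 ≤ κ generalizing κ
  · refine this (κ := 0) zero_lt_one (fun u hu x hx y hy => (hlip u hu x hx y hy).trans ?_) le_rfl
    exact mul_le_mul_of_nonneg_right (not_le.1 hκ0).le dist_nonneg
  let G : ℕ → ℂ → E := fun n u => (T u)^[n] c
  have hG0 : ∀ u, G 0 u = c := fun u => rfl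
  have hGs : ∀ n u, G (n + 1) u = T u (G n u) := fun n u => Function.iterate_succ_apply' _ _ _
  have hmem : ∀ n, ∀ u ∈ S, G n u ∈ Metric.closedBall c r := by
    intro n
    induction n with
    | zero => intro u _; rw [hG0]; exact Metric.mem_closedBall_self hr
    | succ n ih => intro u hu; rw [hGs]; exact hmaps u hu _ (ih u hu)
  have hdiff : ∀ n, DifferentiableOn ℂ (G n) S := by
    intro n
    induction n with
    | zero => exact differentiableOn_const c
    | succ n ih =>
      have : G (n + 1) = fun u => T u (G n u) := funext (hGs n)
      rw [this]; exact hhol _ ih (hmem n)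
  have hgeo : ∀ u ∈ S, ∀ n, dist (G n u) (G (n + 1) u) ≤ r * κ ^ n := by
    intro u hu n
    induction n with
    | zero =>
      rw [pow_zero, mul_one, dist_comm]
      simpa [hG0] using hmem 1 u hu
    | succ n ih =>
      rw [hGs n, hGs (n + 1)]
      calc _ ≤ κ * dist (G n u) (G (n + 1) u) := hlip u hu _ (hmem _ u hu) _ (hmem _ u hu)
        _ ≤ κ * (r * κ ^ n) := by gcongr
        _ = r * κ ^ (n + 1) := by ring
  have hlim : ∀ u, ∃ a, u ∈ S → Tendsto (fun n => G n u) atTop (𝓝 a) := by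
    intro u
    by_cases hu : u ∈ S
    · obtain ⟨a, ha⟩ := cauchySeq_tendsto_of_complete
        (cauchySeq_of_le_geometric κ r hκ (hgeo u hu))
      exact ⟨a, fun _ => ha⟩
    · exact ⟨c, fun h => absurd h hu⟩
  choose g hg using hlim
  have hgmem : Set.MapsTo g S (Metric.closedBall c r) := fun u hu =>
    Metric.isClosed_closedBall.mem_of_tendsto (hg u hu) (Eventually.of_forall fun n => hmem n u hu)
  refine ⟨g, ?_, hgmem, ?_⟩
  -- The iterates are holomorphic and the geometric tail bound does not depend on `u`; a uniform
  -- limit of holomorphic maps is holomorphic.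
  · refine TendstoLocallyUniformlyOn.differentiableOn (φ := atTop) (F := G)
      (TendstoUniformlyOn.tendstoLocallyUniformlyOn ?_) (Eventually.of_forall hdiff) hS
    rw [Metric.tendstoUniformlyOn_iff]
    intro ε hε
    have h0 : Tendsto (fun n : ℕ => r * κ ^ n / (1 - κ)) atTop (𝓝 0) := by
      have := (tendsto_pow_atTop_nhds_zero_of_lt_one hκ0 hκ).const_mul r
      simpa using this.div_const (1 - κ)
    filter_upwards [h0.eventually_lt_const hε] with n hn u hu
    rw [dist_comm]
    exact (dist_le_of_le_geometric_of_tendsto κ r hκ (hgeo u hu) (hg u hu) n).trans_lt hn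
  · intro u hu
    have h1 : Tendsto (fun n => G (n + 1) u) atTop (𝓝 (g u)) :=
      (hg u hu).comp (tendsto_add_atTop_nat 1)
    have h2 : Tendsto (fun n => G (n + 1) u) atTop (𝓝 (T u (g u))) := by
      rw [tendsto_iff_dist_tendsto_zero] at *
      refine squeeze_zero (fun _ => dist_nonneg) (fun n => ?_)
        (by simpa using (tendsto_iff_dist_tendsto_zero.1 (hg u hu)).const_mul κ)
      rw [hGs]
      exact hlip u hu _ (hmem n u hu) _ (hgmem hu)
    exact tendsto_nhds_unique h2 h1

/-- Uniqueness of fixed points of contractions. -/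
lemma eq_of_fixedPoint {E : Type*} [NormedAddCommGroup E] {s : Set E} {T : E → E} {κ : ℝ}
    (hκ : κ < 1) (hlip : ∀ x ∈ s, ∀ y ∈ s, dist (T x) (T y) ≤ κ * dist x y)
    {x y : E} (hx : x ∈ s) (hy : y ∈ s) (hTx : T x = x) (hTy : T y = y) : x = y := by
  have h := hlip x hx y hy
  rw [hTx, hTy] at h
  have : dist x y ≤ 0 := by nlinarith [dist_nonneg (x := x) (y := y)]
  exact dist_le_zero.1 this

/-- Bounded holomorphic functions are Lipschitz on smaller balls. -/
lemma lipschitz_of_bounded {f : ℂ → ℂ} {c : ℂ} {r R C : ℝ} (hrR : r < R)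
    (hf : DifferentiableOn ℂ f (Metric.ball c R)) (hC : ∀ z ∈ Metric.ball c R, ‖f z‖ ≤ C)
    {x y : ℂ} (hx : x ∈ Metric.closedBall c r) (hy : y ∈ Metric.closedBall c r) :
    dist (f x) (f y) ≤ 2 * C / (R - r) * dist x y := by
  -- Cauchy's estimate on circles of half the gap, which stay inside the open ball.
  have hd : ∀ z ∈ Metric.closedBall c r, ‖deriv f z‖ ≤ C / ((R - r) / 2) := by
    intro z hz
    have hsub : Metric.closedBall z ((R - r) / 2) ⊆ Metric.ball c R := fun w hw => by
      rw [Metric.mem_closedBall] at hw hz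
      rw [Metric.mem_ball]
      linarith [dist_triangle w z c]
    refine Complex.norm_deriv_le_of_forall_mem_sphere_norm_le (by linarith)
      ((hf.mono hsub).diffContOnCl_ball le_rfl) fun w hw => ?_
    exact hC w (hsub (Metric.sphere_subset_closedBall hw))
  have h := (convex_closedBall c r).norm_image_sub_le_of_norm_deriv_le (𝕜 := ℂ)
    (fun z hz => hf.differentiableAt (Metric.isOpen_ball.mem_nhds
      (Metric.closedBall_subset_ball hrR hz))) hd hy hx
  rw [dist_eq_norm, dist_eq_norm]
  convert h using 2
  field_simp

/-! ### Sturm theory for real coefficients -/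

/-- The right end point. -/
noncomputable def piPt : HalfPeriod := ⟨Real.pi, Real.pi_pos.le, le_rfl⟩

/-- The Wronskian of two solutions with different coefficients. -/
lemma wronskian (a₁ b₁ a₂ b₂ : ℂ) (q₁ q₂ : Coeff) (x : HalfPeriod) :
    sol a₁ b₁ q₁ x * dsol a₂ b₂ q₂ x - dsol a₁ b₁ q₁ x * sol a₂ b₂ q₂ x
      = (a₁ * b₂ - b₁ * a₂) + primitiveL ((q₂ - q₁) * ivp a₁ b₁ q₁ * ivp a₂ b₂ q₂) x := by
  have h := eq_add_integral_of_hasDerivWithinAt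
    (f := fun x => sol a₁ b₁ q₁ x * dsol a₂ b₂ q₂ x - dsol a₁ b₁ q₁ x * sol a₂ b₂ q₂ x)
    (fun y hy => (((hasDerivAt_sol a₁ b₁ q₁ hy).mul (hasDerivAt_dsol a₂ b₂ q₂ hy)).sub
      ((hasDerivAt_dsol a₁ b₁ q₁ hy).mul (hasDerivAt_sol a₂ b₂ q₂ hy))).hasDerivWithinAt)
    ((q₂ - q₁) * ivp a₁ b₁ q₁ * ivp a₂ b₂ q₂)
    (fun y => by
      simp only [ContinuousMap.mul_apply, ContinuousMap.sub_apply, ext_coe, sol_coe]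
      ring) x
  simpa [sol_zero, dsol_zero, primitiveL_apply] using h

/-- Real-valued coefficients. -/
def IsRealCoeff (q : Coeff) : Prop := ∀ x, (q x).im = 0

/-- The complex conjugate solves the same initial value problem, so uniqueness makes the solution
equal to its conjugate. -/
lemma IsRealCoeff.sol_im {q : Coeff} (hq : IsRealCoeff q) {a b : ℂ} (ha : a.im = 0)
    (hb : b.im = 0) {x : ℝ} (hx : x ∈ Set.Icc 0 Real.pi) :
    (sol a b q x).im = 0 ∧ (dsol a b q x).im = 0 := by
  have h := eq_sol_of_hasDerivWithinAt (q := q) (f := fun x => star (sol a b q x))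
    (f' := fun x => star (dsol a b q x))
    (fun y hy => (hasDerivAt_sol a b q hy).star.hasDerivWithinAt)
    (fun y hy => by
      have h1 := (hasDerivAt_dsol a b q hy).star.hasDerivWithinAt (s := Set.Icc 0 Real.pi)
      have h2 : star (ext q y) = ext q y := by
        rw [ext_apply q hy]; exact Complex.conj_eq_iff_im.2 (hq _)
      rwa [star_mul', h2] at h1) x hx
  simp only [sol_zero, dsol_zero] at h
  have ha' : star a = a := Complex.conj_eq_iff_im.2 ha
  have hb' : star b = b := Complex.conj_eq_iff_im.2 hb
  rw [ha', hb'] at h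
  exact ⟨Complex.conj_eq_iff_im.1 h.1, Complex.conj_eq_iff_im.1 h.2⟩

lemma BoundaryCondition.initVal_im (bc : BoundaryCondition) : bc.initVal.im = 0 := by
  cases bc <;> simp [initVal]

lemma BoundaryCondition.initSlope_im (bc : BoundaryCondition) : bc.initSlope.im = 0 := by
  cases bc <;> simp [initSlope]

/-! ### The Prüfer curve and the rotation number -/

/-- The Prüfer plane curve `u' + i u`. -/
noncomputable def prufer (bc : BoundaryCondition) (q : Coeff) : Coeff :=
  ivpDeriv bc.initVal bc.initSlope q + Complex.I • ivp bc.initVal bc.initSlope q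

/-- The derivative of the Prüfer plane curve. -/
noncomputable def pruferDeriv (bc : BoundaryCondition) (q : Coeff) : Coeff :=
  q * ivp bc.initVal bc.initSlope q + Complex.I • ivpDeriv bc.initVal bc.initSlope q

lemma prufer_apply (bc : BoundaryCondition) (q : Coeff) (x : HalfPeriod) :
    prufer bc q x = dbsol bc q x + Complex.I * bsol bc q x := by
  simp [prufer, sol_coe, dsol_coe]

lemma IsRealCoeff.prufer_re {q : Coeff} (hq : IsRealCoeff q) (bc : BoundaryCondition)
    (x : HalfPeriod) : (prufer bc q x).re = (dbsol bc q x).re := by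
  simp [prufer_apply, (hq.sol_im bc.initVal_im bc.initSlope_im x.2).1]

lemma IsRealCoeff.prufer_im {q : Coeff} (hq : IsRealCoeff q) (bc : BoundaryCondition)
    (x : HalfPeriod) : (prufer bc q x).im = (bsol bc q x).re := by
  simp [prufer_apply, (hq.sol_im bc.initVal_im bc.initSlope_im x.2).2]

/-- The Wronskian with the solution whose initial data are `(-b, a)` is constant and equals `a² + b²
= 1`. -/
lemma sol_ne_zero_or (bc : BoundaryCondition) (q : Coeff) (x : HalfPeriod) :
    bsol bc q x ≠ 0 ∨ dbsol bc q x ≠ 0 := by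
  by_contra! h
  have hw := wronskian bc.initVal bc.initSlope (-bc.initSlope) bc.initVal q q x
  rw [show sol bc.initVal bc.initSlope q x = 0 from h.1,
    show dsol bc.initVal bc.initSlope q x = 0 from h.2, sub_self] at hw
  simp only [zero_mul, map_zero, ContinuousMap.zero_apply] at hw
  cases bc <;> simp [BoundaryCondition.initVal, BoundaryCondition.initSlope] at hw

lemma IsRealCoeff.prufer_ne_zero {q : Coeff} (hq : IsRealCoeff q) (bc : BoundaryCondition)
    (x : HalfPeriod) : prufer bc q x ≠ 0 := by
  intro h
  have h1 := hq.prufer_re bc x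
  have h2 := hq.prufer_im bc x
  rw [h] at h1 h2
  have h3 := hq.sol_im bc.initVal_im bc.initSlope_im x.2
  rcases sol_ne_zero_or bc q x with h4 | h4
  · exact h4 (Complex.ext h2.symm h3.1)
  · exact h4 (Complex.ext h1.symm h3.2)

/-- The logarithmic derivative of the Prüfer plane curve. -/
noncomputable def pruferRate (bc : BoundaryCondition) (q : Coeff) (x : ℝ) : ℂ :=
  ext (pruferDeriv bc q) x / ext (prufer bc q) x

/-- A logarithm of the Prüfer plane curve, vanishing at `0`. -/
noncomputable def pruferLog (bc : BoundaryCondition) (q : Coeff) (x : ℝ) : ℂ :=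
  ∫ s in (0 : ℝ)..x, pruferRate bc q s

/-- The number of half turns of the Prüfer plane curve on `[0, π]`. -/
noncomputable def rot (bc : BoundaryCondition) (q : Coeff) : ℝ :=
  (pruferLog bc q Real.pi).im / Real.pi

lemma ext_ne_zero {f : Coeff} (hf : ∀ x, f x ≠ 0) (x : ℝ) : ext f x ≠ 0 := by
  simp only [ext, ContinuousMap.coe_IccExtend, Set.IccExtend, Function.comp_apply]
  exact hf _

lemma IsRealCoeff.continuous_pruferRate {q : Coeff} (hq : IsRealCoeff q)
    (bc : BoundaryCondition) : Continuous (pruferRate bc q) :=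
  (ext _).continuous.div (ext _).continuous (ext_ne_zero (hq.prufer_ne_zero bc))

lemma hasDerivAt_prufer (bc : BoundaryCondition) (q : Coeff) {x : ℝ}
    (hx : x ∈ Set.Icc 0 Real.pi) :
    HasDerivAt (fun x => dbsol bc q x + Complex.I * bsol bc q x) (pruferDeriv bc q ⟨x, hx⟩) x := by
  have h := (hasDerivAt_dsol bc.initVal bc.initSlope q hx).add
    ((hasDerivAt_sol bc.initVal bc.initSlope q hx).const_mul Complex.I)
  refine h.congr_deriv ?_
  simp [pruferDeriv, ext_apply q hx, sol_coe _ _ _ ⟨x, hx⟩, dsol_coe _ _ _ ⟨x, hx⟩]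

/-- The initial point of the Prüfer plane curve. -/
noncomputable def BoundaryCondition.start (bc : BoundaryCondition) : ℂ :=
  bc.initSlope + Complex.I * bc.initVal

/-- The product of the curve with `exp (-pruferLog)` has derivative zero. The integral defines a
continuous argument without any choice of branch. -/
lemma IsRealCoeff.prufer_eq_exp {q : Coeff} (hq : IsRealCoeff q) (bc : BoundaryCondition)
    (x : HalfPeriod) : prufer bc q x = bc.start * Complex.exp (pruferLog bc q x) := by
  have hL : ∀ y, HasDerivAt (pruferLog bc q) (pruferRate bc q y) y := fun y =>
    ((hq.continuous_pruferRate bc).integral_hasStrictDerivAt 0 y).hasDerivAt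
  have hd : ∀ y ∈ Set.Icc 0 Real.pi, HasDerivAt
      (fun y => (dbsol bc q y + Complex.I * bsol bc q y) * Complex.exp (-pruferLog bc q y)) 0 y := by
    intro y hy
    have h := (hasDerivAt_prufer bc q hy).mul (hL y).neg.cexp
    refine h.congr_deriv ?_
    have hne : prufer bc q ⟨y, hy⟩ ≠ 0 := hq.prufer_ne_zero bc ⟨y, hy⟩
    have h2 : dbsol bc q y + Complex.I * bsol bc q y = prufer bc q ⟨y, hy⟩ :=
      (prufer_apply bc q ⟨y, hy⟩).symm
    rw [h2, pruferRate, ext_apply _ hy, ext_apply _ hy]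
    simp only [Pi.neg_apply]
    field_simp
    ring
  have hconst := constant_of_has_deriv_right_zero
    (fun y hy => (hd y hy).continuousAt.continuousWithinAt)
    (fun y hy => (hd y ⟨hy.1, hy.2.le⟩).hasDerivWithinAt) x x.2
  rw [← prufer_apply] at hconst
  have h0 : (dbsol bc q 0 + Complex.I * bsol bc q 0) * Complex.exp (-pruferLog bc q 0)
      = bc.start := by
    simp [pruferLog, sol_zero, dsol_zero, BoundaryCondition.start]
  rw [h0, Complex.exp_neg] at hconst
  rw [← hconst]
  field_simp [Complex.exp_ne_zero]

lemma pruferLog_pi_im (bc : BoundaryCondition) (q : Coeff) :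
    (pruferLog bc q Real.pi).im = rot bc q * Real.pi := by
  rw [rot, div_mul_cancel₀ _ Real.pi_ne_zero]

/-- The rotation number depends continuously on real coefficients. -/
lemma continuous_rot (bc : BoundaryCondition) {q : ℝ → Coeff} (hq : Continuous q)
    (hr : ∀ t, IsRealCoeff (q t)) : Continuous fun t => rot bc (q t) := by
  have hext : ∀ f : ℝ → Coeff, Continuous f → Continuous fun p : ℝ × ℝ => ext (f p.1) p.2 := by
    intro f hf
    simp only [ext, ContinuousMap.coe_IccExtend, Set.IccExtend, Function.comp_apply]
    have h1 : Continuous fun p : ℝ × ℝ => Set.projIcc 0 Real.pi Real.pi_pos.le p.2 :=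
      continuous_projIcc.comp continuous_snd
    exact (hf.comp continuous_fst).eval h1
  have hu : Continuous fun t => ivp bc.initVal bc.initSlope (q t) :=
    (differentiable_ivp _ _).continuous.comp hq
  have hv : Continuous fun t => ivpDeriv bc.initVal bc.initSlope (q t) :=
    (differentiable_ivpDeriv _ _).continuous.comp hq
  have h1 : Continuous fun t => prufer bc (q t) := hv.add (hu.const_smul Complex.I)
  have h2 : Continuous fun t => pruferDeriv bc (q t) := (hq.mul hu).add (hv.const_smul Complex.I)
  -- Joint continuity of the integrand in parameter and position gives continuity of its integral
  -- over the fixed interval, hence of the lifted angle.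
  have h3 : Continuous fun p : ℝ × ℝ => pruferRate bc (q p.1) p.2 :=
    (hext _ h2).div (hext _ h1) fun p => ext_ne_zero ((hr p.1).prufer_ne_zero bc) p.2
  have h4 : Continuous fun t => pruferLog bc (q t) Real.pi :=
    intervalIntegral.continuous_parametric_intervalIntegral_of_continuous' h3 0 Real.pi
  exact (Complex.continuous_im.comp h4).div_const _

/-- The characteristic function in terms of the rotation number. -/
lemma IsRealCoeff.charFn_eq {q : Coeff} (hq : IsRealCoeff q) (bc : BoundaryCondition) :
    ∃ c : ℝ, c ≠ 0 ∧ charFn bc q = ((c * Real.sin (rot bc q * Real.pi) : ℝ) : ℂ) := by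
  have h := hq.prufer_eq_exp bc piPt
  have hre := hq.prufer_re bc piPt
  have him := hq.prufer_im bc piPt
  have hs := hq.sol_im bc.initVal_im bc.initSlope_im piPt.2
  have hL : pruferLog bc q piPt = pruferLog bc q Real.pi := rfl
  rw [h, hL] at hre him
  -- The curve starts at `1` for Dirichlet, where the characteristic function is its imaginary part,
  -- and at `i` for Neumann, where it is the real part. Since `Re (i e^L) = -e^{Re L} sin (Im L)`,
  -- the factor `c` is negative in the Neumann case.
  cases bc with
  | dirichlet =>
    refine ⟨Real.exp (pruferLog .dirichlet q Real.pi).re, (Real.exp_pos _).ne', ?_⟩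
    refine Complex.ext ?_ hs.1
    simp only [BoundaryCondition.start, BoundaryCondition.initSlope, BoundaryCondition.initVal,
      mul_zero, add_zero, one_mul, Complex.exp_im, pruferLog_pi_im] at him
    rw [Complex.ofReal_re, him]; rfl
  | neumann =>
    refine ⟨-Real.exp (pruferLog .neumann q Real.pi).re, neg_ne_zero.2 (Real.exp_pos _).ne', ?_⟩
    refine Complex.ext ?_ hs.2
    simp only [BoundaryCondition.start, BoundaryCondition.initSlope, BoundaryCondition.initVal,
      mul_one, zero_add, Complex.mul_re, Complex.I_re, Complex.I_im, zero_mul, one_mul, zero_sub,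
      Complex.exp_im, pruferLog_pi_im] at hre
    rw [Complex.ofReal_re, neg_mul, hre]; rfl

lemma IsRealCoeff.charFn_eq_zero_iff {q : Coeff} (hq : IsRealCoeff q) (bc : BoundaryCondition) :
    charFn bc q = 0 ↔ ∃ j : ℤ, rot bc q = j := by
  obtain ⟨c, hc, h⟩ := hq.charFn_eq bc
  rw [h, Complex.ofReal_eq_zero, mul_eq_zero, or_iff_right hc, Real.sin_eq_zero_iff]
  refine exists_congr fun j => ?_
  rw [eq_comm, mul_left_inj' Real.pi_ne_zero]

/-! ### Dependence on the spectral parameter -/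

/-- The spectral shift `q - λ`. -/
noncomputable def shift (q : Coeff) (lam : ℂ) : Coeff := q - lam • 1

lemma IsRealCoeff.shift {q : Coeff} (hq : IsRealCoeff q) (lam : ℝ) :
    IsRealCoeff (shift q lam) := fun x => by simp [AngularHill.shift, hq x]

lemma continuous_shift (q : Coeff) : Continuous (shift q) := by unfold shift; fun_prop

/-- Lagrange's identity. Both solutions have the same initial data, so the boundary term at `0`
cancels. Simplicity of eigenvalues and monotonicity of the rotation number both come from it. -/
lemma wronskian_shift (bc : BoundaryCondition) (q : Coeff) (lam mu : ℂ) :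
    bsol bc (shift q lam) Real.pi * dbsol bc (shift q mu) Real.pi
        - dbsol bc (shift q lam) Real.pi * bsol bc (shift q mu) Real.pi
      = (lam - mu) * primitiveL (ivp bc.initVal bc.initSlope (shift q lam) *
          ivp bc.initVal bc.initSlope (shift q mu)) piPt := by
  have h := wronskian bc.initVal bc.initSlope bc.initVal bc.initSlope (shift q lam) (shift q mu)
    piPt
  have h2 : (shift q mu - shift q lam) = (lam - mu) • 1 := by
    simp only [shift, sub_smul]; abel
  rw [h2, smul_one_mul, smul_mul_assoc, map_smul] at h
  rw [mul_comm bc.initVal, sub_self, zero_add] at h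
  exact h

/-- The squared norm of a real solution is positive. -/
lemma IsRealCoeff.integral_sq_pos {q : Coeff} (hq : IsRealCoeff q) (bc : BoundaryCondition) :
    ∃ c : ℝ, 0 < c ∧ primitiveL (ivp bc.initVal bc.initSlope q *
      ivp bc.initVal bc.initSlope q) piPt = c := by
  obtain ⟨x₀, hx₀, hne⟩ := exists_bsol_ne_zero bc q
  have hreal : ∀ x ∈ Set.Icc 0 Real.pi, bsol bc q x = ((bsol bc q x).re : ℂ) := fun x hx =>
    Complex.ext rfl (hq.sol_im bc.initVal_im bc.initSlope_im hx).1
  refine ⟨∫ x in (0 : ℝ)..Real.pi, (bsol bc q x).re ^ 2, ?_, ?_⟩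
  · refine intervalIntegral.integral_pos Real.pi_pos ?_ (fun x _ => sq_nonneg _)
      ⟨x₀, hx₀, ?_⟩
    · exact ((Complex.continuous_re.comp (continuous_sol _ _ q)).pow 2).continuousOn
    · have : (bsol bc q x₀).re ≠ 0 := fun h => hne (by rw [hreal x₀ hx₀, h]; rfl)
      positivity
  · rw [primitiveL_apply, ← intervalIntegral.integral_ofReal]
    refine intervalIntegral.integral_congr fun x hx => ?_
    have hx' : x ∈ Set.Icc 0 Real.pi := by
      have h1 : x ∈ Set.uIcc 0 Real.pi := hx
      rwa [Set.uIcc_of_le Real.pi_pos.le] at h1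
    rw [ext_apply _ hx', ContinuousMap.mul_apply, ← sol_coe, Complex.ofReal_pow, ← hreal x hx',
      sq]

/-- Real eigenvalues are simple zeros of the characteristic function. -/
lemma IsRealCoeff.exists_hasDerivAt_charFn {q : Coeff} (hq : IsRealCoeff q)
    (bc : BoundaryCondition) {lam : ℝ} (h : charFn bc (AngularHill.shift q lam) = 0) :
    ∃ d : ℂ, d ≠ 0 ∧ HasDerivAt (fun mu : ℂ => charFn bc (AngularHill.shift q mu)) d lam := by
  obtain ⟨c, hc, hcI⟩ := (hq.shift lam).integral_sq_pos bc
  let I : ℂ → ℂ := fun mu => primitiveL (ivp bc.initVal bc.initSlope (AngularHill.shift q lam) *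
          ivp bc.initVal bc.initSlope (AngularHill.shift q mu)) piPt
  have hI : Continuous I := by
    have h1 : Continuous fun mu => ivp bc.initVal bc.initSlope (AngularHill.shift q mu) :=
      (differentiable_ivp _ _).continuous.comp (continuous_shift q)
    exact (ContinuousMap.evalCLM ℂ piPt).continuous.comp
      (primitiveL.continuous.comp (continuous_const.mul h1))
  -- At an eigenvalue one boundary term of the Wronskian at `π` drops out, leaving `k · charFn (mu)
  -- = (mu - lam) I(mu)`. The difference quotient is therefore `I(mu) / k`, with limit `∫ u² / k ≠
  -- 0`.
  have key : ∀ k : ℂ, k ≠ 0 →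
      (∀ mu, k * charFn bc (AngularHill.shift q mu) = (mu - lam) * I mu) →
      ∃ d : ℂ, d ≠ 0 ∧ HasDerivAt (fun mu : ℂ => charFn bc (AngularHill.shift q mu)) d lam := by
    intro k hk hmu
    refine ⟨I lam / k, div_ne_zero ?_ hk, ?_⟩
    · change primitiveL _ piPt ≠ 0
      rw [hcI]; exact_mod_cast hc.ne'
    · rw [hasDerivAt_iff_tendsto_slope]
      have h1 : Tendsto (fun mu => I mu / k) (𝓝[≠] (lam : ℂ)) (𝓝 (I lam / k)) :=
        ((hI.div_const k).tendsto _).mono_left nhdsWithin_le_nhds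
      refine h1.congr' ?_
      filter_upwards [self_mem_nhdsWithin] with mu hne
      have hne' : mu - lam ≠ 0 := sub_ne_zero.2 hne
      rw [slope_def_field, h, sub_zero, eq_div_iff hne', div_mul_eq_mul_div, div_eq_iff hk,
        mul_comm _ k, hmu, mul_comm]
  have hW := wronskian_shift bc q lam
  have hor := sol_ne_zero_or bc (AngularHill.shift q lam) piPt
  cases bc with
  | dirichlet =>
    have h' : bsol .dirichlet (AngularHill.shift q lam) Real.pi = 0 := h
    refine key (dbsol .dirichlet (AngularHill.shift q lam) Real.pi)
      (hor.resolve_left fun hh => hh h) fun mu => ?_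
    have := hW mu
    rw [h', zero_mul, zero_sub] at this
    change _ * bsol .dirichlet (AngularHill.shift q mu) Real.pi = (mu - lam) * primitiveL _ piPt
    linear_combination -this
  | neumann =>
    have h' : dbsol .neumann (AngularHill.shift q lam) Real.pi = 0 := h
    refine key (-bsol .neumann (AngularHill.shift q lam) Real.pi)
      (neg_ne_zero.2 (hor.resolve_right fun hh => hh h)) fun mu => ?_
    have := hW mu
    rw [h', zero_mul, sub_zero] at this
    change -_ * dbsol .neumann (AngularHill.shift q mu) Real.pi = (mu - lam) * primitiveL _ piPt
    linear_combination -this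

lemma BoundaryCondition.norm_start (bc : BoundaryCondition) : ‖bc.start‖ = 1 := by
  cases bc <;> simp [start, initSlope, initVal]

/-- For positive coefficients the Prüfer curve makes less than a quarter turn. -/
lemma IsRealCoeff.rot_of_pos {q : Coeff} (hq : IsRealCoeff q) (hpos : ∀ x, 0 < (q x).re)
    (bc : BoundaryCondition) :
    (bc.firstIndex : ℝ) - 1 < rot bc q ∧ rot bc q < bc.firstIndex := by
  let u : ℝ → ℝ := fun x => (bsol bc q x).re
  let v : ℝ → ℝ := fun x => (dbsol bc q x).re
  have hu : ∀ x ∈ Set.Icc 0 Real.pi, HasDerivAt u (v x) x := fun x hx =>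
    Complex.reCLM.hasFDerivAt.comp_hasDerivAt x (hasDerivAt_sol _ _ q hx)
  have hv : ∀ x (hx : x ∈ Set.Icc 0 Real.pi), HasDerivAt v ((q ⟨x, hx⟩).re * u x) x := by
    intro x hx
    have h := Complex.reCLM.hasFDerivAt.comp_hasDerivAt x
      (hasDerivAt_dsol bc.initVal bc.initSlope q hx)
    refine h.congr_deriv ?_
    rw [ext_apply q hx, Complex.reCLM_apply, Complex.mul_re, hq, zero_mul, sub_zero]
  have hw : ∀ x (hx : x ∈ Set.Icc 0 Real.pi), HasDerivAt (fun x => u x * v x)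
      (v x * v x + u x * ((q ⟨x, hx⟩).re * u x)) x := fun x hx => (hu x hx).mul (hv x hx)
  have hwpos : ∀ x (hx : x ∈ Set.Icc 0 Real.pi),
      0 < v x * v x + u x * ((q ⟨x, hx⟩).re * u x) := by
    intro x hx
    have h3 := hq.sol_im bc.initVal_im bc.initSlope_im hx
    have hne : u x ≠ 0 ∨ v x ≠ 0 := by
      rcases sol_ne_zero_or bc q ⟨x, hx⟩ with h4 | h4
      · exact Or.inl fun h => h4 (Complex.ext h h3.1)
      · exact Or.inr fun h => h4 (Complex.ext h h3.2)
    have hq0 := hpos ⟨x, hx⟩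
    rcases hne with h | h
    · have := mul_pos hq0 (mul_self_pos.2 h)
      nlinarith [mul_self_nonneg (v x)]
    · have := mul_nonneg hq0.le (mul_self_nonneg (u x))
      nlinarith [mul_self_pos.2 h]
  -- Here `(u u')' = u'² + q u² > 0`, and `u u'` vanishes at `0`; so `u u' > 0` from then on and the
  -- curve is confined to a quadrant.
  have hmono : StrictMonoOn (fun x => u x * v x) (Set.Icc 0 Real.pi) := by
    refine strictMonoOn_of_deriv_pos (convex_Icc _ _)
      (fun x hx => (hw x hx).continuousAt.continuousWithinAt) fun x hx => ?_
    rw [interior_Icc] at hx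
    have hx' := Set.Ioo_subset_Icc_self hx
    rw [(hw x hx').deriv]
    exact hwpos x hx'
  have h0 : u 0 * v 0 = 0 := by
    simp only [u, v, sol_zero, dsol_zero]
    cases bc <;> simp [BoundaryCondition.initVal, BoundaryCondition.initSlope]
  have hwx : ∀ x, 0 < x → x ≤ Real.pi → 0 < u x * v x := fun x hx0 hx => by
    have := hmono ⟨le_rfl, Real.pi_pos.le⟩ ⟨hx0.le, hx⟩ hx0
    simpa [h0] using this
  -- Squaring the curve treats both conditions together: `Im (u' + i u)² = 2 u u'` and the squared
  -- starting point is `σ = ±1`. Positivity of `u u'` becomes `sin (2y) > 0` for the signed angle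
  -- `y`, which traps `y` in `(0, π/2)`.
  obtain ⟨σ, hσ, hσ2⟩ : ∃ σ : ℝ, (σ = 1 ∧ bc = .dirichlet ∨ σ = -1 ∧ bc = .neumann) ∧
      bc.start ^ 2 = σ := by
    cases bc
    · exact ⟨1, Or.inl ⟨rfl, rfl⟩, by
        simp [BoundaryCondition.start, BoundaryCondition.initVal, BoundaryCondition.initSlope]⟩
    · exact ⟨-1, Or.inr ⟨rfl, rfl⟩, by
        simp [BoundaryCondition.start, BoundaryCondition.initVal, BoundaryCondition.initSlope]⟩
  let y : ℝ → ℝ := fun x => σ * (pruferLog bc q x).im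
  have hy : Continuous y := continuous_const.mul (Complex.continuous_im.comp
    (intervalIntegral.continuous_primitive
      (fun a b => (hq.continuous_pruferRate bc).intervalIntegrable a b) 0))
  have hy0 : y 0 = 0 := by simp [y, pruferLog]
  have hsin : ∀ x, 0 < x → x ≤ Real.pi → 0 < Real.sin (2 * y x) := by
    intro x hx0 hx
    have hxm : x ∈ Set.Icc 0 Real.pi := ⟨hx0.le, hx⟩
    have e := hq.prufer_eq_exp bc ⟨x, hxm⟩
    have r := hq.prufer_re bc ⟨x, hxm⟩
    have m := hq.prufer_im bc ⟨x, hxm⟩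
    have h1 : (prufer bc q ⟨x, hxm⟩ ^ 2).im = 2 * (u x * v x) := by
      rw [sq, Complex.mul_im, r, m]; simp only [u, v]; ring
    have h2 : prufer bc q ⟨x, hxm⟩ ^ 2 = σ * Complex.exp (2 * pruferLog bc q x) := by
      rw [e, mul_pow, hσ2, ← Complex.exp_nat_mul]; norm_num
    rw [h2, Complex.im_ofReal_mul, Complex.exp_im] at h1
    have him : (2 * pruferLog bc q x).im = 2 * (pruferLog bc q x).im := by simp
    rw [him] at h1
    have h3 : σ * Real.sin (2 * (pruferLog bc q x).im) = Real.sin (2 * y x) := by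
      rcases hσ with ⟨h, -⟩ | ⟨h, -⟩
      · simp [y, h]
      · simp only [y, h, neg_mul, one_mul, mul_neg, Real.sin_neg]
    have h4 : 0 < Real.exp (2 * pruferLog bc q x).re * Real.sin (2 * y x) := by
      rw [← h3]; nlinarith [hwx x hx0 hx]
    exact pos_of_mul_pos_right h4 (Real.exp_pos _).le
  have hnot : ∀ c : ℝ, c ≠ 0 → Real.sin (2 * c) = 0 → c ∉ y '' Set.Icc 0 Real.pi := by
    rintro c hc hs ⟨x, hx, rfl⟩
    have hx0 : 0 < x := lt_of_le_of_ne hx.1 fun h => hc (by rw [← h, hy0])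
    exact (hsin x hx0 hx.2).ne' hs
  have hupper : y Real.pi < Real.pi / 2 := by
    by_contra! h
    refine hnot (Real.pi / 2) Real.pi_div_two_pos.ne' (by rw [mul_div_cancel₀ _ two_ne_zero]; simp)
      (intermediate_value_Icc Real.pi_pos.le hy.continuousOn ⟨?_, h⟩)
    rw [hy0]; exact Real.pi_div_two_pos.le
  have hlower : 0 < y Real.pi := by
    by_contra! h
    have h1 : -(Real.pi / 2) < y Real.pi := by
      by_contra! h2
      refine hnot (-(Real.pi / 2)) (neg_ne_zero.2 Real.pi_div_two_pos.ne')
        (by rw [mul_neg, mul_div_cancel₀ _ two_ne_zero]; simp)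
        (intermediate_value_Icc' Real.pi_pos.le hy.continuousOn ⟨h2, ?_⟩)
      rw [hy0]; linarith [Real.pi_div_two_pos]
    have h3 := hsin Real.pi Real.pi_pos le_rfl
    exact absurd h3 (not_lt.2 (Real.sin_nonpos_of_nonpos_of_neg_pi_le (by linarith) (by linarith)))
  have hpi := Real.pi_pos
  simp only [y, pruferLog_pi_im] at hupper hlower
  rcases hσ with ⟨rfl, rfl⟩ | ⟨rfl, rfl⟩
  · have h1 : 0 < rot .dirichlet q := by
      by_contra! h; nlinarith
    have h2 : rot .dirichlet q < 1 := by
      by_contra! h; nlinarith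
    simp only [BoundaryCondition.firstIndex, Nat.cast_one, sub_self]
    exact ⟨h1, h2⟩
  · have h1 : rot .neumann q < 0 := by
      by_contra! h; nlinarith
    have h2 : -1 < rot .neumann q := by
      by_contra! h; nlinarith
    simp only [BoundaryCondition.firstIndex, Nat.cast_zero, zero_sub]
    exact ⟨h2, h1⟩

/-- The rotation number increases strictly with the spectral parameter. -/
lemma IsRealCoeff.strictMono_rot {q : Coeff} (hq : IsRealCoeff q) (bc : BoundaryCondition) :
    StrictMono fun lam : ℝ => rot bc (AngularHill.shift q lam) := by
  have hcont : Continuous fun lam : ℝ => rot bc (AngularHill.shift q lam) :=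
    continuous_rot bc ((continuous_shift q).comp Complex.continuous_ofReal) fun t => hq.shift t
  refine strictMono_of_deriv_pos fun mu => ?_
  obtain ⟨c, hc, hcI⟩ := (hq.shift mu).integral_sq_pos bc
  let Ic : ℝ → ℂ := fun lam => primitiveL (ivp bc.initVal bc.initSlope (AngularHill.shift q lam) *
    ivp bc.initVal bc.initSlope (AngularHill.shift q mu)) piPt
  have hIc : Continuous Ic := by
    have h1 : Continuous fun lam : ℝ => ivp bc.initVal bc.initSlope (AngularHill.shift q lam) :=
      (differentiable_ivp _ _).continuous.comp
        ((continuous_shift q).comp Complex.continuous_ofReal)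
    exact (ContinuousMap.evalCLM ℂ piPt).continuous.comp
      (primitiveL.continuous.comp (h1.mul continuous_const))
  let N : ℝ → ℝ := fun lam => ‖prufer bc (AngularHill.shift q lam) piPt‖ *
    ‖prufer bc (AngularHill.shift q mu) piPt‖
  have hN0 : ∀ lam : ℝ, 0 < N lam := fun lam =>
    mul_pos (norm_pos_iff.2 ((hq.shift lam).prufer_ne_zero bc _))
      (norm_pos_iff.2 ((hq.shift mu).prufer_ne_zero bc _))
  have hN : Continuous N := by
    have h1 : Continuous fun lam : ℝ => AngularHill.shift q lam :=
      (continuous_shift q).comp Complex.continuous_ofReal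
    have h2 : Continuous fun lam : ℝ => prufer bc (AngularHill.shift q lam) :=
      ((differentiable_ivpDeriv _ _).continuous.comp h1).add
        (((differentiable_ivp _ _).continuous.comp h1).const_smul Complex.I)
    exact (((ContinuousMap.evalCLM ℂ piPt).continuous.comp h2).norm).mul continuous_const
  let C : ℝ → ℝ := fun lam => (Ic lam).re / N lam
  have hC : Continuous C := (Complex.continuous_re.comp hIc).div hN fun lam => (hN0 lam).ne'
  have hCmu : 0 < C mu := by
    have : Ic mu = c := hcI
    simp only [C, this, Complex.ofReal_re]
    exact div_pos hc (hN0 mu)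
  -- The Wronskian at `π` is the imaginary part of one Prüfer endpoint times the conjugate of the
  -- other, that is, the product of the moduli times the sine of the angle difference.
  have hsin : ∀ lam : ℝ, Real.sin ((rot bc (AngularHill.shift q lam)
      - rot bc (AngularHill.shift q mu)) * Real.pi) = (lam - mu) * C lam := by
    intro lam
    have e1 := (hq.shift lam).prufer_eq_exp bc piPt
    have e2 := (hq.shift mu).prufer_eq_exp bc piPt
    set l1 := pruferLog bc (AngularHill.shift q lam) piPt with hl1
    set l2 := pruferLog bc (AngularHill.shift q mu) piPt with hl2
    have i1 : l1.im = rot bc (AngularHill.shift q lam) * Real.pi := pruferLog_pi_im bc _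
    have i2 : l2.im = rot bc (AngularHill.shift q mu) * Real.pi := pruferLog_pi_im bc _
    have hNval : N lam = Real.exp l1.re * Real.exp l2.re := by
      simp only [N, e1, e2, norm_mul, bc.norm_start, one_mul, Complex.norm_exp]
    have him : (prufer bc (AngularHill.shift q lam) piPt *
        star (prufer bc (AngularHill.shift q mu) piPt)).im = (lam - mu) * (Ic lam).re := by
      have hW := congrArg Complex.re (wronskian_shift bc q lam mu)
      have r1 := (hq.shift lam).prufer_re bc piPt
      have r2 := (hq.shift mu).prufer_re bc piPt
      have m1 := (hq.shift lam).prufer_im bc piPt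
      have m2 := (hq.shift mu).prufer_im bc piPt
      have s1 := (hq.shift lam).sol_im bc.initVal_im bc.initSlope_im piPt.2
      have s2 := (hq.shift mu).sol_im bc.initVal_im bc.initSlope_im piPt.2
      have hp : (piPt : ℝ) = Real.pi := rfl
      rw [hp] at r1 r2 m1 m2 s1 s2
      change _ = (((lam : ℂ) - mu) * Ic lam).re at hW
      rw [← Complex.ofReal_sub, Complex.re_ofReal_mul] at hW
      rw [← hW, Complex.mul_im, Complex.star_def, Complex.conj_re, Complex.conj_im, r1, r2, m1,
        m2]
      simp only [Complex.sub_re, Complex.mul_re]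
      have t1 := s1.1
      have t2 := s1.2
      simp only [bsol, dbsol]
      rw [s1.1, s1.2]
      ring
    have hexp : prufer bc (AngularHill.shift q lam) piPt *
        star (prufer bc (AngularHill.shift q mu) piPt) = Complex.exp (l1 + star l2) := by
      have hst : bc.start * star bc.start = 1 := by
        rw [Complex.star_def, Complex.mul_conj, Complex.normSq_eq_norm_sq, bc.norm_start]; simp
      rw [e1, e2, star_mul', Complex.exp_add, Complex.star_def, Complex.exp_conj,
        ← Complex.star_def]
      linear_combination (Complex.exp l1 * star (Complex.exp l2)) * hst
    rw [hexp, Complex.exp_im] at him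
    have hre : (l1 + star l2).re = l1.re + l2.re := by simp
    have him' : (l1 + star l2).im = (rot bc (AngularHill.shift q lam)
        - rot bc (AngularHill.shift q mu)) * Real.pi := by
      simp only [Complex.add_im, Complex.star_def, Complex.conj_im, i1, i2]; ring
    rw [hre, him', Real.exp_add, ← hNval] at him
    simp only [C]
    rw [← mul_div_assoc, ← him, mul_div_cancel_left₀ _ (hN0 lam).ne']
  -- Near `mu` the angle difference is small by continuity, so `arcsin` recovers it from its sine
  -- and the derivative can be read off.
  have hd : HasDerivAt (fun lam : ℝ => rot bc (AngularHill.shift q lam)) (C mu / Real.pi) mu := by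
    have h1 : HasDerivAt (fun lam : ℝ => (lam - mu) * C lam) (C mu) mu := by
      rw [hasDerivAt_iff_tendsto_slope]
      refine ((hC.tendsto mu).mono_left nhdsWithin_le_nhds).congr' ?_
      filter_upwards [self_mem_nhdsWithin] with lam hne
      have hne' : lam - mu ≠ 0 := sub_ne_zero.2 hne
      rw [slope_def_field, sub_self, zero_mul, sub_zero, mul_div_cancel_left₀ _ hne']
    have h2 : HasDerivAt (fun lam : ℝ => Real.arcsin ((lam - mu) * C lam)) (C mu) mu := by
      have h3 : HasDerivAt Real.arcsin (1 / √(1 - ((mu - mu) * C mu) ^ 2)) ((mu - mu) * C mu) :=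
        Real.hasDerivAt_arcsin (by simp) (by simp)
      have h4 := h3.comp mu h1
      refine h4.congr_deriv ?_
      simp
    have h4 : HasDerivAt (fun lam : ℝ => Real.arcsin ((lam - mu) * C lam) / Real.pi
        + rot bc (AngularHill.shift q mu)) (C mu / Real.pi) mu := (h2.div_const _).add_const _
    refine h4.congr_of_eventuallyEq ?_
    have h5 : Tendsto (fun lam : ℝ => (rot bc (AngularHill.shift q lam)
        - rot bc (AngularHill.shift q mu)) * Real.pi) (𝓝 mu) (𝓝 0) := by
      have := ((hcont.tendsto mu).sub_const (rot bc (AngularHill.shift q mu))).mul_const Real.pi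
      simpa using this
    filter_upwards [h5.eventually (Icc_mem_nhds (neg_lt_zero.2 Real.pi_div_two_pos)
      Real.pi_div_two_pos)] with lam hlam
    rw [← hsin, Real.arcsin_sin hlam.1 hlam.2, mul_div_cancel_right₀ _ Real.pi_ne_zero]
    ring
  rw [hd.deriv]
  exact div_pos hCmu Real.pi_pos

/-! ### Asymptotics of the characteristic function -/

lemma norm_cexp_I_mul_le {z : ℂ} {c : ℝ} (hz : |z.im| ≤ c) : ‖Complex.exp (z * Complex.I)‖ ≤
    Real.exp c := by
  rw [Complex.norm_exp, Complex.mul_I_re]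
  exact Real.exp_le_exp.2 ((neg_le_abs _).trans hz)

lemma norm_cos_le_exp {z : ℂ} {c : ℝ} (hz : |z.im| ≤ c) : ‖Complex.cos z‖ ≤ Real.exp c := by
  have h1 := norm_cexp_I_mul_le hz
  have h2 := norm_cexp_I_mul_le (z := -z) (c := c) (by simpa using hz)
  rw [Complex.cos, norm_div, Complex.norm_two]
  linarith [norm_add_le (Complex.exp (z * Complex.I)) (Complex.exp (-z * Complex.I))]

lemma norm_sin_le_exp {z : ℂ} {c : ℝ} (hz : |z.im| ≤ c) : ‖Complex.sin z‖ ≤ Real.exp c := by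
  have h1 := norm_cexp_I_mul_le hz
  have h2 := norm_cexp_I_mul_le (z := -z) (c := c) (by simpa using hz)
  rw [Complex.sin, norm_div, Complex.norm_two, norm_mul, Complex.norm_I, mul_one]
  linarith [norm_sub_le (Complex.exp (-z * Complex.I)) (Complex.exp (z * Complex.I))]

lemma abs_im_mul_sub_le {k : ℂ} (hk : |k.im| ≤ 1) {x t : ℝ} (hx : x ∈ Set.Icc 0 Real.pi)
    (ht : t ∈ Set.Icc 0 Real.pi) : |(k * ((x : ℂ) - t)).im| ≤ Real.pi := by
  have : (k * ((x : ℂ) - t)).im = k.im * (x - t) := by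
    rw [← Complex.ofReal_sub, Complex.im_mul_ofReal]
  rw [this, abs_mul]
  have h2 : |x - t| ≤ Real.pi := by
    rw [abs_le]; constructor <;> linarith [hx.1, hx.2, ht.1, ht.2]
  calc |k.im| * |x - t| ≤ 1 * Real.pi := by gcongr
    _ = Real.pi := one_mul _

/-- The coefficient of the model equation `u'' = -(k² + R) u`. -/
noncomputable def modelCoeff (k : ℂ) (R : Coeff) : Coeff := -(k ^ 2 • 1 + R)

/-- Comparison of a solution with an explicit solution `s` of `s'' = -k² s`. -/
lemma comparison (a b k : ℂ) (R : Coeff) (x : HalfPeriod) {s s' : ℝ → ℂ}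
    (hs : ∀ t, HasDerivAt s (s' t) t) (hs' : ∀ t, HasDerivAt s' (-k ^ 2 * s t) t)
    (g : Coeff) (hg : ∀ t : HalfPeriod, g t = R t * ivp a b (modelCoeff k R) t * s t) :
    sol a b (modelCoeff k R) x * s' x - dsol a b (modelCoeff k R) x * s x
      = (a * s' 0 - b * s 0) + primitiveL g x := by
  have h := eq_add_integral_of_hasDerivWithinAt
    (f := fun t => sol a b (modelCoeff k R) t * s' t - dsol a b (modelCoeff k R) t * s t)
    (fun y hy => (((hasDerivAt_sol a b _ hy).mul (hs' y)).sub
      ((hasDerivAt_dsol a b _ hy).mul (hs y))).hasDerivWithinAt) g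
    (fun y => by
      rw [hg, ext_coe, sol_coe]
      simp only [modelCoeff, ContinuousMap.neg_apply, ContinuousMap.add_apply,
        ContinuousMap.smul_apply, ContinuousMap.one_apply, smul_eq_mul]
      ring) x
  simpa [sol_zero, dsol_zero, primitiveL_apply] using h

lemma hasDerivAt_sin_mul_sub (k x : ℂ) (t : ℝ) :
    HasDerivAt (fun t : ℝ => Complex.sin (k * (x - t))) (-k * Complex.cos (k * (x - t))) t := by
  have h1 : HasDerivAt (fun w : ℂ => k * (x - w)) (k * -1) t :=
    ((hasDerivAt_id (t : ℂ)).const_sub x).const_mul k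
  refine h1.csin.comp_ofReal.congr_deriv ?_
  ring

lemma hasDerivAt_cos_mul_sub (k x : ℂ) (t : ℝ) :
    HasDerivAt (fun t : ℝ => Complex.cos (k * (x - t))) (k * Complex.sin (k * (x - t))) t := by
  have h1 : HasDerivAt (fun w : ℂ => k * (x - w)) (k * -1) t :=
    ((hasDerivAt_id (t : ℂ)).const_sub x).const_mul k
  refine h1.ccos.comp_ofReal.congr_deriv ?_
  ring

/-- The kernel `sin (k (x - t))`. -/
noncomputable def sinKer (k : ℂ) (x : HalfPeriod) : Coeff :=
  ⟨fun t => Complex.sin (k * ((x : ℝ) - (t : ℝ))), by fun_prop⟩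

/-- The kernel `cos (k (x - t))`. -/
noncomputable def cosKer (k : ℂ) (x : HalfPeriod) : Coeff :=
  ⟨fun t => Complex.cos (k * ((x : ℝ) - (t : ℝ))), by fun_prop⟩

lemma norm_sinKer_le {k : ℂ} (hk : |k.im| ≤ 1) (x : HalfPeriod) :
    ‖sinKer k x‖ ≤ Real.exp Real.pi :=
  (ContinuousMap.norm_le _ (Real.exp_pos _).le).2 fun t =>
    norm_sin_le_exp (abs_im_mul_sub_le hk x.2 t.2)

lemma norm_cosKer_le {k : ℂ} (hk : |k.im| ≤ 1) (x : HalfPeriod) :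
    ‖cosKer k x‖ ≤ Real.exp Real.pi :=
  (ContinuousMap.norm_le _ (Real.exp_pos _).le).2 fun t =>
    norm_cos_le_exp (abs_im_mul_sub_le hk x.2 t.2)

/-- Variation of constants. -/
lemma mul_sol_eq (a b k : ℂ) (R : Coeff) (x : HalfPeriod) :
    k * ivp a b (modelCoeff k R) x = a * k * Complex.cos (k * x) + b * Complex.sin (k * x)
      - primitiveL (R * ivp a b (modelCoeff k R) * sinKer k x) x := by
  have h := comparison a b k R x (s := fun t => Complex.sin (k * ((x : ℝ) - t)))
    (s' := fun t => -k * Complex.cos (k * ((x : ℝ) - t)))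
    (fun t => hasDerivAt_sin_mul_sub k _ t)
    (fun t => ((hasDerivAt_cos_mul_sub k _ t).const_mul (-k)).congr_deriv (by ring))
    (R * ivp a b (modelCoeff k R) * sinKer k x) (fun t => rfl)
  simp only [sub_self, mul_zero, Complex.sin_zero, Complex.cos_zero, Complex.ofReal_zero, sub_zero,
    sol_coe] at h
  linear_combination -h

lemma neg_dsol_eq (a b k : ℂ) (R : Coeff) (x : HalfPeriod) :
    -ivpDeriv a b (modelCoeff k R) x = a * k * Complex.sin (k * x) - b * Complex.cos (k * x)
      + primitiveL (R * ivp a b (modelCoeff k R) * cosKer k x) x := by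
  have h := comparison a b k R x (s := fun t => Complex.cos (k * ((x : ℝ) - t)))
    (s' := fun t => k * Complex.sin (k * ((x : ℝ) - t)))
    (fun t => hasDerivAt_cos_mul_sub k _ t)
    (fun t => ((hasDerivAt_sin_mul_sub k _ t).const_mul k).congr_deriv (by ring))
    (R * ivp a b (modelCoeff k R) * cosKer k x) (fun t => rfl)
  simp only [sub_self, mul_zero, Complex.sin_zero, Complex.cos_zero, Complex.ofReal_zero, sub_zero,
    sol_coe, dsol_coe] at h
  linear_combination h

lemma norm_primitiveL_apply_le (f : Coeff) (x : HalfPeriod) :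
    ‖primitiveL f x‖ ≤ Real.pi * ‖f‖ := norm_integral_ext_le f x

/-- A priori bound for solutions of the model equation. -/
lemma norm_ivp_le {a b k : ℂ} {R : Coeff} {B : ℝ} (hR : ‖R‖ ≤ B) (hk : |k.im| ≤ 1)
    (hk0 : k ≠ 0) (hkB : 2 * Real.pi * B * Real.exp Real.pi ≤ ‖k‖) :
    ‖ivp a b (modelCoeff k R)‖ ≤ 2 * Real.exp Real.pi * (‖a‖ + ‖b‖ / ‖k‖) := by
  set u := ivp a b (modelCoeff k R)
  set e := Real.exp Real.pi with he
  have he0 : 0 < e := Real.exp_pos _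
  have hB0 : 0 ≤ B := (norm_nonneg _).trans hR
  have hkn : 0 < ‖k‖ := norm_pos_iff.2 hk0
  have hx : ∀ x : HalfPeriod, ‖u x‖ ≤ e * (‖a‖ + ‖b‖ / ‖k‖) + ‖u‖ / 2 := by
    intro x
    have h := mul_sol_eq a b k R x
    have h1 : ‖primitiveL (R * u * sinKer k x) x‖ ≤ Real.pi * (B * ‖u‖ * e) := by
      refine (norm_primitiveL_apply_le _ _).trans ?_
      gcongr
      calc _ ≤ ‖R‖ * ‖u‖ * ‖sinKer k x‖ :=
            (norm_mul_le _ _).trans (mul_le_mul_of_nonneg_right (norm_mul_le _ _) (norm_nonneg _))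
        _ ≤ B * ‖u‖ * e := by
            have := norm_sinKer_le hk x
            gcongr
    have him : |(k * (x : ℝ)).im| ≤ Real.pi := by
      have := abs_im_mul_sub_le hk x.2 (t := 0) ⟨le_rfl, Real.pi_pos.le⟩
      simpa using this
    have hc := norm_cos_le_exp him
    have hs := norm_sin_le_exp him
    have h2 : ‖k‖ * ‖u x‖ ≤ ‖a‖ * ‖k‖ * e + ‖b‖ * e + Real.pi * (B * ‖u‖ * e) := by
      rw [← norm_mul, h]
      refine (norm_sub_le _ _).trans (add_le_add ((norm_add_le _ _).trans ?_) h1)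
      rw [norm_mul, norm_mul, norm_mul]
      gcongr
    -- The lower bound on `‖k‖` is chosen so that the integral term costs at most half of `‖u‖`,
    -- which is absorbed on the left.
    have h3 : Real.pi * (B * ‖u‖ * e) ≤ ‖k‖ * (‖u‖ / 2) := by
      nlinarith [norm_nonneg u]
    have h4 : ‖k‖ * ‖u x‖ ≤ ‖k‖ * (e * (‖a‖ + ‖b‖ / ‖k‖) + ‖u‖ / 2) := by
      have : ‖k‖ * (e * (‖a‖ + ‖b‖ / ‖k‖) + ‖u‖ / 2)
          = ‖a‖ * ‖k‖ * e + ‖b‖ * e + ‖k‖ * (‖u‖ / 2) := by field_simp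
      linarith
    exact le_of_mul_le_mul_left h4 hkn
  have h5 : ‖u‖ ≤ e * (‖a‖ + ‖b‖ / ‖k‖) + ‖u‖ / 2 := (ContinuousMap.norm_le _ (by positivity)).2 hx
  linarith

/-- The characteristic function of the model equation, normalized to be close to `sin (k π)`. -/
noncomputable def normChar : BoundaryCondition → ℂ → Coeff → ℂ
  | .dirichlet, k, R => k * charFn .dirichlet (modelCoeff k R)
  | .neumann, k, R => -charFn .neumann (modelCoeff k R) / k

lemma normChar_eq_zero_iff (bc : BoundaryCondition) {k : ℂ} (hk : k ≠ 0) (R : Coeff) :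
    normChar bc k R = 0 ↔ charFn bc (modelCoeff k R) = 0 := by
  cases bc <;> simp [normChar, hk]

/-- Variation of constants at `x = π`: the normalization makes the free term `sin (kπ)` for both
conditions, and the a priori bound controls the integral. Only a bound on `‖R‖` enters, so the
estimate is uniform over families of coefficients. -/
lemma normChar_sub_sin (bc : BoundaryCondition) {k : ℂ} {R : Coeff} {B : ℝ} (hR : ‖R‖ ≤ B)
    (hk : |k.im| ≤ 1) (hk0 : k ≠ 0) (hkB : 2 * Real.pi * B * Real.exp Real.pi ≤ ‖k‖) :
    ‖normChar bc k R - Complex.sin (k * Real.pi)‖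
      ≤ 2 * Real.pi * B * Real.exp Real.pi ^ 2 / ‖k‖ := by
  have hkn : 0 < ‖k‖ := norm_pos_iff.2 hk0
  have hB0 : 0 ≤ B := (norm_nonneg _).trans hR
  have hu := norm_ivp_le (a := bc.initVal) (b := bc.initSlope) hR hk hk0 hkB
  set e := Real.exp Real.pi
  set u := ivp bc.initVal bc.initSlope (modelCoeff k R) with hu_def
  have hb : ∀ s : Coeff, ‖s‖ ≤ e → ‖primitiveL (R * u * s) piPt‖ ≤ Real.pi * (B * ‖u‖ * e) := by
    intro s hs
    refine (norm_primitiveL_apply_le _ _).trans ?_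
    gcongr
    calc _ ≤ ‖R‖ * ‖u‖ * ‖s‖ :=
          (norm_mul_le _ _).trans (mul_le_mul_of_nonneg_right (norm_mul_le _ _) (norm_nonneg _))
      _ ≤ B * ‖u‖ * e := by gcongr
  cases bc with
  | dirichlet =>
    have h := mul_sol_eq 0 1 k R piPt
    have h2 : normChar .dirichlet k R - Complex.sin (k * Real.pi)
        = -primitiveL (R * u * sinKer k piPt) piPt := by
      have h3 : charFn .dirichlet (modelCoeff k R) = ivp 0 1 (modelCoeff k R) piPt :=
        sol_coe 0 1 _ piPt
      rw [normChar, h3, h]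
      simp only [zero_mul, one_mul, zero_add]
      exact sub_sub_cancel_left _ _
    rw [h2, norm_neg]
    refine (hb _ (norm_sinKer_le hk _)).trans ?_
    simp only [BoundaryCondition.initVal, BoundaryCondition.initSlope, norm_zero, norm_one,
      zero_add] at hu
    calc Real.pi * (B * ‖u‖ * e) ≤ Real.pi * (B * (2 * e * (1 / ‖k‖)) * e) := by gcongr
      _ = _ := by ring
  | neumann =>
    have h := neg_dsol_eq 1 0 k R piPt
    have h2 : normChar .neumann k R - Complex.sin (k * Real.pi)
        = primitiveL (R * u * cosKer k piPt) piPt / k := by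
      have h3 : charFn .neumann (modelCoeff k R) = ivpDeriv 1 0 (modelCoeff k R) piPt :=
        dsol_coe 1 0 _ piPt
      rw [normChar, h3, h]
      simp only [zero_mul, one_mul, sub_zero]
      rw [add_div, mul_div_cancel_left₀ _ hk0]
      exact add_sub_cancel_left _ _
    rw [h2, norm_div]
    have h4 := hb _ (norm_cosKer_le hk piPt)
    simp only [BoundaryCondition.initVal, BoundaryCondition.initSlope, norm_zero, norm_one,
      zero_div, add_zero, mul_one] at hu
    gcongr
    calc _ ≤ _ := h4
      _ ≤ Real.pi * (B * (2 * e) * e) := by gcongr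
      _ = _ := by ring

lemma normChar_zero (bc : BoundaryCondition) {k : ℂ} (hk : |k.im| ≤ 1) (hk0 : k ≠ 0) :
    normChar bc k 0 = Complex.sin (k * Real.pi) := by
  have := normChar_sub_sin bc (R := 0) (B := 0) (by simp) hk hk0 (by simp)
  rw [mul_zero, zero_mul, zero_div] at this
  exact sub_eq_zero.1 (norm_le_zero_iff.1 this)

lemma shift_eq_modelCoeff (V : Coeff) (k : ℂ) : shift V (k ^ 2) = modelCoeff k (-V) := by
  simp [shift, modelCoeff]; abel

/-! ### Enumeration of the unperturbed eigenvalues -/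

lemma isRealCoeff_basePot (γ₁ γ₂ : ℝ) : IsRealCoeff (basePot γ₁ γ₂) := fun _ =>
  Complex.ofReal_im _

lemma hillCoeff_zero (γ₁ γ₂ : ℝ) (lam : ℂ) : hillCoeff γ₁ γ₂ 0 lam = shift (basePot γ₁ γ₂) lam := by
  simp [hillCoeff, shift]

lemma isEigenvalue_zero_iff (bc : BoundaryCondition) (γ₁ γ₂ : ℝ) (lam : ℝ) :
    IsEigenvalue bc γ₁ γ₂ 0 lam ↔ ∃ j : ℤ, rot bc (shift (basePot γ₁ γ₂) lam) = j := by
  rw [isEigenvalue_iff, hillCoeff_zero,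
    ((isRealCoeff_basePot γ₁ γ₂).shift lam).charFn_eq_zero_iff]

lemma IsRealCoeff.continuous_rot_shift {V : Coeff} (hV : IsRealCoeff V)
    (bc : BoundaryCondition) : Continuous fun lam : ℝ => rot bc (AngularHill.shift V lam) :=
  continuous_rot bc ((continuous_shift V).comp Complex.continuous_ofReal) fun t => hV.shift t

/-- Below `-‖V‖` the coefficient `V - λ` is positive, so the curve makes less than a quarter turn.
-/
lemma IsRealCoeff.rot_shift_of_lt {V : Coeff} (hV : IsRealCoeff V) (bc : BoundaryCondition)
    {lam : ℝ} (h : lam < -‖V‖) :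
    (bc.firstIndex : ℝ) - 1 < rot bc (AngularHill.shift V lam) ∧
      rot bc (AngularHill.shift V lam) < bc.firstIndex := by
  refine (hV.shift lam).rot_of_pos (fun x => ?_) bc
  have h1 : -‖V‖ ≤ (V x).re :=
    (abs_le.1 ((Complex.abs_re_le_norm _).trans (V.norm_coe_le_norm x))).1
  simp [AngularHill.shift]
  linarith

lemma IsRealCoeff.lt_rot_shift {V : Coeff} (hV : IsRealCoeff V) (bc : BoundaryCondition)
    (lam : ℝ) : (bc.firstIndex : ℝ) - 1 < rot bc (AngularHill.shift V lam) := by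
  rcases lt_or_ge lam (-‖V‖) with h | h
  · exact (hV.rot_shift_of_lt bc h).1
  · exact (hV.rot_shift_of_lt bc (lam := -‖V‖ - 1) (by linarith)).1.trans
      (hV.strictMono_rot bc (by linarith))

lemma charFn_shift_zero_eq_zero_iff (bc : BoundaryCondition) {k : ℝ} (hk : 0 < k) :
    charFn bc (shift 0 ((k ^ 2 : ℝ) : ℂ)) = 0 ↔ ∃ j : ℤ, (j : ℝ) = k := by
  have hk0 : (k : ℂ) ≠ 0 := by exact_mod_cast hk.ne'
  rw [Complex.ofReal_pow, shift_eq_modelCoeff, neg_zero, ← normChar_eq_zero_iff bc hk0,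
    normChar_zero bc (by simp) hk0, ← Complex.ofReal_mul, ← Complex.ofReal_sin,
    Complex.ofReal_eq_zero, Real.sin_eq_zero_iff]
  exact exists_congr fun j => mul_left_inj' Real.pi_ne_zero

lemma isRealCoeff_zero : IsRealCoeff 0 := fun _ => rfl

lemma rot_shift_zero_int_iff (bc : BoundaryCondition) {k : ℝ} (hk : 0 < k) :
    (∃ j : ℤ, rot bc (shift 0 ((k ^ 2 : ℝ) : ℂ)) = j) ↔ ∃ j : ℤ, (j : ℝ) = k := by
  rw [← (isRealCoeff_zero.shift (k ^ 2)).charFn_eq_zero_iff, charFn_shift_zero_eq_zero_iff bc hk]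

/-- Obtained in the limit `λ ↑ 0` from positive coefficients, hence only a weak inequality; it is an
equality for Neumann. -/
lemma rot_shift_zero_zero (bc : BoundaryCondition) :
    rot bc (shift 0 ((0 : ℝ) : ℂ)) ≤ bc.firstIndex := by
  have hc : Continuous fun lam : ℝ => rot bc (shift 0 lam) :=
    isRealCoeff_zero.continuous_rot_shift bc
  refine le_of_tendsto ((hc.tendsto 0).mono_left (nhdsWithin_le_nhds (s := Set.Iio 0))) ?_
  filter_upwards [self_mem_nhdsWithin] with lam hlam
  exact (isRealCoeff_zero.rot_shift_of_lt bc (by simpa using hlam)).2.le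

/-- The eigenvalues of `-∂²` are the squares. -/
lemma rot_shift_zero_sq (bc : BoundaryCondition) {n : ℕ} (hn : bc.firstIndex ≤ n) :
    rot bc (shift 0 (((n : ℝ) ^ 2 : ℝ) : ℂ)) = n := by
  have hc : Continuous fun lam : ℝ => rot bc (shift 0 lam) :=
    isRealCoeff_zero.continuous_rot_shift bc
  have hm : StrictMono fun lam : ℝ => rot bc (shift 0 lam) := isRealCoeff_zero.strictMono_rot bc
  -- The rotation number at `(m+1)²` is an integer above `m`. If it exceeded `m + 1`, the value `m +
  -- 1` would be taken strictly between `m²` and `(m+1)²`, at a `λ` whose root is not an integer.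
  have step : ∀ m : ℕ, (m : ℝ) ≤ rot bc (shift 0 (((m : ℝ) ^ 2 : ℝ) : ℂ)) →
      rot bc (shift 0 (((m : ℝ) ^ 2 : ℝ) : ℂ)) < m + 1 →
      rot bc (shift 0 ((((m + 1 : ℕ) : ℝ) ^ 2 : ℝ) : ℂ)) = (m + 1 : ℕ) := by
    intro m h0 h1
    obtain ⟨j, hj⟩ := (rot_shift_zero_int_iff bc (k := ((m + 1 : ℕ) : ℝ)) (by positivity)).2
      ⟨(m + 1 : ℕ), by simp⟩
    have hlt : (m : ℝ) ^ 2 < ((m + 1 : ℕ) : ℝ) ^ 2 := by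
      push_cast; nlinarith [(Nat.cast_nonneg m : (0 : ℝ) ≤ m)]
    have hmj : (m : ℝ) < j := by rw [← hj]; exact h0.trans_lt (hm hlt)
    have hmj' : (m : ℤ) < j := by exact_mod_cast hmj
    rw [hj]
    by_contra hne
    have hj2 : (m : ℤ) + 1 < j := by
      refine lt_of_le_of_ne hmj' fun h => hne ?_
      rw [← h]; push_cast; rfl
    have hj2' : (m : ℝ) + 1 < j := by exact_mod_cast hj2
    obtain ⟨lam, hlam, hlam2⟩ := intermediate_value_Ioo hlt.le hc.continuousOn
      (show (m : ℝ) + 1 ∈ Set.Ioo _ _ from ⟨h1, by simp only [hj]; exact hj2'⟩)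
    have hpos : 0 < lam := lt_of_le_of_lt (by positivity) hlam.1
    obtain ⟨i, hi⟩ := (rot_shift_zero_int_iff bc (k := √lam) (Real.sqrt_pos.2 hpos)).1
      ⟨m + 1, by rw [Real.sq_sqrt hpos.le]; push_cast; exact hlam2⟩
    have h5 : (m : ℝ) < i := by rw [hi]; exact Real.lt_sqrt_of_sq_lt hlam.1
    have h6 : (i : ℝ) < (m + 1 : ℕ) := by
      rw [hi]; exact (Real.sqrt_lt' (by positivity)).2 hlam.2
    have h5' : (m : ℤ) < i := by exact_mod_cast h5
    have h6' : i < ((m + 1 : ℕ) : ℤ) := by exact_mod_cast h6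
    push_cast at h6'
    omega
  have hlow : (bc.firstIndex : ℝ) - 1 < rot bc (shift 0 ((0 : ℝ) : ℂ)) :=
    isRealCoeff_zero.lt_rot_shift bc 0
  have hupp := rot_shift_zero_zero bc
  -- At `λ = 0` the Dirichlet solution is `x`, so `0` is not an eigenvalue and `step` applies from
  -- `m = 0`. The Neumann solution is the constant `1`, and `0` is the only integer in `(-1, 0]`.
  have base : rot bc (shift 0 (((bc.firstIndex : ℝ) ^ 2 : ℝ) : ℂ)) = bc.firstIndex := by
    have hshift0 : shift 0 ((0 : ℝ) : ℂ) = 0 := by simp [shift]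
    cases bc with
    | dirichlet =>
      have hne : charFn .dirichlet 0 ≠ 0 := by
        have h := eq_sol_of_hasDerivWithinAt (q := 0) (f := fun x : ℝ => (x : ℂ))
          (f' := fun _ => 1) (fun x _ => (Complex.ofRealCLM.hasDerivAt).hasDerivWithinAt)
          (fun x hx => by
            rw [ext_apply _ hx]
            simpa using (hasDerivAt_const x (1 : ℂ)).hasDerivWithinAt) Real.pi
          ⟨Real.pi_pos.le, le_rfl⟩
        have h2 : charFn .dirichlet 0 = (Real.pi : ℂ) := by
          rw [h.1]; simp only [Complex.ofReal_zero]; rfl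
        rw [h2]; exact_mod_cast Real.pi_ne_zero
      have hne2 : rot .dirichlet (shift 0 ((0 : ℝ) : ℂ)) ≠ 1 := fun h =>
        hne ((isRealCoeff_zero.charFn_eq_zero_iff .dirichlet).2
          ⟨1, by rw [hshift0] at h; exact_mod_cast h⟩)
      have h := step 0 (by
          simp only [BoundaryCondition.firstIndex, Nat.cast_one, sub_self] at hlow
          simpa using hlow.le)
        (by
          simp only [BoundaryCondition.firstIndex, Nat.cast_one] at hupp
          have := lt_of_le_of_ne hupp hne2
          simpa using this)
      simpa [BoundaryCondition.firstIndex] using h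
    | neumann =>
      have hz : charFn .neumann 0 = 0 := by
        have h := eq_sol_of_hasDerivWithinAt (q := 0) (f := fun _ : ℝ => (1 : ℂ))
          (f' := fun _ => 0) (fun x _ => (hasDerivAt_const x (1 : ℂ)).hasDerivWithinAt)
          (fun x hx => by
            rw [ext_apply _ hx]
            simpa using (hasDerivAt_const x (0 : ℂ)).hasDerivWithinAt) Real.pi
          ⟨Real.pi_pos.le, le_rfl⟩
        exact h.2.symm
      obtain ⟨j, hj⟩ := (isRealCoeff_zero.charFn_eq_zero_iff .neumann).1 hz
      rw [hshift0, hj] at hlow hupp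
      simp only [BoundaryCondition.firstIndex, Nat.cast_zero, zero_sub] at hlow hupp
      have h1 : (-1 : ℤ) < j := by exact_mod_cast hlow
      have h2 : j ≤ 0 := by exact_mod_cast hupp
      have h3 : j = 0 := by omega
      have h4 : shift 0 (((0 : ℕ) : ℝ) ^ 2 : ℝ) = 0 := by simp [shift]
      simp only [BoundaryCondition.firstIndex]
      rw [h4, hj, h3]; simp
  induction n, hn using Nat.le_induction with
  | base => exact base
  | succ m hm ih => exact step m ih.ge (by rw [ih]; linarith)

/-- A continuous function that avoids the integers stays between consecutive integers. -/
lemma mem_Ioo_of_avoids_int {f : ℝ → ℝ} (hf : Continuous f)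
    (hav : ∀ t ∈ Set.Icc (0 : ℝ) 1, ∀ j : ℤ, f t ≠ j) {m : ℤ} (h0 : f 0 ∈ Set.Ioo (m : ℝ) (m + 1)) :
    f 1 ∈ Set.Ioo (m : ℝ) (m + 1) := by
  constructor
  · by_contra! h
    obtain ⟨t, ht, htm⟩ := intermediate_value_Icc' zero_le_one hf.continuousOn
      (show (m : ℝ) ∈ Set.Icc (f 1) (f 0) from ⟨h, h0.1.le⟩)
    exact hav t ht m htm
  · by_contra! h
    obtain ⟨t, ht, htm⟩ := intermediate_value_Icc zero_le_one hf.continuousOn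
      (show (m : ℝ) + 1 ∈ Set.Icc (f 0) (f 1) from ⟨h0.2.le, h⟩)
    exact hav t ht (m + 1) (by push_cast; exact htm)

/-- At large `k` with `|sin (k π)|` bounded below, the rotation number lies between the same
integers for the potentials `V` and `0`. -/
lemma rot_shift_mem_of_rot_shift_zero_mem {V : Coeff} (hV : IsRealCoeff V)
    (bc : BoundaryCondition) {k : ℝ} (hk : 0 < k)
    (hk1 : 2 * Real.pi * ‖V‖ * Real.exp Real.pi ≤ k)
    (hk2 : 2 * Real.pi * ‖V‖ * Real.exp Real.pi ^ 2 / k < |Real.sin (k * Real.pi)|)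
    {m : ℤ} (h0 : rot bc (shift 0 ((k ^ 2 : ℝ) : ℂ)) ∈ Set.Ioo (m : ℝ) (m + 1)) :
    rot bc (shift V ((k ^ 2 : ℝ) : ℂ)) ∈ Set.Ioo (m : ℝ) (m + 1) := by
  have hk0 : (k : ℂ) ≠ 0 := by exact_mod_cast hk.ne'
  have hr : ∀ t : ℝ, IsRealCoeff (shift ((t : ℂ) • V) ((k ^ 2 : ℝ) : ℂ)) := fun t =>
    IsRealCoeff.shift (fun x => by simp [hV x]) _
  have hc : Continuous fun t : ℝ => rot bc (shift ((t : ℂ) • V) ((k ^ 2 : ℝ) : ℂ)) :=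
    continuous_rot bc
      ((Complex.continuous_ofReal.smul continuous_const).sub continuous_const) hr
  -- Homotopy from `0` to `V` along `tV`: since `‖tV‖ ≤ ‖V‖`, the normalized characteristic function
  -- stays too close to `sin (kπ)` to vanish, so the rotation number never meets an integer.
  have h := mem_Ioo_of_avoids_int hc (m := m) (fun t ht j hj => ?_) (by simpa using h0)
  · simpa using h
  · have h1 := ((hr t).charFn_eq_zero_iff bc).2 ⟨j, hj⟩
    rw [Complex.ofReal_pow, shift_eq_modelCoeff, ← normChar_eq_zero_iff bc hk0] at h1
    have hnorm : ‖(-((t : ℂ) • V))‖ ≤ ‖V‖ := by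
      rw [norm_neg, norm_smul, Complex.norm_real, Real.norm_of_nonneg ht.1]
      exact mul_le_of_le_one_left (norm_nonneg _) ht.2
    have hkn : ‖(k : ℂ)‖ = k := by rw [Complex.norm_real, Real.norm_of_nonneg hk.le]
    have h2 := normChar_sub_sin bc hnorm (k := k) (by simp) hk0 (by rw [hkn]; exact hk1)
    rw [h1, zero_sub, norm_neg, hkn, ← Complex.ofReal_mul, ← Complex.ofReal_sin,
      Complex.norm_real, Real.norm_eq_abs] at h2
    exact absurd h2 (not_le.2 hk2)

lemma abs_sin_quarter (n : ℕ) {s : ℝ} (hs : s = 1 / 4 ∨ s = -(1 / 4)) :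
    1 / 2 < |Real.sin ((n + s) * Real.pi)| := by
  have h1 : 1 / 2 < √2 / 2 := by
    have : (1 : ℝ) < √2 := Real.lt_sqrt_of_sq_lt (by norm_num)
    linarith
  have h2 : |Real.sin ((n + s) * Real.pi)| = √2 / 2 := by
    rw [add_mul, add_comm, Real.sin_add_nat_mul_pi, abs_mul, abs_pow, abs_neg, abs_one, one_pow,
      one_mul]
    have h4 : |√2 / 2| = √2 / 2 := abs_of_pos (by positivity)
    rcases hs with rfl | rfl
    · rw [show (1 / 4 : ℝ) * Real.pi = Real.pi / 4 by ring, Real.sin_pi_div_four, h4]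
    · rw [show -(1 / 4 : ℝ) * Real.pi = -(Real.pi / 4) by ring, Real.sin_neg, abs_neg,
        Real.sin_pi_div_four, h4]
  rwa [h2]

/-- The rotation number near the squares. -/
lemma IsRealCoeff.eventually_rot_shift {V : Coeff} (hV : IsRealCoeff V)
    (bc : BoundaryCondition) : ∀ᶠ n : ℕ in atTop,
      rot bc (AngularHill.shift V ((((n : ℝ) - 1 / 4) ^ 2 : ℝ) : ℂ)) < n ∧
      (n : ℝ) < rot bc (AngularHill.shift V ((((n : ℝ) + 1 / 4) ^ 2 : ℝ) : ℂ)) := by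
  have hm : StrictMono fun lam : ℝ => rot bc (AngularHill.shift 0 lam) :=
    isRealCoeff_zero.strictMono_rot bc
  have hlarge : ∀ c : ℝ, ∀ᶠ n : ℕ in atTop, c ≤ n := fun c =>
    tendsto_natCast_atTop_atTop.eventually_ge_atTop c
  set A := 2 * Real.pi * ‖V‖ * Real.exp Real.pi with hA
  set A' := 2 * Real.pi * ‖V‖ * Real.exp Real.pi ^ 2 with hA'
  have hA'0 : 0 ≤ A' := by positivity
  filter_upwards [hlarge (A + 1), hlarge (2 * A' + 1), eventually_ge_atTop (bc.firstIndex + 1),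
    eventually_ge_atTop 1] with n h1 h2 h3 h4
  have hn1 : (1 : ℝ) ≤ n := by exact_mod_cast h4
  -- For zero potential the rotation number is known at `p²`, `(p+1)²`, `(p+2)²`; by monotonicity
  -- this brackets its values at `(p + 1 ± 1/4)²`. The index `p` is admissible because `n` exceeds
  -- the first index.
  obtain ⟨p, rfl⟩ : ∃ p, n = p + 1 := ⟨n - 1, by omega⟩
  have e0 := rot_shift_zero_sq bc (n := p) (by omega)
  have e1 := rot_shift_zero_sq bc (n := p + 1) (by omega)
  have e2 := rot_shift_zero_sq bc (n := p + 2) (by omega)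
  simp only [Nat.cast_add, Nat.cast_one, Nat.cast_ofNat] at e1 e2 h1 h2 hn1 ⊢
  have hp : (0 : ℝ) ≤ p := by linarith
  constructor
  · have h := rot_shift_mem_of_rot_shift_zero_mem hV bc (k := (p : ℝ) + 1 - 1 / 4) (m := (p : ℤ))
      (by linarith) (by linarith) ?_ ⟨?_, ?_⟩
    · simpa only [Int.cast_natCast] using h.2
    · refine lt_of_le_of_lt ?_ (by
        have := abs_sin_quarter (p + 1) (Or.inr rfl)
        simpa only [Nat.cast_add, Nat.cast_one, ← sub_eq_add_neg] using this)
      rw [div_le_iff₀ (by linarith)]; linarith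
    · have : rot bc (AngularHill.shift 0 (((p : ℝ) ^ 2 : ℝ) : ℂ))
          < rot bc (AngularHill.shift 0 ((((p : ℝ) + 1 - 1 / 4) ^ 2 : ℝ) : ℂ)) :=
        hm (by nlinarith)
      rw [e0] at this
      simpa only [Int.cast_add, Int.cast_one, Int.cast_natCast] using this
    · have : rot bc (AngularHill.shift 0 ((((p : ℝ) + 1 - 1 / 4) ^ 2 : ℝ) : ℂ))
          < rot bc (AngularHill.shift 0 ((((p : ℝ) + 1) ^ 2 : ℝ) : ℂ)) :=
        hm (by nlinarith)
      rw [e1] at this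
      simpa only [Int.cast_add, Int.cast_one, Int.cast_natCast] using this
  · have h := rot_shift_mem_of_rot_shift_zero_mem hV bc (k := (p : ℝ) + 1 + 1 / 4) (m := (p : ℤ) + 1)
      (by linarith) (by linarith) ?_ ⟨?_, ?_⟩
    · simpa only [Int.cast_add, Int.cast_one, Int.cast_natCast] using h.1
    · refine lt_of_le_of_lt ?_ (by
        have := abs_sin_quarter (p + 1) (Or.inl rfl)
        simpa only [Nat.cast_add, Nat.cast_one] using this)
      rw [div_le_iff₀ (by linarith)]; linarith
    · have : rot bc (AngularHill.shift 0 ((((p : ℝ) + 1) ^ 2 : ℝ) : ℂ))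
          < rot bc (AngularHill.shift 0 ((((p : ℝ) + 1 + 1 / 4) ^ 2 : ℝ) : ℂ)) :=
        hm (by nlinarith)
      rw [e1] at this
      simpa only [Int.cast_add, Int.cast_one, Int.cast_natCast] using this
    · have : rot bc (AngularHill.shift 0 ((((p : ℝ) + 1 + 1 / 4) ^ 2 : ℝ) : ℂ))
          < rot bc (AngularHill.shift 0 ((((p : ℝ) + 2) ^ 2 : ℝ) : ℂ)) :=
        hm (by nlinarith)
      rw [e2] at this
      simp only [Int.cast_add, Int.cast_one, Int.cast_natCast]
      linarith

/-- Every admissible index is attained. -/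
lemma IsRealCoeff.exists_rot_shift_eq {V : Coeff} (hV : IsRealCoeff V) (bc : BoundaryCondition)
    {n : ℕ} (hn : bc.firstIndex ≤ n) : ∃ lam : ℝ, rot bc (AngularHill.shift V lam) = n := by
  obtain ⟨N, hN, hN2⟩ := ((hV.eventually_rot_shift bc).and (eventually_ge_atTop n)).exists
  have hlow := (hV.rot_shift_of_lt bc (lam := -‖V‖ - 1) (by linarith)).2
  have hle : -‖V‖ - 1 ≤ ((N : ℝ) + 1 / 4) ^ 2 := by nlinarith [norm_nonneg V]
  have hn' : (bc.firstIndex : ℝ) ≤ n := by exact_mod_cast hn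
  have hN' : (n : ℝ) ≤ N := by exact_mod_cast hN2
  obtain ⟨lam, -, h⟩ := intermediate_value_Icc hle (hV.continuous_rot_shift bc).continuousOn
    (show (n : ℝ) ∈ Set.Icc _ _ from ⟨hlow.le.trans hn', hN'.trans hN.2.le⟩)
  exact ⟨lam, h⟩

/-- The `n`-th eigenvalue is the parameter at which the rotation number is `n`. -/
lemma isNthEigenvalue_iff (bc : BoundaryCondition) (γ₁ γ₂ : ℝ) {n : ℕ} {lam : ℝ} :
    IsNthEigenvalue bc γ₁ γ₂ n lam ↔
      bc.firstIndex ≤ n ∧ rot bc (shift (basePot γ₁ γ₂) lam) = n := by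
  have hV := isRealCoeff_basePot γ₁ γ₂
  have hm : StrictMono fun lam : ℝ => rot bc (shift (basePot γ₁ γ₂) lam) := hV.strictMono_rot bc
  -- Below `mu` the rotation number takes each integer in `[firstIndex, m)` exactly once and no
  -- other integer, so the eigenvalues there are in bijection with that range.
  have count : ∀ m : ℕ, bc.firstIndex ≤ m → ∀ mu : ℝ, rot bc (shift (basePot γ₁ γ₂) mu) = m →
      {ν : ℝ | ν < mu ∧ IsEigenvalue bc γ₁ γ₂ 0 (ν : ℂ)}.encard + (bc.firstIndex : ℕ∞) = m := by
    intro m hfm mu hmu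
    have hex : ∀ i : ℕ, ∃ ν : ℝ, bc.firstIndex ≤ i → rot bc (shift (basePot γ₁ γ₂) ν) = i := by
      intro i
      by_cases hi : bc.firstIndex ≤ i
      · obtain ⟨ν, hν⟩ := hV.exists_rot_shift_eq bc hi
        exact ⟨ν, fun _ => hν⟩
      · exact ⟨0, fun h => absurd h hi⟩
    choose e he using hex
    have himage : {ν : ℝ | ν < mu ∧ IsEigenvalue bc γ₁ γ₂ 0 (ν : ℂ)}
        = e '' (Finset.Ico bc.firstIndex m : Set ℕ) := by
      ext ν
      simp only [Set.mem_ofPred_eq, Set.mem_image, Finset.coe_Ico, Set.mem_Ico,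
        isEigenvalue_zero_iff]
      constructor
      · rintro ⟨hν, j, hj⟩
        have h1 := hV.lt_rot_shift bc ν
        have h2 : rot bc (shift (basePot γ₁ γ₂) ν) < m := by rw [← hmu]; exact hm hν
        rw [hj] at h1 h2
        have h1' : (bc.firstIndex : ℤ) - 1 < j := by exact_mod_cast h1
        have h2' : j < m := by exact_mod_cast h2
        lift j to ℕ using by omega
        refine ⟨j, ⟨by omega, by omega⟩, hm.injective ?_⟩
        simp only [he j (by omega), hj]
        simp
      · rintro ⟨i, ⟨hi1, hi2⟩, rfl⟩
        refine ⟨hm.lt_iff_lt.1 ?_, i, by rw [he i hi1]; simp⟩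
        simp only [he i hi1, hmu]
        exact_mod_cast hi2
    have hinj : Set.InjOn e (Finset.Ico bc.firstIndex m : Set ℕ) := by
      intro i hi j hj hij
      rw [Finset.coe_Ico, Set.mem_Ico] at hi hj
      have h1 := he i hi.1
      rw [hij, he j hj.1] at h1
      exact_mod_cast h1.symm
    rw [himage, hinj.encard_image, Set.encard_coe_eq_coe_finsetCard, Nat.card_Ico]
    norm_cast
    omega
  constructor
  · rintro ⟨h1, h2⟩
    obtain ⟨j, hj⟩ := (isEigenvalue_zero_iff bc γ₁ γ₂ lam).1 h1
    have h3 := hV.lt_rot_shift bc lam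
    rw [hj] at h3
    have h3' : (bc.firstIndex : ℤ) - 1 < j := by exact_mod_cast h3
    lift j to ℕ using by omega
    have hj' : rot bc (shift (basePot γ₁ γ₂) lam) = j := by rw [hj]; simp
    have h4 := count j (by omega) lam hj'
    rw [h2] at h4
    have h5 : n = j := by exact_mod_cast h4
    subst h5
    exact ⟨by omega, hj'⟩
  · rintro ⟨h1, h2⟩
    exact ⟨(isEigenvalue_zero_iff bc γ₁ γ₂ lam).2 ⟨n, by rw [h2]; simp⟩, count n h1 lam h2⟩

/-- Large eigenvalues are close to squares. -/
lemma eventually_nthEigenvalue_close (bc : BoundaryCondition) (γ₁ γ₂ : ℝ) :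
    ∀ᶠ n : ℕ in atTop, ∀ lam : ℝ, IsNthEigenvalue bc γ₁ γ₂ n lam →
      ((n : ℝ) - 1 / 4) ^ 2 < lam ∧ lam < ((n : ℝ) + 1 / 4) ^ 2 := by
  have hV := isRealCoeff_basePot γ₁ γ₂
  have hm : StrictMono fun lam : ℝ => rot bc (shift (basePot γ₁ γ₂) lam) := hV.strictMono_rot bc
  filter_upwards [hV.eventually_rot_shift bc] with n hn lam hlam
  have h := ((isNthEigenvalue_iff bc γ₁ γ₂).1 hlam).2
  refine ⟨hm.lt_iff_lt.1 ?_, hm.lt_iff_lt.1 ?_⟩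
  · simp only [h]; exact hn.1
  · simp only [h]; exact hn.2

/-! ### The complex phase -/

/-- The principal square root. -/
noncomputable def csqrt (z : ℂ) : ℂ := z ^ (2⁻¹ : ℂ)

lemma csqrt_sq (z : ℂ) : csqrt z ^ 2 = z := by
  simp [csqrt]

lemma csqrt_re_nonneg (z : ℂ) : 0 ≤ (csqrt z).re := by
  by_cases hz : z = 0
  · simp [csqrt, hz]
  · rw [csqrt, Complex.cpow_def_of_ne_zero hz, Complex.exp_re]
    have him : (Complex.log z * 2⁻¹).im = z.arg / 2 := by
      rw [show (2⁻¹ : ℂ) = ((2⁻¹ : ℝ) : ℂ) by norm_num, Complex.im_mul_ofReal, Complex.log_im]; ring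
    rw [him]
    refine mul_nonneg (Real.exp_pos _).le (Real.cos_nonneg_of_mem_Icc ⟨?_, ?_⟩)
    · linarith [Complex.neg_pi_lt_arg z]
    · linarith [Complex.arg_le_pi z]

lemma csqrt_ofReal {x : ℝ} (hx : 0 ≤ x) : csqrt x = (√x : ℝ) := by
  rw [csqrt, Real.sqrt_eq_rpow, Complex.ofReal_cpow hx]; norm_num

lemma differentiableAt_csqrt {z : ℂ} (hz : z ∈ Complex.slitPlane) : DifferentiableAt ℂ csqrt z :=
  differentiableAt_id.cpow_const hz

/-- A lower bound for the real part of the square root near `1`. -/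
lemma le_csqrt_re {z : ℂ} {σ : ℝ} (h : ‖z‖ + σ ^ 2 ≤ 1) : σ ≤ (csqrt (1 - z)).re := by
  set s := csqrt (1 - z)
  have hs : s ^ 2 = 1 - z := csqrt_sq _
  have h1 : (s ^ 2).re = s.re ^ 2 - s.im ^ 2 := by simp [sq]
  have h2 : ‖s ^ 2‖ = s.re ^ 2 + s.im ^ 2 := by
    rw [norm_pow, ← Complex.normSq_eq_norm_sq, Complex.normSq_apply]; ring
  rw [hs] at h1 h2
  have h3 : 1 - ‖z‖ ≤ ‖1 - z‖ := by simpa using norm_sub_norm_le (1 : ℂ) z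
  have h4 : 1 - ‖z‖ ≤ (1 - z).re := by
    simp only [Complex.sub_re, Complex.one_re]
    linarith [Complex.re_le_norm z]
  -- Adding `h1` and `h2` gives `2 (Re s)² = Re (1 - z) + ‖1 - z‖ ≥ 2 (1 - ‖z‖) ≥ 2 σ²`; the
  -- principal root has nonnegative real part.
  exact (le_abs_self σ).trans
    (abs_le_of_sq_le_sq (b := s.re) (by linarith [sq_nonneg s.im]) (csqrt_re_nonneg _))

/-- From `(1 - s)(1 + s) = z` for `s = √(1 - z)`, together with `Re s ≥ σ`. -/
lemma norm_one_sub_csqrt_le {z : ℂ} {σ : ℝ} (hσ : 0 ≤ σ) (h : ‖z‖ + σ ^ 2 ≤ 1) :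
    ‖1 - csqrt (1 - z)‖ ≤ ‖z‖ / (1 + σ) := by
  set s := csqrt (1 - z)
  have hs : s ^ 2 = 1 - z := csqrt_sq _
  have hre := le_csqrt_re h
  have h1 : 1 + σ ≤ ‖1 + s‖ := by
    have := Complex.re_le_norm (1 + s)
    simp only [Complex.add_re, Complex.one_re] at this
    linarith
  rw [le_div_iff₀ (by linarith)]
  calc ‖1 - s‖ * (1 + σ) ≤ ‖1 - s‖ * ‖1 + s‖ := by gcongr
    _ = ‖z‖ := by
      rw [← norm_mul]; congr 1
      linear_combination -hs

/-- The first-order Taylor remainder of `√(1 - z)` is exactly `-(1 - s)² / 2`. -/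
lemma norm_csqrt_sub_le {z : ℂ} {σ : ℝ} (hσ : 0 ≤ σ) (h : ‖z‖ + σ ^ 2 ≤ 1) :
    ‖csqrt (1 - z) - 1 + z / 2‖ ≤ (‖z‖ / (1 + σ)) ^ 2 / 2 := by
  have h1 : csqrt (1 - z) - 1 + z / 2 = -((1 - csqrt (1 - z)) ^ 2 / 2) := by
    linear_combination (1 / 2) * csqrt_sq (1 - z)
  rw [h1, norm_neg, norm_div, norm_pow, Complex.norm_two]
  have := norm_one_sub_csqrt_le hσ h
  gcongr

/-- The parameter disc. -/
abbrev paramDisc : Set ℂ := Metric.ball 0 (51 / 100)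

/-- The strip in which the phase is considered. -/
def strip : Set ℂ := {η | |η.im| < 35 / 100}

lemma isOpen_strip : IsOpen strip :=
  isOpen_lt (Complex.continuous_im.abs) continuous_const

lemma convex_strip : Convex ℝ strip := by
  have : strip = Complex.imLm ⁻¹' (Set.Ioo (-(35 / 100)) (35 / 100)) := by
    ext η; simp [strip, abs_lt]
  rw [this]
  exact (convex_Ioo _ _).linear_preimage _

lemma ofReal_mem_strip (x : ℝ) : (x : ℂ) ∈ strip := by
  simp only [strip, Set.mem_ofPred_eq, Complex.ofReal_im, abs_zero]; norm_num

/-- The half-width `0.35` leaves a margin over the displacement bound `1/3`, so displaced points lie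
in an open set of holomorphy. -/
lemma add_mem_strip (x : ℝ) {ξ : ℂ} (hξ : ‖ξ‖ ≤ 1 / 3) : (x : ℂ) + ξ ∈ strip := by
  simp only [strip, Set.mem_ofPred_eq, Complex.add_im, Complex.ofReal_im, zero_add]
  have := Complex.abs_im_le_norm ξ
  linarith

lemma smul_mem_strip {η : ℂ} (hη : η ∈ strip) {u : ℝ} (h0 : 0 ≤ u) (h1 : u ≤ 1) :
    (u : ℂ) * η ∈ strip := by
  simp only [strip, Set.mem_ofPred_eq, Complex.im_ofReal_mul, abs_mul, abs_of_nonneg h0] at hη ⊢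
  exact (mul_le_of_le_one_left (abs_nonneg _) h1).trans_lt hη

/-- The argument is `2 · 0.35`, the largest imaginary part of `2η` up to the edge of the strip. The
exponent `0.245` is split into four equal parts so that `e^y ≤ 1 / (1 - y)` is sharp enough. -/
lemma cosh_seven_tenths_le : Real.cosh (7 / 10) ≤ 129 / 100 := by
  refine (Real.cosh_le_exp_half_sq _).trans ?_
  have h1 : Real.exp (245 / 4000) ≤ 4000 / 3755 := by
    have := Real.add_one_le_exp (-(245 / 4000 : ℝ))
    rw [Real.exp_neg] at this
    have h2 : (3755 / 4000 : ℝ) ≤ (Real.exp (245 / 4000))⁻¹ := by linarith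
    have := inv_anti₀ (by norm_num) h2
    rw [inv_inv] at this
    linarith [show (3755 / 4000 : ℝ)⁻¹ = 4000 / 3755 by norm_num]
  have h3 : Real.exp ((7 / 10) ^ 2 / 2) = Real.exp (245 / 4000) ^ 4 := by
    rw [← Real.exp_nat_mul]; norm_num
  rw [h3]
  calc _ ≤ (4000 / 3755 : ℝ) ^ 4 := by gcongr
    _ ≤ _ := by norm_num

lemma norm_cos_sin_le_cosh (z : ℂ) : ‖Complex.cos z‖ ≤ Real.cosh z.im ∧
    ‖Complex.sin z‖ ≤ Real.cosh z.im := by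
  have h1 : ‖Complex.exp (z * Complex.I)‖ = Real.exp (-z.im) := by
    rw [Complex.norm_exp, Complex.mul_I_re]
  have h2 : ‖Complex.exp (-z * Complex.I)‖ = Real.exp z.im := by
    rw [Complex.norm_exp, Complex.mul_I_re, Complex.neg_im, neg_neg]
  rw [Real.cosh_eq]
  constructor
  · rw [Complex.cos, norm_div, Complex.norm_two]
    have := norm_add_le (Complex.exp (z * Complex.I)) (Complex.exp (-z * Complex.I))
    rw [h1, h2] at this
    linarith
  · rw [Complex.sin, norm_div, Complex.norm_two, norm_mul, Complex.norm_I, mul_one]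
    have := norm_sub_le (Complex.exp (-z * Complex.I)) (Complex.exp (z * Complex.I))
    rw [h1, h2] at this
    linarith

lemma norm_cos_sin_two_mul_le {η : ℂ} (hη : η ∈ strip) :
    ‖Complex.cos (2 * η)‖ ≤ 129 / 100 ∧ ‖Complex.sin (2 * η)‖ ≤ 129 / 100 := by
  have him : (2 * η).im = 2 * η.im := by simp
  have hc : Real.cosh (2 * η).im ≤ 129 / 100 := by
    refine le_trans ?_ cosh_seven_tenths_le
    rw [Real.cosh_le_cosh, him, abs_mul, abs_of_pos (by norm_num : (0 : ℝ) < 7 / 10), abs_two]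
    have : |η.im| < 35 / 100 := hη
    linarith
  exact ⟨(norm_cos_sin_le_cosh _).1.trans hc, (norm_cos_sin_le_cosh _).2.trans hc⟩

lemma norm_param_lt {e : ℂ} (he : e ∈ paramDisc) : ‖e‖ < 51 / 100 := by simpa using he

lemma norm_mul_cos_le {e η : ℂ} (he : e ∈ paramDisc) (hη : η ∈ strip) :
    ‖e * Complex.cos (2 * η)‖ ≤ 658 / 1000 := by
  rw [norm_mul]
  have h1 := (norm_param_lt he).le
  have h2 := (norm_cos_sin_two_mul_le hη).1
  calc _ ≤ (51 / 100 : ℝ) * (129 / 100) := by gcongr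
    _ ≤ _ := by norm_num

lemma norm_mul_cos_real_le {e : ℂ} (he : e ∈ paramDisc) (x : ℝ) :
    ‖e * Complex.cos (2 * x)‖ ≤ 51 / 100 := by
  rw [norm_mul]
  have h1 := (norm_param_lt he).le
  have h2 : ‖Complex.cos (2 * (x : ℂ))‖ ≤ 1 := by
    have := (norm_cos_sin_le_cosh (2 * (x : ℂ))).1
    simpa using this
  calc _ ≤ (51 / 100 : ℝ) * 1 := by gcongr
    _ ≤ _ := by norm_num

/-- The radicand `1 - e cos 2η`. -/
noncomputable def radicand (e η : ℂ) : ℂ := 1 - e * Complex.cos (2 * η)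

/-- The derivative of the unnormalized phase. -/
noncomputable def root (e η : ℂ) : ℂ := csqrt (radicand e η)

lemma radicand_re_pos {e η : ℂ} (he : e ∈ paramDisc) (hη : η ∈ strip) :
    342 / 1000 ≤ (radicand e η).re := by
  have h1 := norm_mul_cos_le he hη
  have h2 := Complex.re_le_norm (e * Complex.cos (2 * η))
  simp only [radicand, Complex.sub_re, Complex.one_re]
  linarith

lemma radicand_mem_slitPlane {e η : ℂ} (he : e ∈ paramDisc) (hη : η ∈ strip) :
    radicand e η ∈ Complex.slitPlane :=
  Or.inl (lt_of_lt_of_le (by norm_num) (radicand_re_pos he hη))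

lemma radicand_ne_zero {e η : ℂ} (he : e ∈ paramDisc) (hη : η ∈ strip) : radicand e η ≠ 0 :=
  Complex.slitPlane_ne_zero (radicand_mem_slitPlane he hη)

lemma le_norm_radicand {e η : ℂ} (he : e ∈ paramDisc) (hη : η ∈ strip) :
    342 / 1000 ≤ ‖radicand e η‖ := (radicand_re_pos he hη).trans (Complex.re_le_norm _)

lemma continuousOn_root : ContinuousOn (fun p : ℂ × ℂ => root p.1 p.2) (paramDisc ×ˢ strip) := by
  intro p hp
  have h1 : ContinuousAt csqrt (radicand p.1 p.2) :=
    (differentiableAt_csqrt (radicand_mem_slitPlane hp.1 hp.2)).continuousAt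
  have h2 : Continuous fun p : ℂ × ℂ => radicand p.1 p.2 := by unfold radicand; fun_prop
  exact (ContinuousAt.comp (f := fun p : ℂ × ℂ => radicand p.1 p.2) h1
    h2.continuousAt).continuousWithinAt

/-- The square root along a holomorphic family of points. -/
lemma differentiableAt_root_comp {f g : ℂ → ℂ} {w : ℂ} (hf : DifferentiableAt ℂ f w)
    (hg : DifferentiableAt ℂ g w) (he : f w ∈ paramDisc) (hη : g w ∈ strip) :
    DifferentiableAt ℂ (fun w => root (f w) (g w)) w := by
  have h2 : DifferentiableAt ℂ (fun w => radicand (f w) (g w)) w := by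
    unfold radicand; fun_prop
  exact DifferentiableAt.comp (f := fun w => radicand (f w) (g w)) w
    (differentiableAt_csqrt (radicand_mem_slitPlane he hη)) h2

/-- On the strip `|e cos 2η| ≤ 0.658`, and `σ = 0.5848` is chosen with `0.658 + σ² ≤ 1`; then `0.658
/ (1 + σ) ≤ 0.4152`. -/
lemma norm_one_sub_root_le {e η : ℂ} (he : e ∈ paramDisc) (hη : η ∈ strip) :
    ‖1 - root e η‖ ≤ 4152 / 10000 := by
  have h := norm_mul_cos_le he hη
  have h1 := norm_one_sub_csqrt_le (σ := 5848 / 10000) (by norm_num)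
    (show ‖e * Complex.cos (2 * η)‖ + _ ≤ 1 by linarith)
  refine h1.trans ?_
  rw [div_le_iff₀ (by norm_num)]
  linarith

lemma norm_root_sub_le {e η : ℂ} (he : e ∈ paramDisc) (hη : η ∈ strip) :
    ‖root e η - 1 + e * Complex.cos (2 * η) / 2‖ ≤ 862 / 10000 := by
  have h := norm_mul_cos_le he hη
  have h1 := norm_csqrt_sub_le (σ := 5848 / 10000) (by norm_num)
    (show ‖e * Complex.cos (2 * η)‖ + _ ≤ 1 by linarith)
  refine h1.trans ?_
  have h2 : ‖e * Complex.cos (2 * η)‖ / (1 + 5848 / 10000) ≤ 4152 / 10000 := by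
    rw [div_le_iff₀ (by norm_num)]; linarith
  have h3 : 0 ≤ ‖e * Complex.cos (2 * η)‖ / (1 + 5848 / 10000) := by positivity
  nlinarith

/-- On the real line `|cos| ≤ 1`, so `0.51 + 0.7² = 1` permits `σ = 0.7`, and `(0.51 / 1.7)² / 2 =
0.045`. -/
lemma norm_root_sub_real_le {e : ℂ} (he : e ∈ paramDisc) (x : ℝ) :
    ‖root e x - 1 + e * Complex.cos (2 * x) / 2‖ ≤ 45 / 1000 := by
  have h := norm_mul_cos_real_le he x
  have h1 := norm_csqrt_sub_le (σ := 7 / 10) (by norm_num)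
    (show ‖e * Complex.cos (2 * x)‖ + _ ≤ 1 by linarith)
  refine h1.trans ?_
  have h2 : ‖e * Complex.cos (2 * x)‖ / (1 + 7 / 10) ≤ 3 / 10 := by
    rw [div_le_iff₀ (by norm_num)]; linarith
  have h3 : 0 ≤ ‖e * Complex.cos (2 * x)‖ / (1 + 7 / 10) := by positivity
  nlinarith

lemma le_root_re {e : ℂ} (he : e ∈ paramDisc) (x : ℝ) : 7 / 10 ≤ (root e x).re := by
  have h := norm_mul_cos_real_le he x
  exact le_csqrt_re (show ‖e * Complex.cos (2 * x)‖ + _ ≤ 1 by linarith)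

/-- The function `x ↦ root e (x η / π)` on `[0, π]`. -/
noncomputable def rootFamily (p : ℂ × ℂ) : Coeff :=
  ContinuousMap.mkD (fun x : HalfPeriod => root p.1 (((x : ℝ) / Real.pi : ℝ) * p.2)) 0

lemma div_pi_mul_mem_strip (x : HalfPeriod) {η : ℂ} (hη : η ∈ strip) :
    (((x : ℝ) / Real.pi : ℝ) : ℂ) * η ∈ strip :=
  smul_mem_strip hη (div_nonneg x.2.1 Real.pi_pos.le) ((div_le_one Real.pi_pos).2 x.2.2)

lemma rootFamily_apply {p : ℂ × ℂ} (hp : p ∈ paramDisc ×ˢ strip) (x : HalfPeriod) :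
    rootFamily p x = root p.1 (((x : ℝ) / Real.pi : ℝ) * p.2) := by
  refine ContinuousMap.mkD_apply_of_continuous ?_
  exact continuousOn_root.comp_continuous
    (f := fun x : HalfPeriod => (p.1, (((x : ℝ) / Real.pi : ℝ) : ℂ) * p.2)) (by fun_prop)
    fun x => ⟨hp.1, div_pi_mul_mem_strip x hp.2⟩

lemma continuousOn_rootFamily : ContinuousOn rootFamily (paramDisc ×ˢ strip) := by
  refine continuousOn_continuousMap ?_
  have h : ContinuousOn (fun q : (ℂ × ℂ) × HalfPeriod =>
      root q.1.1 (((q.2 : ℝ) / Real.pi : ℝ) * q.1.2)) ((paramDisc ×ˢ strip) ×ˢ Set.univ) :=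
    continuousOn_root.comp
      (f := fun q : (ℂ × ℂ) × HalfPeriod => (q.1.1, (((q.2 : ℝ) / Real.pi : ℝ) : ℂ) * q.1.2))
      (by fun_prop) fun q hq => ⟨hq.1.1, div_pi_mul_mem_strip q.2 hq.1.2⟩
  exact h.congr fun q hq => rootFamily_apply hq.1 q.2

/-- Holomorphic substitution in `rootFamily`. -/
lemma differentiableOn_rootFamily_comp {f g : ℂ → ℂ} {U : Set ℂ} (hU : IsOpen U)
    (hf : DifferentiableOn ℂ f U) (hg : DifferentiableOn ℂ g U)
    (hmaps : ∀ w ∈ U, (f w, g w) ∈ paramDisc ×ˢ strip) :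
    DifferentiableOn ℂ (fun w => rootFamily (f w, g w)) U := by
  refine differentiableOn_continuousMap hU
    (continuousOn_rootFamily.comp (hf.continuousOn.prodMk hg.continuousOn) hmaps) fun x => ?_
  intro w hw
  have h1 := hf.differentiableAt (hU.mem_nhds hw)
  have h2 := hg.differentiableAt (hU.mem_nhds hw)
  have h3 := differentiableAt_root_comp (w := w) h1
    (h2.const_mul (((x : ℝ) / Real.pi : ℝ) : ℂ)) (hmaps w hw).1
    (div_pi_mul_mem_strip x (hmaps w hw).2)
  refine (h3.congr_of_eventuallyEq ?_).differentiableWithinAt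
  filter_upwards [hU.mem_nhds hw] with z hz
  exact rootFamily_apply (hmaps z hz) x

/-- The unnormalized phase `∫₀^η √(1 - e cos 2u) du`. -/
noncomputable def action (e η : ℂ) : ℂ := η / Real.pi * primitiveL (rootFamily (e, η)) piPt

lemma action_zero (e : ℂ) : action e 0 = 0 := by simp [action]

lemma differentiableOn_action_comp {f g : ℂ → ℂ} {U : Set ℂ} (hU : IsOpen U)
    (hf : DifferentiableOn ℂ f U) (hg : DifferentiableOn ℂ g U)
    (hmaps : ∀ w ∈ U, (f w, g w) ∈ paramDisc ×ˢ strip) :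
    DifferentiableOn ℂ (fun w => action (f w) (g w)) U := by
  have h := differentiableOn_rootFamily_comp hU hf hg hmaps
  have h2 : DifferentiableOn ℂ (fun w => primitiveL (rootFamily (f w, g w)) piPt) U := fun w hw =>
    (((ContinuousMap.evalCLM ℂ piPt).comp primitiveL).differentiableAt).comp_differentiableWithinAt
      w (h w hw)
  exact (hg.div_const _).mul h2

lemma continuousOn_action : ContinuousOn (fun p : ℂ × ℂ => action p.1 p.2)
    (paramDisc ×ˢ strip) := by
  have h2 : ContinuousOn (fun p : ℂ × ℂ => primitiveL (rootFamily p) piPt) (paramDisc ×ˢ strip) :=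
    ((ContinuousMap.evalCLM ℂ piPt).comp primitiveL).continuous.comp_continuousOn
      continuousOn_rootFamily
  exact (continuous_snd.div_const _).continuousOn.mul h2

/-- The action is an integral along the segment from `0` to `η`, rescaled to `[0, π]`. After
differentiation under the integral, the integrand is the total derivative of `x · root e (x η / π)`,
so only the end point contributes. -/
lemma hasDerivAt_action {e η : ℂ} (he : e ∈ paramDisc) (hη : η ∈ strip) :
    HasDerivAt (action e) (root e η) η := by
  let F : ℂ → Coeff := fun w => rootFamily (e, w)
  have hF : DifferentiableAt ℂ F η :=
    (differentiableOn_rootFamily_comp isOpen_strip (differentiableOn_const e) differentiableOn_id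
      fun w hw => ⟨he, hw⟩).differentiableAt (isOpen_strip.mem_nhds hη)
  have hrd : ∀ w ∈ strip, HasDerivAt (root e) (deriv (root e) w) w := fun w hw =>
    (differentiableAt_root_comp (differentiableAt_const e) differentiableAt_id he hw).hasDerivAt
  have hFx : ∀ x : HalfPeriod, deriv F η x
      = deriv (root e) ((((x : ℝ) / Real.pi : ℝ) : ℂ) * η) * (((x : ℝ) / Real.pi : ℝ) : ℂ) := by
    intro x
    let L : Coeff →L[ℂ] ℂ := ContinuousMap.evalCLM ℂ x
    have h1 : HasDerivAt (fun w => F w x) (deriv F η x) η :=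
      L.hasFDerivAt.comp_hasDerivAt η hF.hasDerivAt
    have h2 : HasDerivAt (fun w => root e ((((x : ℝ) / Real.pi : ℝ) : ℂ) * w))
        (deriv (root e) ((((x : ℝ) / Real.pi : ℝ) : ℂ) * η) * (((x : ℝ) / Real.pi : ℝ) : ℂ)) η := by
      have h3 : HasDerivAt (fun w : ℂ => (((x : ℝ) / Real.pi : ℝ) : ℂ) * w)
          ((((x : ℝ) / Real.pi : ℝ) : ℂ)) η := by
        simpa using (hasDerivAt_id η).const_mul (((x : ℝ) / Real.pi : ℝ) : ℂ)
      exact (hrd _ (div_pi_mul_mem_strip x hη)).comp η h3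
    refine h1.unique (h2.congr_of_eventuallyEq ?_)
    filter_upwards [isOpen_strip.mem_nhds hη] with w hw
    exact rootFamily_apply (p := (e, w)) ⟨he, hw⟩ x
  have hG : HasDerivAt (fun w => primitiveL (F w) piPt) (primitiveL (deriv F η) piPt) η :=
    ((ContinuousMap.evalCLM ℂ piPt).comp primitiveL).hasFDerivAt.comp_hasDerivAt η hF.hasDerivAt
  have hS : HasDerivAt (action e)
      (1 / Real.pi * primitiveL (F η) piPt + η / Real.pi * primitiveL (deriv F η) piPt) η :=
    ((hasDerivAt_id η).div_const (Real.pi : ℂ)).mul hG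
  refine hS.congr_deriv ?_
  have hpi : (Real.pi : ℂ) ≠ 0 := by exact_mod_cast Real.pi_ne_zero
  have hint := eq_add_integral_of_hasDerivWithinAt
    (f := fun x : ℝ => (x : ℂ) * root e (((x / Real.pi : ℝ) : ℂ) * η))
    (f' := fun x : ℝ => root e (((x / Real.pi : ℝ) : ℂ) * η) + (x : ℂ) *
      (deriv (root e) (((x / Real.pi : ℝ) : ℂ) * η) * (η / Real.pi)))
    (fun x hx => by
      have h1 : HasDerivAt (fun x : ℝ => (x : ℂ)) 1 x := Complex.ofRealCLM.hasDerivAt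
      have h2 : HasDerivAt (fun w : ℂ => (w / Real.pi) * η) (1 / Real.pi * η) (x : ℂ) :=
        ((hasDerivAt_id (x : ℂ)).div_const _).mul_const η
      have hmem : ((x : ℂ) / Real.pi) * η ∈ strip := by
        have := div_pi_mul_mem_strip ⟨x, hx⟩ hη
        simpa using this
      have h3 := ((hrd _ hmem).comp (x : ℂ) h2).comp_ofReal
      have h4 := (h1.mul h3).hasDerivWithinAt (s := Set.Icc 0 Real.pi)
      have e1 : (fun x : ℝ => (x : ℂ)) * (fun y : ℝ => (root e ∘ fun w : ℂ => (w / Real.pi) * η) y)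
          = fun x : ℝ => (x : ℂ) * root e (((x / Real.pi : ℝ) : ℂ) * η) := by
        funext y; simp
      rw [e1] at h4
      refine h4.congr_deriv ?_
      simp only [Function.comp_apply, Complex.ofReal_div]
      ring)
    (F η + η • deriv F η)
    (fun x => by
      have h1 : F η x = _ := rootFamily_apply (p := (e, η)) ⟨he, hη⟩ x
      rw [ContinuousMap.add_apply, ContinuousMap.smul_apply, h1, hFx, smul_eq_mul]
      push_cast
      field_simp) piPt
  have hprim : primitiveL (F η + η • deriv F η) piPt = Real.pi * root e η := by
    rw [primitiveL_apply]
    have e2 : ((piPt : ℝ) / Real.pi : ℝ) = 1 := div_self Real.pi_ne_zero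
    rw [e2] at hint
    simp only [Complex.ofReal_one, one_mul, Complex.ofReal_zero, zero_mul, zero_add] at hint
    exact hint.symm
  rw [map_add, map_smul, ContinuousMap.add_apply, ContinuousMap.smul_apply, smul_eq_mul] at hprim
  field_simp
  linear_combination hprim

/-! ### The mean and the normalized phase -/

/-- The mean of `root e` over the half period. -/
noncomputable def meanRoot (e : ℂ) : ℂ := action e Real.pi / Real.pi

lemma action_pi (e : ℂ) : action e Real.pi = meanRoot e * Real.pi := by
  have hpi : (Real.pi : ℂ) ≠ 0 := by exact_mod_cast Real.pi_ne_zero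
  rw [meanRoot, div_mul_cancel₀ _ hpi]

lemma differentiableOn_meanRoot : DifferentiableOn ℂ meanRoot paramDisc :=
  (differentiableOn_action_comp Metric.isOpen_ball differentiableOn_id (differentiableOn_const _)
    fun _ hw => ⟨hw, ofReal_mem_strip _⟩).div_const _

lemma hasDerivAt_sin_two_mul (η : ℂ) :
    HasDerivAt (fun η : ℂ => Complex.sin (2 * η)) (2 * Complex.cos (2 * η)) η := by
  have h : HasDerivAt (fun η : ℂ => 2 * η) 2 η := by simpa using (hasDerivAt_id η).const_mul 2
  refine h.csin.congr_deriv ?_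
  ring

lemma sin_two_mul_pi : Complex.sin (2 * (Real.pi : ℂ)) = 0 := by
  rw [Complex.sin_two_mul, Complex.sin_pi]; ring

/-- The first-order term `-(e/2) cos 2x` has zero mean over `[0, π]`, so only the second-order
remainder counts. -/
lemma norm_meanRoot_sub_one_le {e : ℂ} (he : e ∈ paramDisc) :
    ‖meanRoot e - 1‖ ≤ 45 / 1000 := by
  have hd : ∀ x ∈ Set.Icc (0 : ℝ) Real.pi, HasDerivWithinAt
      (fun x : ℝ => action e x - x + e / 4 * Complex.sin (2 * x))
      (root e x - 1 + e * Complex.cos (2 * x) / 2) (Set.Icc 0 Real.pi) x := by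
    intro x _
    have h := ((hasDerivAt_action he (ofReal_mem_strip x)).sub (hasDerivAt_id (x : ℂ))).add
      ((hasDerivAt_sin_two_mul (x : ℂ)).const_mul (e / 4))
    refine (h.comp_ofReal.congr_deriv ?_).hasDerivWithinAt
    ring
  have h := (convex_Icc (0 : ℝ) Real.pi).norm_image_sub_le_of_norm_hasDerivWithin_le hd
    (fun x _ => norm_root_sub_real_le he x) ⟨le_rfl, Real.pi_pos.le⟩ ⟨Real.pi_pos.le, le_rfl⟩
  simp only [Complex.ofReal_zero, action_zero, mul_zero, Complex.sin_zero, sub_zero, add_zero,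
    sin_two_mul_pi, action_pi] at h
  rw [show meanRoot e * Real.pi - Real.pi = (meanRoot e - 1) * Real.pi by ring, norm_mul,
    Complex.norm_real] at h
  exact le_of_mul_le_mul_right h (norm_pos_iff.2 Real.pi_ne_zero)

lemma le_norm_meanRoot {e : ℂ} (he : e ∈ paramDisc) : 955 / 1000 ≤ ‖meanRoot e‖ := by
  have h1 := norm_meanRoot_sub_one_le he
  have h2 := norm_sub_norm_le (1 : ℂ) (1 - meanRoot e)
  rw [norm_one, norm_sub_rev, sub_sub_cancel] at h2
  linarith

lemma norm_meanRoot_le {e : ℂ} (he : e ∈ paramDisc) : ‖meanRoot e‖ ≤ 1045 / 1000 := by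
  have h1 := norm_meanRoot_sub_one_le he
  have h2 := norm_add_le (1 : ℂ) (meanRoot e - 1)
  rw [norm_one, add_sub_cancel] at h2
  linarith

lemma meanRoot_ne_zero {e : ℂ} (he : e ∈ paramDisc) : meanRoot e ≠ 0 := fun h => by
  have := le_norm_meanRoot he
  rw [h, norm_zero] at this
  norm_num at this

/-- The deviation of the normalized phase from the identity. -/
noncomputable def phaseDev (e η : ℂ) : ℂ := action e η / meanRoot e - η

lemma hasDerivAt_phaseDev {e η : ℂ} (he : e ∈ paramDisc) (hη : η ∈ strip) :
    HasDerivAt (phaseDev e) (root e η / meanRoot e - 1) η :=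
  ((hasDerivAt_action he hη).div_const _).sub (hasDerivAt_id η)

/-- Numerically `(0.4152 + 0.045) / 0.955 < 1/2`. This is the contraction constant used to invert
the phase. -/
lemma norm_deriv_phaseDev_le {e η : ℂ} (he : e ∈ paramDisc) (hη : η ∈ strip) :
    ‖root e η / meanRoot e - 1‖ ≤ 1 / 2 := by
  have hM := meanRoot_ne_zero he
  have h1 := norm_one_sub_root_le he hη
  have h2 := norm_meanRoot_sub_one_le he
  have h3 := le_norm_meanRoot he
  have h4 : root e η / meanRoot e - 1 = -((1 - root e η) + (meanRoot e - 1)) / meanRoot e := by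
    field_simp; ring
  rw [h4, norm_div, norm_neg, div_le_iff₀ (by linarith)]
  have := norm_add_le (1 - root e η) (meanRoot e - 1)
  linarith

lemma phaseDev_lipschitz {e : ℂ} (he : e ∈ paramDisc) {η η' : ℂ} (hη : η ∈ strip)
    (hη' : η' ∈ strip) : ‖phaseDev e η - phaseDev e η'‖ ≤ 1 / 2 * ‖η - η'‖ :=
  convex_strip.norm_image_sub_le_of_norm_hasDerivWithin_le
    (fun _ hw => (hasDerivAt_phaseDev he hw).hasDerivWithinAt)
    (fun _ hw => norm_deriv_phaseDev_le he hw) hη' hη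

/-- The part of the phase of second order in `e`. -/
noncomputable def phaseRem (e η : ℂ) : ℂ :=
  action e η - meanRoot e * η + e / 4 * Complex.sin (2 * η)

lemma hasDerivAt_phaseRem {e η : ℂ} (he : e ∈ paramDisc) (hη : η ∈ strip) :
    HasDerivAt (phaseRem e) (root e η - meanRoot e + e * Complex.cos (2 * η) / 2) η := by
  have h := ((hasDerivAt_action he hη).sub ((hasDerivAt_id η).const_mul (meanRoot e))).add
      ((hasDerivAt_sin_two_mul η).const_mul (e / 4))
  refine h.congr_deriv ?_
  ring

lemma phaseRem_zero (e : ℂ) : phaseRem e 0 = 0 := by simp [phaseRem, action_zero]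

lemma phaseRem_pi (e : ℂ) : phaseRem e Real.pi = 0 := by
  simp [phaseRem, action_pi]

/-- The symmetry `η ↦ π - η` of `cos 2η` makes `phaseRem e η + phaseRem e (π - η)` constant, equal
to its value `0` at the end point. A third zero halves the distance over which the remainder can
grow. -/
lemma phaseRem_half_pi {e : ℂ} (he : e ∈ paramDisc) : phaseRem e ((Real.pi / 2 : ℝ) : ℂ) = 0 := by
  have hd : ∀ η ∈ strip, HasDerivWithinAt (fun η => phaseRem e η + phaseRem e (Real.pi - η)) 0
      strip η := by
    intro η hη
    have hη' : (Real.pi : ℂ) - η ∈ strip := by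
      simpa [strip] using hη
    have h1 : HasDerivAt (fun w : ℂ => (Real.pi : ℂ) - w) (-1) η :=
      (hasDerivAt_id η).const_sub _
    have h2 := (hasDerivAt_phaseRem he hη).add ((hasDerivAt_phaseRem he hη').comp η h1)
    have hc : Complex.cos (2 * (Real.pi - η)) = Complex.cos (2 * η) := by
      rw [mul_sub, mul_comm 2 (Real.pi : ℂ), mul_comm (Real.pi : ℂ) 2, Complex.cos_two_pi_sub]
    have hr : root e (Real.pi - η) = root e η := by rw [root, root, radicand, radicand, hc]
    refine (h2.congr_deriv ?_).hasDerivWithinAt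
    rw [hc, hr]; ring
  have h := convex_strip.norm_image_sub_le_of_norm_hasDerivWithin_le (C := 0) hd
    (fun _ _ => by simp) (ofReal_mem_strip 0) (ofReal_mem_strip (Real.pi / 2))
  rw [zero_mul] at h
  have h' := sub_eq_zero.1 (norm_le_zero_iff.1 h)
  have h3 : (Real.pi : ℂ) - ((Real.pi / 2 : ℝ) : ℂ) = ((Real.pi / 2 : ℝ) : ℂ) := by
    push_cast; ring
  simp only [Complex.ofReal_zero, phaseRem_zero, sub_zero, phaseRem_pi, add_zero, h3] at h'
  have h4 : 2 * phaseRem e ((Real.pi / 2 : ℝ) : ℂ) = 0 := by rw [two_mul]; exact h'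
  simpa using h4

lemma norm_phaseRem_sub_le {e : ℂ} (he : e ∈ paramDisc) {η η' : ℂ} (hη : η ∈ strip)
    (hη' : η' ∈ strip) : ‖phaseRem e η - phaseRem e η'‖ ≤ 1312 / 10000 * ‖η - η'‖ := by
  refine convex_strip.norm_image_sub_le_of_norm_hasDerivWithin_le
    (fun _ hw => (hasDerivAt_phaseRem he hw).hasDerivWithinAt) (fun w hw => ?_) hη' hη
  have h1 := norm_root_sub_le he hw
  have h2 := norm_meanRoot_sub_one_le he
  have h3 := norm_sub_le (root e w - 1 + e * Complex.cos (2 * w) / 2) (meanRoot e - 1)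
  rw [show root e w - 1 + e * Complex.cos (2 * w) / 2 - (meanRoot e - 1)
    = root e w - meanRoot e + e * Complex.cos (2 * w) / 2 by ring] at h3
  linarith

/-- The deviation of the phase stays in the disc of radius `1/3`. -/
lemma norm_phaseDev_le {e : ℂ} (he : e ∈ paramDisc) {t : ℝ} (ht : t ∈ Set.Icc 0 Real.pi) {ξ : ℂ}
    (hξ : ‖ξ‖ ≤ 1 / 3) : ‖phaseDev e (t + ξ)‖ ≤ 1 / 3 := by
  have hM := meanRoot_ne_zero he
  have hmem := add_mem_strip t hξ
  -- One of the zeros `0`, `π/2`, `π` of the remainder is within `π/4` of `t`.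
  obtain ⟨c, hc0, hct⟩ : ∃ c : ℝ, phaseRem e (c : ℂ) = 0 ∧ |t - c| ≤ Real.pi / 4 := by
    rcases le_total t (Real.pi / 4) with h1 | h1
    · exact ⟨0, by simpa using phaseRem_zero e, by rw [abs_le]; constructor <;> linarith [ht.1]⟩
    · rcases le_total t (3 * Real.pi / 4) with h2 | h2
      · exact ⟨Real.pi / 2, phaseRem_half_pi he, by rw [abs_le]; constructor <;> linarith⟩
      · exact ⟨Real.pi, phaseRem_pi e, by rw [abs_le]; constructor <;> linarith [ht.2]⟩
  have h1 := norm_phaseRem_sub_le he hmem (ofReal_mem_strip c)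
  rw [hc0, sub_zero] at h1
  have h2 : ‖(t : ℂ) + ξ - c‖ ≤ Real.pi / 4 + 1 / 3 := by
    rw [show (t : ℂ) + ξ - c = ((t - c : ℝ) : ℂ) + ξ by push_cast; ring]
    refine (norm_add_le _ _).trans (add_le_add ?_ hξ)
    rwa [Complex.norm_real]
  have h3 := (norm_cos_sin_two_mul_le hmem).2
  have h4 : phaseDev e (t + ξ)
      = (phaseRem e (t + ξ) - e / 4 * Complex.sin (2 * (t + ξ))) / meanRoot e := by
    rw [phaseDev, phaseRem]; field_simp; ring
  have h5 := le_norm_meanRoot he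
  have hpi := Real.pi_lt_d4
  rw [h4, norm_div, div_le_iff₀ (by linarith)]
  -- The budget is `0.1312 (π/4 + 1/3) + (0.51/4) · 1.29 < 0.312`, below `0.955 / 3`.
  have h6 : ‖e / 4 * Complex.sin (2 * (t + ξ))‖ ≤ 51 / 400 * (129 / 100) := by
    rw [norm_mul, norm_div]
    have := (norm_param_lt he).le
    have h4 : ‖(4 : ℂ)‖ = 4 := by simp
    rw [h4]
    have h7 : ‖e‖ / 4 ≤ 51 / 400 := by linarith
    gcongr
  have h8 := norm_sub_le (phaseRem e (t + ξ)) (e / 4 * Complex.sin (2 * (t + ξ)))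
  linarith

lemma continuousOn_eval_family {U : Set ℂ} {g : ℂ → Coeff} (hg : ContinuousOn g U) :
    ContinuousOn (fun p : ℂ × HalfPeriod => g p.1 p.2) (U ×ˢ Set.univ) := by
  refine continuousOn_iff_continuous_domRestrict.2 ?_
  have : Continuous fun p : (U ×ˢ Set.univ : Set (ℂ × HalfPeriod)) => g p.1.1 :=
    hg.comp_continuous (by fun_prop) fun p => p.2.1
  exact this.eval (by fun_prop)

/-- The inverse of the phase map: a holomorphic family of displacements. -/
lemma exists_displacement : ∃ ξ : ℂ → Coeff, DifferentiableOn ℂ ξ paramDisc ∧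
    ∀ e ∈ paramDisc, ∀ t : HalfPeriod, ‖ξ e t‖ ≤ 1 / 3 ∧ phaseDev e ((t : ℝ) + ξ e t) = -ξ e t := by
  let T : ℂ → Coeff → Coeff := fun e g =>
    ContinuousMap.mkD (fun t : HalfPeriod => -phaseDev e ((t : ℝ) + g t)) 0
  have hcont : ContinuousOn (fun p : ℂ × ℂ => -phaseDev p.1 p.2) (paramDisc ×ˢ strip) :=
    ((continuousOn_action.div (differentiableOn_meanRoot.continuousOn.comp continuousOn_fst
      fun p hp => hp.1) fun p hp => meanRoot_ne_zero hp.1).sub continuousOn_snd).neg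
  have hball : ∀ g : Coeff, g ∈ Metric.closedBall 0 (1 / 3) → ∀ t, ‖g t‖ ≤ 1 / 3 := fun g hg t =>
    (g.norm_coe_le_norm t).trans (mem_closedBall_zero_iff.1 hg)
  have hT : ∀ e ∈ paramDisc, ∀ g ∈ Metric.closedBall (0 : Coeff) (1 / 3), ∀ t : HalfPeriod,
      T e g t = -phaseDev e ((t : ℝ) + g t) := by
    intro e he g hg t
    refine ContinuousMap.mkD_apply_of_continuous ?_
    exact hcont.comp_continuous (f := fun t : HalfPeriod => (e, ((t : ℝ) : ℂ) + g t))
      (by fun_prop) fun t => ⟨he, add_mem_strip _ (hball g hg t)⟩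
  -- With `X = t + ξ`, the fixed-point equation `phaseDev e X = -ξ` says `action e X / meanRoot e =
  -- t`, so `X` inverts the normalized phase.
  obtain ⟨ξ, h1, h2, h3⟩ := exists_holomorphic_fixedPoint (S := paramDisc) (T := T) (c := 0)
    (r := 1 / 3) (κ := 1 / 2) Metric.isOpen_ball (by norm_num) (by norm_num)
    (fun e he g hg => by
      rw [mem_closedBall_zero_iff, ContinuousMap.norm_le _ (by norm_num)]
      intro t
      rw [hT e he g hg, norm_neg]
      exact norm_phaseDev_le he t.2 (hball g hg t))
    (fun e he g hg g' hg' => by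
      rw [dist_eq_norm, ContinuousMap.norm_le _ (by positivity)]
      intro t
      rw [ContinuousMap.sub_apply, hT e he g hg, hT e he g' hg', neg_sub_neg, norm_sub_rev]
      refine (phaseDev_lipschitz he (add_mem_strip _ (hball g hg t))
        (add_mem_strip _ (hball g' hg' t))).trans ?_
      rw [add_sub_add_left_eq_sub, dist_eq_norm]
      gcongr
      exact (g - g').norm_coe_le_norm t)
    (fun g hg hmaps => by
      refine differentiableOn_continuousMap_of_joint Metric.isOpen_ball ?_ fun t => ?_
      · have hgc := continuousOn_eval_family hg.continuousOn
        have h : ContinuousOn (fun p : ℂ × HalfPeriod =>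
            -phaseDev p.1 (((p.2 : ℝ) : ℂ) + g p.1 p.2)) (paramDisc ×ˢ Set.univ) :=
          hcont.comp (f := fun p : ℂ × HalfPeriod => (p.1, ((p.2 : ℝ) : ℂ) + g p.1 p.2))
            (continuousOn_fst.prodMk (ContinuousOn.add (by fun_prop) hgc))
            fun p hp => ⟨hp.1, add_mem_strip _ (hball _ (hmaps hp.1) _)⟩
        exact h.congr fun p hp => hT _ hp.1 _ (hmaps hp.1) _
      · have hgt : DifferentiableOn ℂ (fun e => ((t : ℝ) : ℂ) + g e t) paramDisc := fun e he =>
          (((ContinuousMap.evalCLM ℂ t).differentiableAt).comp_differentiableWithinAt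
            e (hg e he)).const_add _
        have h : DifferentiableOn ℂ (fun e => -phaseDev e (((t : ℝ) : ℂ) + g e t)) paramDisc :=
          (((differentiableOn_action_comp Metric.isOpen_ball differentiableOn_id hgt
            fun e he => ⟨he, add_mem_strip _ (hball _ (hmaps he) _)⟩).div
            differentiableOn_meanRoot fun e he => meanRoot_ne_zero he).sub hgt).neg
        exact h.congr fun e he => hT _ he _ (hmaps he) _)
  refine ⟨ξ, h1, fun e he t => ⟨hball _ (h2 he) t, ?_⟩⟩
  have := hT e he (ξ e) (h2 he) t
  rw [h3 e he] at this
  exact neg_eq_iff_eq_neg.1 this.symm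

/-! ### The Liouville transformation -/

/-- The displacement `X(t) - t`, where `X` is the inverse of the phase. -/
noncomputable def displacement : ℂ → Coeff := exists_displacement.choose

lemma differentiableOn_displacement : DifferentiableOn ℂ displacement paramDisc :=
  exists_displacement.choose_spec.1

lemma norm_displacement_le {e : ℂ} (he : e ∈ paramDisc) (t : HalfPeriod) :
    ‖displacement e t‖ ≤ 1 / 3 := (exists_displacement.choose_spec.2 e he t).1

lemma phaseDev_displacement {e : ℂ} (he : e ∈ paramDisc) (t : HalfPeriod) :
    phaseDev e ((t : ℝ) + displacement e t) = -displacement e t :=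
  (exists_displacement.choose_spec.2 e he t).2

lemma displacement_eq {e : ℂ} (he : e ∈ paramDisc) (t : HalfPeriod) {ξ : ℂ} (hξ : ‖ξ‖ ≤ 1 / 3)
    (h : phaseDev e ((t : ℝ) + ξ) = -ξ) : displacement e t = ξ := by
  have h1 := phaseDev_lipschitz he (add_mem_strip t (norm_displacement_le he t))
    (add_mem_strip t hξ)
  rw [phaseDev_displacement he, h, neg_sub_neg, add_sub_add_left_eq_sub, norm_sub_rev] at h1
  have h2 : ‖displacement e t - ξ‖ ≤ 0 := by linarith [norm_nonneg (displacement e t - ξ)]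
  exact sub_eq_zero.1 (norm_le_zero_iff.1 h2)

lemma displacement_mem_strip {e : ℂ} (he : e ∈ paramDisc) (t : HalfPeriod) :
    ((t : ℝ) : ℂ) + displacement e t ∈ strip := add_mem_strip _ (norm_displacement_le he t)

/-- The coefficient produced by the Liouville transformation, in the original variable. -/
noncomputable def liouville (γ₁ γ₂ : ℝ) (e η : ℂ) : ℂ :=
  meanRoot e ^ 2 * (-(γ₁ * Complex.cos η + γ₂ * Complex.cos (2 * η)) / radicand e η
    - e * Complex.cos (2 * η) / radicand e η ^ 2
    + 5 / 4 * e ^ 2 * Complex.sin (2 * η) ^ 2 / radicand e η ^ 3)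

/-- The coefficient produced by the Liouville transformation, in the phase variable. -/
noncomputable def liouvilleCoeff (γ₁ γ₂ : ℝ) (e : ℂ) : Coeff :=
  ContinuousMap.mkD (fun t : HalfPeriod => liouville γ₁ γ₂ e ((t : ℝ) + displacement e t)) 0

lemma continuousOn_liouville (γ₁ γ₂ : ℝ) :
    ContinuousOn (fun p : ℂ × ℂ => liouville γ₁ γ₂ p.1 p.2) (paramDisc ×ˢ strip) := by
  have hM : ContinuousOn (fun p : ℂ × ℂ => meanRoot p.1) (paramDisc ×ˢ strip) :=
    differentiableOn_meanRoot.continuousOn.comp continuousOn_fst fun p hp => hp.1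
  have hA : ContinuousOn (fun p : ℂ × ℂ => radicand p.1 p.2) (paramDisc ×ˢ strip) := by
    unfold radicand; fun_prop
  have hA0 : ∀ p ∈ paramDisc ×ˢ strip, radicand p.1 p.2 ≠ 0 := fun p hp =>
    radicand_ne_zero hp.1 hp.2
  unfold liouville
  refine (hM.pow 2).mul (((ContinuousOn.div ?_ hA hA0).sub (ContinuousOn.div ?_ (hA.pow 2) ?_)).add
    (ContinuousOn.div ?_ (hA.pow 3) ?_))
  · fun_prop
  · fun_prop
  · exact fun p hp => pow_ne_zero _ (hA0 p hp)
  · fun_prop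
  · exact fun p hp => pow_ne_zero _ (hA0 p hp)

lemma liouvilleCoeff_apply (γ₁ γ₂ : ℝ) {e : ℂ} (he : e ∈ paramDisc) (t : HalfPeriod) :
    liouvilleCoeff γ₁ γ₂ e t = liouville γ₁ γ₂ e ((t : ℝ) + displacement e t) := by
  refine ContinuousMap.mkD_apply_of_continuous ?_
  exact (continuousOn_liouville γ₁ γ₂).comp_continuous
    (f := fun t : HalfPeriod => (e, ((t : ℝ) : ℂ) + displacement e t)) (by fun_prop)
    fun t => ⟨he, displacement_mem_strip he t⟩

lemma differentiableOn_liouvilleCoeff (γ₁ γ₂ : ℝ) :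
    DifferentiableOn ℂ (liouvilleCoeff γ₁ γ₂) paramDisc := by
  refine differentiableOn_continuousMap_of_joint Metric.isOpen_ball ?_ fun t => ?_
  · have hgc := continuousOn_eval_family differentiableOn_displacement.continuousOn
    have h : ContinuousOn (fun p : ℂ × HalfPeriod =>
        liouville γ₁ γ₂ p.1 (((p.2 : ℝ) : ℂ) + displacement p.1 p.2)) (paramDisc ×ˢ Set.univ) :=
      (continuousOn_liouville γ₁ γ₂).comp
        (f := fun p : ℂ × HalfPeriod => (p.1, ((p.2 : ℝ) : ℂ) + displacement p.1 p.2))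
        (continuousOn_fst.prodMk (ContinuousOn.add (by fun_prop) hgc))
        fun p hp => ⟨hp.1, displacement_mem_strip hp.1 _⟩
    exact h.congr fun p hp => liouvilleCoeff_apply γ₁ γ₂ hp.1 _
  · have hg : DifferentiableOn ℂ (fun e => ((t : ℝ) : ℂ) + displacement e t) paramDisc :=
      fun e he => (((ContinuousMap.evalCLM ℂ t).differentiableAt).comp_differentiableWithinAt
        e (differentiableOn_displacement e he)).const_add _
    have hA : DifferentiableOn ℂ (fun e => radicand e (((t : ℝ) : ℂ) + displacement e t))
        paramDisc := by unfold radicand; fun_prop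
    have hA0 : ∀ e ∈ paramDisc, radicand e (((t : ℝ) : ℂ) + displacement e t) ≠ 0 := fun e he =>
      radicand_ne_zero he (displacement_mem_strip he t)
    have h : DifferentiableOn ℂ (fun e => liouville γ₁ γ₂ e (((t : ℝ) : ℂ) + displacement e t))
        paramDisc := by
      unfold liouville
      refine (differentiableOn_meanRoot.pow 2).mul (((DifferentiableOn.div ?_ hA hA0).sub
        (DifferentiableOn.div ?_ (hA.pow 2) ?_)).add (DifferentiableOn.div ?_ (hA.pow 3) ?_))
      · fun_prop
      · fun_prop
      · exact fun p hp => pow_ne_zero _ (hA0 p hp)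
      · fun_prop
      · exact fun p hp => pow_ne_zero _ (hA0 p hp)
    exact h.congr fun e he => liouvilleCoeff_apply γ₁ γ₂ he t

/-- Crude bounds suffice: only independence of `e` matters, since it lets one threshold on `n` serve
the whole parameter disc. -/
lemma exists_norm_liouvilleCoeff_le (γ₁ γ₂ : ℝ) :
    ∃ B : ℝ, ∀ e ∈ paramDisc, ‖liouvilleCoeff γ₁ γ₂ e‖ ≤ B := by
  refine ⟨2 * ((|γ₁| * 2 + |γ₂| * 2) * 3 + 1 * 2 * 3 ^ 2 + 2 * 2 ^ 2 * 3 ^ 3), fun e he => ?_⟩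
  refine (ContinuousMap.norm_le _ (by positivity)).2 fun t => ?_
  rw [liouvilleCoeff_apply γ₁ γ₂ he]
  set η := ((t : ℝ) : ℂ) + displacement e t
  have hη : η ∈ strip := displacement_mem_strip he t
  have h1 : ‖Complex.cos η‖ ≤ 2 := by
    refine (norm_cos_sin_le_cosh η).1.trans (le_trans ?_ (cosh_seven_tenths_le.trans (by norm_num)))
    rw [Real.cosh_le_cosh, abs_of_pos (by norm_num : (0 : ℝ) < 7 / 10)]
    have : |η.im| < 35 / 100 := hη
    linarith
  have h2 : ‖Complex.cos (2 * η)‖ ≤ 2 := (norm_cos_sin_two_mul_le hη).1.trans (by norm_num)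
  have h3 : ‖Complex.sin (2 * η)‖ ≤ 2 := (norm_cos_sin_two_mul_le hη).2.trans (by norm_num)
  have he1 : ‖e‖ ≤ 1 := (norm_param_lt he).le.trans (by norm_num)
  have hA : ‖(radicand e η)⁻¹‖ ≤ 3 := by
    rw [norm_inv]
    exact (inv_anti₀ (by norm_num) (le_norm_radicand he hη)).trans (by norm_num)
  have hM : ‖meanRoot e‖ ^ 2 ≤ 2 := by
    have := norm_meanRoot_le he
    nlinarith [norm_nonneg (meanRoot e)]
  rw [liouville, norm_mul, norm_pow]
  refine mul_le_mul hM ?_ (norm_nonneg _) (by norm_num)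
  refine (norm_add_le _ _).trans (add_le_add ((norm_sub_le _ _).trans (add_le_add ?_ ?_)) ?_)
  · rw [div_eq_mul_inv, norm_mul, norm_neg]
    refine mul_le_mul ((norm_add_le _ _).trans ?_) hA (norm_nonneg _) (by positivity)
    rw [norm_mul, norm_mul, Complex.norm_real, Complex.norm_real, Real.norm_eq_abs,
      Real.norm_eq_abs]
    gcongr
  · rw [div_eq_mul_inv, ← inv_pow, norm_mul, norm_mul, norm_pow]
    gcongr
  · rw [div_eq_mul_inv, ← inv_pow, norm_mul, norm_mul, norm_mul, norm_pow, norm_pow, norm_pow]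
    have h5 : ‖(5 / 4 : ℂ)‖ * ‖e‖ ^ 2 ≤ 2 := by
      have : ‖(5 / 4 : ℂ)‖ = 5 / 4 := by simp
      rw [this]
      nlinarith [norm_nonneg e]
    gcongr

lemma zero_mem_paramDisc : (0 : ℂ) ∈ paramDisc := Metric.mem_ball_self (by norm_num)

lemma action_zero_left (η : ℂ) (hη : η ∈ strip) : action 0 η = η := by
  have h1 : rootFamily (0, η) = (1 : ℂ) • 1 := by
    ext x
    rw [rootFamily_apply ⟨zero_mem_paramDisc, hη⟩]
    simp [root, radicand, csqrt]
  have hpi : (Real.pi : ℂ) ≠ 0 := by exact_mod_cast Real.pi_ne_zero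
  rw [action, h1, primitiveL_one]
  simp only [one_smul]
  change η / Real.pi * (Real.pi : ℂ) = η
  exact div_mul_cancel₀ _ hpi

lemma meanRoot_zero : meanRoot 0 = 1 := by
  have hpi : (Real.pi : ℂ) ≠ 0 := by exact_mod_cast Real.pi_ne_zero
  rw [meanRoot, action_zero_left _ (ofReal_mem_strip _), div_self hpi]

/-- At `e = 0` the phase is the identity. This ties the branch at `β = 0` to the unperturbed
eigenvalues. -/
lemma liouvilleCoeff_zero (γ₁ γ₂ : ℝ) : liouvilleCoeff γ₁ γ₂ 0 = -basePot γ₁ γ₂ := by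
  ext t
  have h0 : displacement 0 t = 0 := by
    refine displacement_eq zero_mem_paramDisc t (by norm_num) ?_
    rw [phaseDev, meanRoot_zero, add_zero, action_zero_left _ (ofReal_mem_strip _)]
    simp
  rw [liouvilleCoeff_apply γ₁ γ₂ zero_mem_paramDisc, h0, liouville, meanRoot_zero]
  simp [radicand, basePot]

/-- The real phase. -/
noncomputable def realAction (e x : ℝ) : ℝ := ∫ s in (0 : ℝ)..x, √(1 - e * Real.cos (2 * s))

lemma ofReal_mem_paramDisc {e : ℝ} (he : |e| < 51 / 100) : (e : ℂ) ∈ paramDisc := by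
  rw [mem_ball_zero_iff, Complex.norm_real]; exact he

lemma radicand_real_pos {e : ℝ} (he : |e| < 51 / 100) (x : ℝ) :
    0 < 1 - e * Real.cos (2 * x) := by
  have h1 : |e * Real.cos (2 * x)| ≤ 51 / 100 := by
    rw [abs_mul]
    calc _ ≤ (51 / 100 : ℝ) * 1 := by gcongr; exact Real.abs_cos_le_one _
      _ ≤ _ := by norm_num
  linarith [(abs_le.1 h1).2]

lemma root_ofReal {e : ℝ} (he : |e| < 51 / 100) (x : ℝ) :
    root e x = (√(1 - e * Real.cos (2 * x)) : ℝ) := by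
  rw [root, ← csqrt_ofReal (radicand_real_pos he x).le, radicand]
  push_cast; rfl

lemma continuous_radicand_real (e : ℝ) : Continuous fun s : ℝ => √(1 - e * Real.cos (2 * s)) := by
  fun_prop

lemma hasDerivAt_realAction (e x : ℝ) :
    HasDerivAt (realAction e) (√(1 - e * Real.cos (2 * x))) x :=
  ((continuous_radicand_real e).integral_hasStrictDerivAt 0 x).hasDerivAt

lemma action_ofReal {e : ℝ} (he : |e| < 51 / 100) (x : ℝ) : action e x = realAction e x := by
  have h := intervalIntegral.integral_eq_sub_of_hasDerivAt (a := 0) (b := x)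
    (f := fun y : ℝ => action e y) (f' := fun y : ℝ => root e y)
    (fun y _ => (hasDerivAt_action (ofReal_mem_paramDisc he) (ofReal_mem_strip y)).comp_ofReal)
    (by
      have : (fun y : ℝ => root e y) = fun y : ℝ => ((√(1 - e * Real.cos (2 * y)) : ℝ) : ℂ) :=
        funext (root_ofReal he)
      rw [this]
      exact (Complex.continuous_ofReal.comp (continuous_radicand_real e)).intervalIntegrable _ _)
  simp only [Complex.ofReal_zero, action_zero, sub_zero] at h
  rw [← h, realAction, ← intervalIntegral.integral_ofReal]
  exact intervalIntegral.integral_congr fun y _ => root_ofReal he y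

lemma strictMono_realAction {e : ℝ} (he : |e| < 51 / 100) : StrictMono (realAction e) :=
  strictMono_of_deriv_pos fun x => by
    rw [(hasDerivAt_realAction e x).deriv]
    exact Real.sqrt_pos.2 (radicand_real_pos he x)

/-- The algebraic identity behind the Liouville transformation. -/
lemma liouville_identity {F m e c s V k Y Y' : ℂ} (hF : F ≠ 0) (hm : m ≠ 0)
    (hA : F ^ 4 = 1 - e * c) :
    (-(4 * e * c) / (4 * F ^ 5) + 5 * (2 * e * s) * (2 * e * s / (4 * F ^ 3)) / (4 * F ^ 6)) * Y
      + -(2 * e * s) / (4 * F ^ 5) * (F ^ 2 / m * Y') + (2 * e * s / (4 * F ^ 3)) / m * Y'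
      + F / m * (F ^ 2 / m * (-(k ^ 2 + m ^ 2 * (-V / F ^ 4 - e * c / (F ^ 4) ^ 2
        + 5 / 4 * e ^ 2 * s ^ 2 / (F ^ 4) ^ 3)) * Y))
    = (V + k ^ 2 * e / m ^ 2 * (1 + c) - (k ^ 2 * e / m ^ 2 + k ^ 2 / m ^ 2)) * (Y / F) := by
  have h : k ^ 2 * e / m ^ 2 * (1 + c) - (k ^ 2 * e / m ^ 2 + k ^ 2 / m ^ 2)
      = -(k ^ 2 / m ^ 2 * F ^ 4) := by
    rw [hA]; ring
  rw [add_sub_assoc, h]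
  field_simp
  ring

/-- Pulling back a solution in the phase variable gives an eigenfunction. -/
lemma isEigenvalue_of_charFn_liouville {bc : BoundaryCondition} {γ₁ γ₂ e : ℝ}
    (he : |e| < 51 / 100) {k : ℂ}
    (h : charFn bc (modelCoeff k (liouvilleCoeff γ₁ γ₂ e)) = 0) :
    IsEigenvalue bc γ₁ γ₂ (k ^ 2 * e / meanRoot e ^ 2)
      (k ^ 2 * e / meanRoot e ^ 2 + k ^ 2 / meanRoot e ^ 2) := by
  have hec := ofReal_mem_paramDisc he
  set m : ℝ := realAction e Real.pi / Real.pi with hm_def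
  have hpi := Real.pi_pos
  have hI0 : realAction e 0 = 0 := by simp [realAction]
  have hIpi : 0 < realAction e Real.pi := by rw [← hI0]; exact strictMono_realAction he hpi
  have hm : 0 < m := div_pos hIpi hpi
  have hM : meanRoot e = m := by rw [meanRoot, action_ofReal he, hm_def]; push_cast; rfl
  have hmC : (m : ℂ) ≠ 0 := by exact_mod_cast hm.ne'
  let φ : ℝ → ℝ := fun x => realAction e x / m
  have hφ0 : φ 0 = 0 := by simp [φ, hI0]
  have hφpi : φ Real.pi = Real.pi := by
    simp only [φ, hm_def]; field_simp
  have hφmem : ∀ x ∈ Set.Icc 0 Real.pi, φ x ∈ Set.Icc 0 Real.pi := by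
    intro x hx
    have hmono : Monotone φ := fun a b hab =>
      div_le_div_of_nonneg_right ((strictMono_realAction he).monotone hab) hm.le
    exact ⟨hφ0 ▸ hmono hx.1, (hmono hx.2).trans_eq hφpi⟩
  set q := modelCoeff k (liouvilleCoeff γ₁ γ₂ e) with hq
  -- By uniqueness of the displacement, the inverse phase sends `φ x` back to the real point `x`.
  have hqφ : ∀ x ∈ Set.Icc 0 Real.pi,
      ext q (φ x) = -(k ^ 2 + liouville γ₁ γ₂ e x) := by
    intro x hx
    have hd : displacement e ⟨φ x, hφmem x hx⟩ = x - φ x := by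
      have hdev : phaseDev e x = -((x : ℂ) - φ x) := by
        rw [phaseDev, action_ofReal he, hM]
        simp only [φ]; push_cast; ring
      refine displacement_eq hec _ ?_ ?_
      · rw [← norm_neg, ← hdev]
        have := norm_phaseDev_le hec hx (ξ := 0) (by norm_num)
        rwa [add_zero] at this
      · rw [← hdev]; congr 1; simp
    rw [ext_apply q (hφmem x hx), hq, modelCoeff, ContinuousMap.neg_apply, ContinuousMap.add_apply,
      liouvilleCoeff_apply γ₁ γ₂ hec, hd]
    simp
  -- The Liouville amplitude `A^{1/4}`; its square is `m φ'`.
  let f : ℝ → ℝ := fun x => √(√(1 - e * Real.cos (2 * x)))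
  have hf0 : ∀ x, 0 < f x := fun x => Real.sqrt_pos.2 (Real.sqrt_pos.2 (radicand_real_pos he x))
  have hf2 : ∀ x, f x ^ 2 = √(1 - e * Real.cos (2 * x)) := fun x =>
    Real.sq_sqrt (Real.sqrt_nonneg _)
  have hf4 : ∀ x, f x ^ 4 = 1 - e * Real.cos (2 * x) := fun x => by
    rw [show f x ^ 4 = (f x ^ 2) ^ 2 by ring, hf2, Real.sq_sqrt (radicand_real_pos he x).le]
  have hfC : ∀ x, (f x : ℂ) ≠ 0 := fun x => by exact_mod_cast (hf0 x).ne'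
  have hfd : ∀ x, HasDerivAt f (2 * e * Real.sin (2 * x) / (4 * f x ^ 3)) x := by
    intro x
    have h1 : HasDerivAt (fun x => 2 * x) 2 x := by simpa using (hasDerivAt_id x).const_mul 2
    have h2 : HasDerivAt (fun x => 1 - e * Real.cos (2 * x)) (2 * e * Real.sin (2 * x)) x := by
      refine ((h1.cos.const_mul e).const_sub 1).congr_deriv ?_
      ring
    have h3 := (h2.sqrt (radicand_real_pos he x).ne').sqrt
      (Real.sqrt_pos.2 (radicand_real_pos he x)).ne'
    refine h3.congr_deriv ?_
    change _ / (2 * √(1 - e * Real.cos (2 * x))) / (2 * f x) = _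
    rw [← hf2]
    have := (hf0 x).ne'
    field_simp
    ring
  have hFd : ∀ x : ℝ, HasDerivAt (fun x => (f x : ℂ))
      (2 * e * Complex.sin (2 * x) / (4 * (f x : ℂ) ^ 3)) x := fun x => by
    refine (hfd x).ofReal_comp.congr_deriv ?_
    push_cast; rfl
  have hφd : ∀ x, HasDerivAt φ (f x ^ 2 / m) x := fun x => by
    rw [hf2]; exact (hasDerivAt_realAction e x).div_const m
  have hYd : ∀ x ∈ Set.Icc 0 Real.pi, HasDerivAt (fun x => bsol bc q (φ x))
      ((f x : ℂ) ^ 2 / m * dbsol bc q (φ x)) x := fun x hx => by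
    refine ((hasDerivAt_sol _ _ q (hφmem x hx)).scomp x (hφd x)).congr_deriv ?_
    rw [Complex.real_smul]; push_cast; rfl
  have hYd' : ∀ x ∈ Set.Icc 0 Real.pi, HasDerivAt (fun x => dbsol bc q (φ x))
      ((f x : ℂ) ^ 2 / m * (-(k ^ 2 + liouville γ₁ γ₂ e x) * bsol bc q (φ x))) x := fun x hx => by
    refine ((hasDerivAt_dsol _ _ q (hφmem x hx)).scomp x (hφd x)).congr_deriv ?_
    rw [Complex.real_smul, hqφ x hx]; push_cast; rfl
  -- The eigenfunction is `A^{-1/4} · Y ∘ φ`. In its derivative the contribution of `f'` carries the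
  -- factor `sin 2x`, which vanishes at both ends, so the Neumann condition is transported too.
  refine ⟨fun x => bsol bc q (φ x) / f x, fun x => -(2 * e * Complex.sin (2 * x)) /
    (4 * (f x : ℂ) ^ 5) * bsol bc q (φ x) + f x / m * dbsol bc q (φ x), ?_, ?_, ?_, ?_⟩
  · intro x hx
    refine ((hYd x hx).div (hFd x) (hfC x)).hasDerivWithinAt.congr_deriv ?_
    have := hfC x
    field_simp
    ring
  · intro x hx
    have hs : HasDerivAt (fun x : ℝ => -(2 * e * Complex.sin (2 * x)))
        (-(4 * e * Complex.cos (2 * x))) x := by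
      refine ((hasDerivAt_sin_two_mul (x : ℂ)).const_mul (2 * (e : ℂ))).neg.comp_ofReal.congr_deriv
        ?_
      ring
    have h5 : HasDerivAt (fun x => 4 * (f x : ℂ) ^ 5)
        (4 * (5 * (f x : ℂ) ^ 4 * (2 * e * Complex.sin (2 * x) / (4 * (f x : ℂ) ^ 3)))) x := by
      refine (((hFd x).pow 5).const_mul 4).congr_deriv ?_
      norm_num
    have hne : 4 * (f x : ℂ) ^ 5 ≠ 0 := mul_ne_zero (by norm_num) (pow_ne_zero _ (hfC x))
    have hfull := ((hs.div h5 hne).mul (hYd x hx)).add (((hFd x).div_const (m : ℂ)).mul (hYd' x hx))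
    refine (hfull.congr_deriv ?_).hasDerivWithinAt
    have hA : (f x : ℂ) ^ 4 = 1 - e * Complex.cos (2 * x) := by
      have := congrArg (fun r : ℝ => (r : ℂ)) (hf4 x)
      push_cast at this
      exact this
    have hid := liouville_identity (F := f x) (m := m) (e := e) (c := Complex.cos (2 * x))
      (s := Complex.sin (2 * x)) (V := γ₁ * Complex.cos x + γ₂ * Complex.cos (2 * x)) (k := k)
      (Y := bsol bc q (φ x)) (Y' := dbsol bc q (φ x)) (hfC x) hmC hA
    have hpot : potential γ₁ γ₂ (k ^ 2 * e / meanRoot e ^ 2) x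
        = γ₁ * Complex.cos x + γ₂ * Complex.cos (2 * x)
          + k ^ 2 * e / m ^ 2 * (1 + Complex.cos (2 * x)) := by
      rw [potential, hM]; push_cast; rfl
    rw [hpot, hM, ← hid, liouville, hM, radicand, ← hA]
    simp only [Pi.div_apply]
    have := hfC x
    field_simp
    ring
  · cases bc with
    | dirichlet =>
      refine ⟨?_, ?_⟩
      · simp only [hφ0, sol_zero]; exact zero_div _
      · simp only [hφpi]
        have : bsol .dirichlet q Real.pi = 0 := h
        rw [this, zero_div]
    | neumann =>
      refine ⟨?_, ?_⟩
      · simp only [hφ0, dsol_zero, Complex.ofReal_zero, mul_zero, Complex.sin_zero, neg_zero,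
          zero_div, zero_mul, zero_add]
        exact mul_zero _
      · simp only [hφpi, sin_two_mul_pi, mul_zero, neg_zero, zero_div, zero_mul, zero_add]
        have : dbsol .neumann q Real.pi = 0 := h
        rw [this, mul_zero]
  · obtain ⟨t, ht, hne⟩ := exists_bsol_ne_zero bc q
    have hcont : ContinuousOn φ (Set.Icc 0 Real.pi) := fun x _ =>
      (hφd x).continuousAt.continuousWithinAt
    obtain ⟨x, hx, hxt⟩ := intermediate_value_Icc hpi.le hcont
      (show t ∈ Set.Icc (φ 0) (φ Real.pi) by rw [hφ0, hφpi]; exact ht)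
    exact ⟨x, hx, div_ne_zero (by rw [hxt]; exact hne) (hfC x)⟩

/-! ### The perturbation series -/

/-- The characteristic function of the perturbed problem. -/
noncomputable def hillChar (bc : BoundaryCondition) (γ₁ γ₂ : ℝ) (p : ℂ × ℂ) : ℂ :=
  charFn bc (hillCoeff γ₁ γ₂ p.1 p.2)

lemma contDiff_hillChar (bc : BoundaryCondition) (γ₁ γ₂ : ℝ) :
    ContDiff ℂ 1 (hillChar bc γ₁ γ₂) := by
  refine (contDiff_charFn bc).comp ?_
  unfold hillCoeff
  exact (contDiff_const.add (contDiff_fst.smul contDiff_const)).sub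
    (contDiff_snd.smul contDiff_const)

lemma isEigenvalue_iff_hillChar (bc : BoundaryCondition) (γ₁ γ₂ : ℝ) (β lam : ℂ) :
    IsEigenvalue bc γ₁ γ₂ β lam ↔ hillChar bc γ₁ γ₂ (β, lam) = 0 := isEigenvalue_iff bc γ₁ γ₂ β lam

/-- The local branch of eigenvalues through a simple eigenvalue. -/
lemma exists_local_branch (bc : BoundaryCondition) (γ₁ γ₂ : ℝ) {lam : ℝ}
    (hlam : IsEigenvalue bc γ₁ γ₂ 0 lam) :
    ∃ δ > 0, ∃ r > 0, ∃ Λ : ℂ → ℂ, DifferentiableOn ℂ Λ (Metric.ball 0 δ) ∧ Λ 0 = lam ∧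
      (∀ β ∈ Metric.ball (0 : ℂ) δ, IsEigenvalue bc γ₁ γ₂ β (Λ β)) ∧
      ∀ β ∈ Metric.ball (0 : ℂ) δ, ∀ x ∈ Metric.closedBall (lam : ℂ) r,
        IsEigenvalue bc γ₁ γ₂ β x → x = Λ β := by
  set D := hillChar bc γ₁ γ₂ with hD_def
  have hD := contDiff_hillChar bc γ₁ γ₂
  have hstrict := hD.contDiffAt.hasStrictFDerivAt (x := ((0 : ℂ), (lam : ℂ))) one_ne_zero
  set D' := fderiv ℂ D (0, (lam : ℂ)) with hD'
  have h0 : D (0, (lam : ℂ)) = 0 := (isEigenvalue_iff_hillChar bc γ₁ γ₂ 0 lam).1 hlam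
  -- Simplicity of the real eigenvalue: the derivative in the spectral variable does not vanish.
  have hd : D' (0, 1) ≠ 0 := by
    have hz : charFn bc (shift (basePot γ₁ γ₂) lam) = 0 := by
      rw [← hillCoeff_zero]; exact h0
    obtain ⟨d, hd0, hd1⟩ := (isRealCoeff_basePot γ₁ γ₂).exists_hasDerivAt_charFn bc hz
    have h1 : HasDerivAt (fun mu : ℂ => D (0, mu)) (D' (0, 1)) lam := by
      have h2 : HasDerivAt (fun mu : ℂ => ((0 : ℂ), mu)) ((0 : ℂ), (1 : ℂ)) (lam : ℂ) :=
        (hasDerivAt_const _ _).prodMk (hasDerivAt_id _)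
      exact hstrict.hasFDerivAt.comp_hasDerivAt (lam : ℂ) h2
    have h3 : (fun mu : ℂ => charFn bc (shift (basePot γ₁ γ₂) mu)) = fun mu : ℂ => D (0, mu) := by
      funext mu
      rw [hD_def, hillChar, hillCoeff_zero]
    rw [h3] at hd1
    rwa [h1.unique hd1]
  set d := D' (0, 1)
  have hdn : 0 < ‖d‖ := norm_pos_iff.2 hd
  have hlin : ∀ z : ℂ, D' (0, z) = d * z := by
    intro z
    have : ((0 : ℂ), z) = z • ((0 : ℂ), (1 : ℂ)) := by simp
    rw [this, map_smul, smul_eq_mul, mul_comm]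
  have hev := hstrict.isLittleO.def (show 0 < ‖d‖ / 2 by positivity)
  obtain ⟨ε, hε, hball⟩ := Metric.eventually_nhds_iff_ball.1 hev
  set r := ε / 2 with hr
  have hr0 : 0 < r := by positivity
  have hcont : Continuous fun β : ℂ => D (β, (lam : ℂ)) :=
    hD.continuous.comp (by fun_prop)
  have hsmall : ∀ᶠ β in 𝓝 (0 : ℂ), ‖D (β, (lam : ℂ))‖ < ‖d‖ * r / 2 := by
    have := (hcont.norm.tendsto 0)
    simp only [h0, norm_zero] at this
    exact this.eventually_lt_const (by positivity)
  obtain ⟨δ₁, hδ₁, hball₁⟩ := Metric.eventually_nhds_iff_ball.1 hsmall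
  set δ := min δ₁ ε with hδ_def
  have hδ : 0 < δ := lt_min hδ₁ hε
  -- Newton's iteration with the derivative frozen at the base point; strict differentiability makes
  -- it a contraction uniformly for small `β`.
  let T : ℂ → ℂ → ℂ := fun β x => x - D (β, x) / d
  have hlip : ∀ β ∈ Metric.ball (0 : ℂ) δ, ∀ x ∈ Metric.closedBall (lam : ℂ) r,
      ∀ y ∈ Metric.closedBall (lam : ℂ) r, dist (T β x) (T β y) ≤ 1 / 2 * dist x y := by
    intro β hβ x hx y hy
    have hmem : ∀ w ∈ Metric.closedBall (lam : ℂ) r, (β, w) ∈ Metric.ball ((0 : ℂ), (lam : ℂ)) ε := by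
      intro w hw
      rw [Metric.mem_ball, Prod.dist_eq, max_lt_iff]
      exact ⟨(Metric.mem_ball.1 hβ).trans_le (min_le_right _ _),
        (Metric.mem_closedBall.1 hw).trans_lt (by rw [hr]; linarith)⟩
    have h := hball ((β, x), (β, y)) (by
      rw [Metric.mem_ball, Prod.dist_eq, max_lt_iff]
      exact ⟨hmem x hx, hmem y hy⟩)
    have h1 : ((β, x) : ℂ × ℂ) - (β, y) = (0, x - y) := by simp
    simp only [h1, hlin] at h
    have h2 : ‖((0 : ℂ), x - y)‖ = ‖x - y‖ := by simp [Prod.norm_def]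
    rw [h2] at h
    have h3 : T β x - T β y = -(D (β, x) - D (β, y) - d * (x - y)) / d := by
      simp only [T]; field_simp; ring
    rw [dist_eq_norm, dist_eq_norm, h3, norm_div, norm_neg, div_le_iff₀ hdn]
    linarith
  have hmaps : ∀ β ∈ Metric.ball (0 : ℂ) δ, ∀ x ∈ Metric.closedBall (lam : ℂ) r,
      T β x ∈ Metric.closedBall (lam : ℂ) r := by
    intro β hβ x hx
    have h1 := hlip β hβ x hx lam (Metric.mem_closedBall_self hr0.le)
    have h2 : dist (T β lam) lam ≤ r / 2 := by
      have h3 := hball₁ β (Metric.ball_subset_ball (min_le_left _ _) hβ)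
      rw [dist_eq_norm]
      simp only [T]
      rw [sub_sub_cancel_left, norm_neg, norm_div, div_le_iff₀ hdn]
      linarith
    rw [Metric.mem_closedBall] at hx ⊢
    linarith [dist_triangle (T β x) (T β lam) lam]
  have hfix : ∀ β x, T β x = x ↔ IsEigenvalue bc γ₁ γ₂ β x := by
    intro β x
    rw [isEigenvalue_iff_hillChar, ← hD_def]
    simp only [T]
    rw [sub_eq_self, div_eq_zero_iff, or_iff_left hd]
  obtain ⟨Λ, hΛ1, hΛ2, hΛ3⟩ := exists_holomorphic_fixedPoint Metric.isOpen_ball hr0.le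
    (by norm_num : (1 / 2 : ℝ) < 1) hmaps hlip (fun g hg _ => by
      have h1 : DifferentiableOn ℂ (fun β => D (β, g β)) (Metric.ball 0 δ) :=
        (hD.differentiable one_ne_zero).comp_differentiableOn
          (differentiableOn_id.prodMk hg)
      exact hg.sub (h1.div_const d))
  have huniq : ∀ β ∈ Metric.ball (0 : ℂ) δ, ∀ x ∈ Metric.closedBall (lam : ℂ) r,
        IsEigenvalue bc γ₁ γ₂ β x → x = Λ β := fun β hβ x hx hex =>
    eq_of_fixedPoint (by norm_num : (1 / 2 : ℝ) < 1) (hlip β hβ) hx (hΛ2 hβ) ((hfix β x).2 hex)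
      (hΛ3 β hβ)
  refine ⟨δ, hδ, r, hr0, Λ, hΛ1, ?_, fun β hβ => (hfix _ _).1 (hΛ3 β hβ), huniq⟩
  exact (huniq 0 (Metric.mem_ball_self hδ) lam (Metric.mem_closedBall_self hr0.le) hlam).symm

/-- Existence and uniqueness of the perturbation series. -/
lemma existsUnique_perturbationSeries (bc : BoundaryCondition) (γ₁ γ₂ : ℝ) {n : ℕ}
    (hn : bc.firstIndex ≤ n) :
    ∃! p : FormalMultilinearSeries ℂ ℂ ℂ, IsPerturbationSeries bc γ₁ γ₂ n p := by
  have hV := isRealCoeff_basePot γ₁ γ₂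
  obtain ⟨lam, hlam⟩ := hV.exists_rot_shift_eq bc hn
  have hnth := (isNthEigenvalue_iff bc γ₁ γ₂).2 ⟨hn, hlam⟩
  obtain ⟨δ, hδ, r, hr, Λ, h1, h2, h3, h4⟩ := exists_local_branch bc γ₁ γ₂ hnth.1
  have hb : Metric.ball (0 : ℂ) δ ∈ 𝓝 0 := Metric.ball_mem_nhds 0 hδ
  obtain ⟨p, hp⟩ := h1.analyticAt hb
  refine ⟨p, ⟨Λ, hp, ⟨lam, hnth, h2⟩, by filter_upwards [hb] with β hβ using h3 β hβ⟩, ?_⟩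
  rintro p' ⟨Λ', hp', ⟨lam', hnth', h2'⟩, h3'⟩
  have hlam' : lam' = lam := by
    refine (hV.strictMono_rot bc).injective ?_
    rw [hlam, ((isNthEigenvalue_iff bc γ₁ γ₂).1 hnth').2]
  refine hp'.eq_formalMultilinearSeries_of_eventually hp ?_
  -- A competing branch is continuous with the same value at `0`, so it enters the disc where the
  -- eigenvalue is unique; equal germs have equal series.
  have hc : ∀ᶠ β in 𝓝 (0 : ℂ), Λ' β ∈ Metric.closedBall (lam : ℂ) r := by
    have := hp'.continuousAt.tendsto
    rw [h2', hlam'] at this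
    exact this.eventually (Metric.closedBall_mem_nhds _ hr)
  filter_upwards [hb, hc, h3'] with β hβ hβ' hβ''
  exact h4 β hβ _ hβ' hβ''

/-- A holomorphic branch on a disc bounds the convergence radius from below. -/
lemma ofReal_le_convergenceRadius (bc : BoundaryCondition) (γ₁ γ₂ : ℝ) {n : ℕ} {lam ρ : ℝ}
    (hnth : IsNthEigenvalue bc γ₁ γ₂ n lam) {Λ : ℂ → ℂ}
    (hΛ : DifferentiableOn ℂ Λ (Metric.ball 0 ρ)) (h0 : Λ 0 = lam)
    (hev : ∀ᶠ β in 𝓝 (0 : ℂ), IsEigenvalue bc γ₁ γ₂ β (Λ β)) :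
    ENNReal.ofReal ρ ≤ convergenceRadius bc γ₁ γ₂ n := by
  refine ENNReal.le_of_forall_nnreal_lt fun r hr => ?_
  rcases eq_or_ne r 0 with rfl | hr0
  · simp
  have hrρ : (r : ℝ) < ρ := by
    rw [ENNReal.ofReal, ENNReal.coe_lt_coe] at hr
    exact Real.lt_toNNReal_iff_coe_lt.1 hr
  have hps := (hΛ.mono (Metric.closedBall_subset_ball hrρ)).hasFPowerSeriesOnBall
    (pos_iff_ne_zero.2 hr0)
  refine hps.r_le.trans ?_
  exact le_iSup₂_of_le (cauchyPowerSeries Λ 0 r) ⟨Λ, hps.hasFPowerSeriesAt, ⟨lam, hnth, h0⟩, hev⟩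
    le_rfl

/-! ### The quantization condition in the phase variable -/

lemma norm_cos_sub_one_le {w : ℂ} (hw : ‖w‖ ≤ 1) : ‖Complex.cos w - 1‖ ≤ ‖w‖ ^ 2 := by
  have h1 := Complex.norm_exp_sub_one_sub_id_le (x := w * Complex.I) (by simpa using hw)
  have h2 := Complex.norm_exp_sub_one_sub_id_le (x := -w * Complex.I) (by simpa using hw)
  rw [norm_mul, Complex.norm_I, mul_one] at h1 h2
  rw [norm_neg] at h2
  have h3 : Complex.cos w - 1 = ((Complex.exp (w * Complex.I) - 1 - w * Complex.I)
      + (Complex.exp (-w * Complex.I) - 1 - -w * Complex.I)) / 2 := by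
    rw [Complex.cos]; ring
  rw [h3, norm_div, Complex.norm_two]
  have := norm_add_le (Complex.exp (w * Complex.I) - 1 - w * Complex.I)
    (Complex.exp (-w * Complex.I) - 1 - -w * Complex.I)
  linarith

/-- The derivative is `1 - cos (πt)`, bounded by `|πt|²`, and `(π/4)² < 0.786² < 0.618`. This is the
leading part of the iteration that locates the wave number. -/
lemma dist_sub_sin_le {x y : ℂ} (hx : x ∈ Metric.closedBall (0 : ℂ) (1 / 4))
    (hy : y ∈ Metric.closedBall (0 : ℂ) (1 / 4)) :
    ‖(x - Complex.sin (Real.pi * x) / Real.pi) - (y - Complex.sin (Real.pi * y) / Real.pi)‖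
      ≤ 618 / 1000 * ‖x - y‖ := by
  have hpi : (Real.pi : ℂ) ≠ 0 := by exact_mod_cast Real.pi_ne_zero
  have hd : ∀ t : ℂ, HasDerivAt (fun t : ℂ => t - Complex.sin (Real.pi * t) / Real.pi)
      (1 - Complex.cos (Real.pi * t)) t := by
    intro t
    have h1 : HasDerivAt (fun t : ℂ => (Real.pi : ℂ) * t) Real.pi t := by
      simpa using (hasDerivAt_id t).const_mul (Real.pi : ℂ)
    refine ((hasDerivAt_id t).sub (h1.csin.div_const (Real.pi : ℂ))).congr_deriv ?_
    rw [mul_div_cancel_right₀ _ hpi]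
  refine Convex.norm_image_sub_le_of_norm_hasDerivWithin_le (𝕜 := ℂ)
    (s := Metric.closedBall (0 : ℂ) (1 / 4))
    (f := fun t : ℂ => t - Complex.sin (Real.pi * t) / Real.pi)
    (fun t _ => (hd t).hasDerivWithinAt) (fun t ht => ?_) (convex_closedBall _ _) hy hx
  rw [mem_closedBall_zero_iff] at ht
  have hn : ‖(Real.pi : ℂ) * t‖ ≤ 786 / 1000 := by
    rw [norm_mul, Complex.norm_real, Real.norm_of_nonneg Real.pi_pos.le]
    have := Real.pi_lt_d4
    nlinarith [norm_nonneg t, Real.pi_pos]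
  rw [norm_sub_rev]
  refine (norm_cos_sub_one_le (hn.trans (by norm_num))).trans ?_
  nlinarith [norm_nonneg ((Real.pi : ℂ) * t)]

lemma differentiableOn_normChar (bc : BoundaryCondition) {k : ℂ → ℂ} {R : ℂ → Coeff} {U : Set ℂ}
    (hk : DifferentiableOn ℂ k U) (hR : DifferentiableOn ℂ R U) (hk0 : ∀ u ∈ U, k u ≠ 0) :
    DifferentiableOn ℂ (fun u => normChar bc (k u) (R u)) U := by
  have h1 : DifferentiableOn ℂ (fun u => modelCoeff (k u) (R u)) U :=
    (((hk.pow 2).smul (differentiableOn_const (1 : Coeff))).add hR).neg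
  cases bc with
  | dirichlet => exact hk.mul ((differentiable_charFn .dirichlet).comp_differentiableOn h1)
  | neumann => exact ((differentiable_charFn .neumann).comp_differentiableOn h1).neg.div hk hk0

lemma sin_natCast_add_mul_pi (n : ℕ) (t : ℂ) :
    (-1 : ℂ) ^ n * Complex.sin ((n + t) * Real.pi) = Complex.sin (Real.pi * t) := by
  have : ((n : ℂ) + t) * Real.pi = Real.pi * t + n * Real.pi := by ring
  rw [this, Complex.sin_antiperiodic.add_nat_mul_eq, ← mul_assoc]
  rw [← mul_pow]
  norm_num

lemma norm_natCast_add_ge (n : ℕ) (t : ℂ) : (n : ℝ) - ‖t‖ ≤ ‖(n : ℂ) + t‖ := by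
  have := norm_sub_norm_le (n : ℂ) (-t)
  rwa [norm_neg, sub_neg_eq_add, Complex.norm_natCast] at this

/-- For large `n` the quantization condition determines the wave number as a holomorphic function
of `e`. -/
lemma eventually_exists_phaseShift (bc : BoundaryCondition) (γ₁ γ₂ : ℝ) :
    ∀ᶠ n : ℕ in atTop, ∃ τ : ℂ → ℂ, DifferentiableOn ℂ τ paramDisc ∧
      (∀ e ∈ paramDisc, ‖τ e‖ ≤ 1 / 4) ∧
      (∀ e ∈ paramDisc, normChar bc (n + τ e) (liouvilleCoeff γ₁ γ₂ e) = 0) ∧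
      ∀ e ∈ paramDisc, ∀ t : ℂ, ‖t‖ ≤ 1 / 4 →
        normChar bc (n + t) (liouvilleCoeff γ₁ γ₂ e) = 0 → t = τ e := by
  obtain ⟨B, hB⟩ := exists_norm_liouvilleCoeff_le γ₁ γ₂
  have hB0 : 0 ≤ B := (norm_nonneg _).trans (hB 0 zero_mem_paramDisc)
  set C := 2 * Real.pi * B * Real.exp Real.pi ^ 2 with hC
  have hpi := Real.pi_pos
  have hC0 : 0 ≤ C := by positivity
  have hexp : 1 ≤ Real.exp Real.pi := Real.one_le_exp hpi.le
  filter_upwards [eventually_ge_atTop 1, eventually_ge_atTop ⌈100 * C + 1⌉₊] with n hn1 hn2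
  have hn2' : 100 * C + 1 ≤ n := Nat.ceil_le.1 hn2
  have hn1' : (1 : ℝ) ≤ n := by exact_mod_cast hn1
  have hkn : ∀ t : ℂ, ‖t‖ ≤ 1 / 2 → 100 * C ≤ ‖(n : ℂ) + t‖ ∧ 0 < ‖(n : ℂ) + t‖ := fun t ht => by
    have := norm_natCast_add_ge n t
    constructor <;> linarith
  have hk0 : ∀ t : ℂ, ‖t‖ ≤ 1 / 2 → (n : ℂ) + t ≠ 0 := fun t ht => norm_pos_iff.1 (hkn t ht).2
  let err : ℂ → ℂ → ℂ := fun e t =>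
    normChar bc (n + t) (liouvilleCoeff γ₁ γ₂ e) - Complex.sin ((n + t) * Real.pi)
  -- The error is at most `C / ‖n + t‖`, and `‖n + t‖ ≥ 100 C`. The disc is twice the one in use, to
  -- leave room for a Cauchy estimate.
  have herr : ∀ e ∈ paramDisc, ∀ t : ℂ, ‖t‖ ≤ 1 / 2 → ‖err e t‖ ≤ 1 / 100 := by
    intro e he t ht
    obtain ⟨h1, h2⟩ := hkn t ht
    have him : |((n : ℂ) + t).im| ≤ 1 := by
      rw [Complex.add_im, Complex.natCast_im, zero_add]
      exact (Complex.abs_im_le_norm t).trans (by linarith)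
    have h3 : 2 * Real.pi * B * Real.exp Real.pi ≤ C := by
      rw [hC, sq, ← mul_assoc]
      exact le_mul_of_one_le_right (by positivity) hexp
    refine (normChar_sub_sin bc (hB e he) him (hk0 t ht) (by linarith)).trans ?_
    rw [div_le_iff₀ h2]
    linarith
  have hfac : ‖(-1 : ℂ) ^ n / Real.pi‖ ≤ 1 := by
    rw [norm_div, norm_pow, norm_neg, norm_one, one_pow, Complex.norm_real,
      Real.norm_of_nonneg hpi.le, div_le_one hpi]
    linarith [Real.pi_gt_three]
  -- A Newton step with frozen derivative: `sin ((n + t) π)` has derivative `(-1)ⁿ π` at `t = 0`.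
  let T : ℂ → ℂ → ℂ := fun e t =>
    t - (-1) ^ n / Real.pi * normChar bc (n + t) (liouvilleCoeff γ₁ γ₂ e)
  have hT : ∀ e t, T e t
      = (t - Complex.sin (Real.pi * t) / Real.pi) - (-1) ^ n / Real.pi * err e t := by
    intro e t
    simp only [T, err]
    rw [← sin_natCast_add_mul_pi n t]
    ring
  have hfix : ∀ e t, T e t = t ↔ normChar bc (n + t) (liouvilleCoeff γ₁ γ₂ e) = 0 := by
    intro e t
    have hne : (-1 : ℂ) ^ n / Real.pi ≠ 0 :=
      div_ne_zero (pow_ne_zero _ (by norm_num)) (by exact_mod_cast hpi.ne')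
    simp only [T]
    rw [sub_eq_self, mul_eq_zero, or_iff_right hne]
  -- The constant is `0.618` from the sine plus `2 · 0.01 / (1/4) = 0.08` from the error.
  have hlip : ∀ e ∈ paramDisc, ∀ x ∈ Metric.closedBall (0 : ℂ) (1 / 4),
      ∀ y ∈ Metric.closedBall (0 : ℂ) (1 / 4), dist (T e x) (T e y) ≤ 7 / 10 * dist x y := by
    intro e he x hx y hy
    have hd : DifferentiableOn ℂ (err e) (Metric.ball 0 (1 / 2)) := by
      refine (differentiableOn_normChar bc (by fun_prop) (differentiableOn_const _) fun t ht =>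
        hk0 t (mem_ball_zero_iff.1 ht).le).sub ?_
      fun_prop
    have h1 := lipschitz_of_bounded (by norm_num : (1 / 4 : ℝ) < 1 / 2) hd
      (fun t ht => herr e he t (mem_ball_zero_iff.1 ht).le) hx hy
    have h2 := dist_sub_sin_le hx hy
    rw [dist_eq_norm, dist_eq_norm] at h1 ⊢
    rw [hT, hT]
    have h3 : ‖(-1 : ℂ) ^ n / Real.pi * (err e x - err e y)‖ ≤ ‖err e x - err e y‖ := by
      rw [norm_mul]; exact mul_le_of_le_one_left (norm_nonneg _) hfac
    rw [sub_sub_sub_comm, ← mul_sub]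
    refine (norm_sub_le _ _).trans ?_
    norm_num at h1 h2 h3 ⊢
    linarith [norm_nonneg (x - y)]
  have hmaps : ∀ e ∈ paramDisc, ∀ x ∈ Metric.closedBall (0 : ℂ) (1 / 4),
      T e x ∈ Metric.closedBall (0 : ℂ) (1 / 4) := by
    intro e he x hx
    have h1 := dist_sub_sin_le hx (Metric.mem_closedBall_self (by norm_num))
    simp only [mul_zero, Complex.sin_zero, zero_div, sub_zero] at h1
    rw [mem_closedBall_zero_iff] at hx ⊢
    rw [hT]
    have h2 := herr e he x (hx.trans (by norm_num))
    have h3 : ‖(-1 : ℂ) ^ n / Real.pi * err e x‖ ≤ ‖err e x‖ := by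
      rw [norm_mul]; exact mul_le_of_le_one_left (norm_nonneg _) hfac
    refine (norm_sub_le _ _).trans ?_
    linarith
  obtain ⟨τ, h1, h2, h3⟩ := exists_holomorphic_fixedPoint Metric.isOpen_ball
    (by norm_num : (0 : ℝ) ≤ 1 / 4) (by norm_num : (7 / 10 : ℝ) < 1) hmaps hlip
    (fun g hg hgm => hg.sub ((differentiableOn_normChar bc (hg.const_add _)
      (differentiableOn_liouvilleCoeff γ₁ γ₂) fun e he =>
        hk0 _ ((mem_closedBall_zero_iff.1 (hgm he)).trans (by norm_num))).const_mul _))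
  refine ⟨τ, h1, fun e he => mem_closedBall_zero_iff.1 (h2 he), fun e he => (hfix _ _).1 (h3 e he),
    fun e he t ht h0 => ?_⟩
  exact eq_of_fixedPoint (by norm_num : (7 / 10 : ℝ) < 1) (hlip e he)
    (mem_closedBall_zero_iff.2 ht) (h2 he) ((hfix e t).2 h0) (h3 e he)

/-! ### Solving for the spectral parameter -/

/-- Difference of squares; the sum of the two roots has real part at least `2 · 0.7`. -/
lemma norm_root_sub_root_le {e e' : ℂ} (he : e ∈ paramDisc) (he' : e' ∈ paramDisc) (x : ℝ) :
    ‖root e x - root e' x‖ ≤ 5 / 7 * ‖e - e'‖ := by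
  have h1 : (root e x - root e' x) * (root e x + root e' x)
      = -((e - e') * Complex.cos (2 * x)) := by
    have h2 : root e x ^ 2 = radicand e x := csqrt_sq _
    have h3 : root e' x ^ 2 = radicand e' x := csqrt_sq _
    rw [radicand] at h2 h3
    linear_combination h2 - h3
  have h4 : 7 / 5 ≤ ‖root e x + root e' x‖ := by
    refine le_trans ?_ (Complex.re_le_norm _)
    rw [Complex.add_re]
    linarith [le_root_re he x, le_root_re he' x]
  have h5 : ‖Complex.cos (2 * (x : ℂ))‖ ≤ 1 := by
    have : Complex.cos (2 * (x : ℂ)) = (Real.cos (2 * x) : ℝ) := by push_cast; rfl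
    rw [this, Complex.norm_real]
    exact Real.abs_cos_le_one _
  have h6 := congrArg norm h1
  rw [norm_mul, norm_neg, norm_mul] at h6
  nlinarith [norm_nonneg (root e x - root e' x), norm_nonneg (e - e')]

lemma norm_meanRoot_sub_le {e e' : ℂ} (he : e ∈ paramDisc) (he' : e' ∈ paramDisc) :
    ‖meanRoot e - meanRoot e'‖ ≤ 5 / 7 * ‖e - e'‖ := by
  have hpi : (Real.pi : ℂ) ≠ 0 := by exact_mod_cast Real.pi_ne_zero
  have hM : ∀ e, meanRoot e = primitiveL (rootFamily (e, (Real.pi : ℂ))) piPt / Real.pi := fun e => by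
    rw [meanRoot, action, div_self hpi, one_mul]
  have h1 : ‖rootFamily (e, (Real.pi : ℂ)) - rootFamily (e', (Real.pi : ℂ))‖
      ≤ 5 / 7 * ‖e - e'‖ := by
    refine (ContinuousMap.norm_le _ (by positivity)).2 fun x => ?_
    rw [ContinuousMap.sub_apply, rootFamily_apply ⟨he, ofReal_mem_strip _⟩,
      rootFamily_apply ⟨he', ofReal_mem_strip _⟩]
    simpa only [Complex.ofReal_mul] using norm_root_sub_root_le he he' ((x : ℝ) / Real.pi * Real.pi)
  rw [hM, hM, ← sub_div, ← ContinuousMap.sub_apply, ← map_sub, norm_div, Complex.norm_real,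
    Real.norm_of_nonneg Real.pi_pos.le, div_le_iff₀ Real.pi_pos]
  refine (norm_primitiveL_apply_le _ _).trans ?_
  rw [mul_comm]
  gcongr

lemma norm_meanRoot_sq_sub_le {e e' : ℂ} (he : e ∈ paramDisc) (he' : e' ∈ paramDisc) :
    ‖meanRoot e ^ 2 - meanRoot e' ^ 2‖ ≤ 1494 / 1000 * ‖e - e'‖ := by
  have h1 := norm_meanRoot_sub_le he he'
  have h2 : ‖meanRoot e + meanRoot e'‖ ≤ 2090 / 1000 :=
    (norm_add_le _ _).trans (by linarith [norm_meanRoot_le he, norm_meanRoot_le he'])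
  rw [sq_sub_sq, norm_mul]
  nlinarith [norm_nonneg (meanRoot e - meanRoot e'), norm_nonneg (e - e'),
    norm_nonneg (meanRoot e + meanRoot e')]

lemma norm_sq_ratio_sub_one_le {n : ℕ} (hn : 10000 ≤ n) {t : ℂ} (ht : ‖t‖ ≤ 1 / 4) :
    ‖((n : ℂ) / (n + t)) ^ 2 - 1‖ ≤ 1 / 10000 := by
  have hn' : (10000 : ℝ) ≤ n := by exact_mod_cast hn
  have h1 := norm_natCast_add_ge n t
  have h2 : 0 < ‖(n : ℂ) + t‖ := by linarith
  have h3 : ((n : ℂ) / (n + t)) ^ 2 - 1 = -(t * (2 * n + t)) / (n + t) ^ 2 := by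
    have := norm_pos_iff.1 h2
    field_simp
    ring
  have h4 : ‖2 * (n : ℂ) + t‖ ≤ 2 * n + 1 / 4 := by
    refine (norm_add_le _ _).trans (add_le_add ?_ ht)
    rw [norm_mul, Complex.norm_two, Complex.norm_natCast]
  rw [h3, norm_div, norm_neg, norm_mul, norm_pow, div_le_iff₀ (by positivity)]
  have h5 : ‖t‖ * ‖2 * (n : ℂ) + t‖ ≤ 1 / 4 * (2 * n + 1 / 4) := by gcongr
  have h6 : ((n : ℝ) - 1 / 4) ^ 2 ≤ ‖(n : ℂ) + t‖ ^ 2 := by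
    gcongr
    · linarith
    · linarith
  nlinarith

/-- Inversion of `e ↦ (n + τ e)² e / M(e)²` on the disc of radius `6 n² / 13`. -/
lemma exists_inverse_param {n : ℕ} (hn : 10000 ≤ n) {τ : ℂ → ℂ}
    (hτ : DifferentiableOn ℂ τ paramDisc) (hτ' : ∀ e ∈ paramDisc, ‖τ e‖ ≤ 1 / 4) :
    ∃ g : ℂ → ℂ, DifferentiableOn ℂ g (Metric.ball 0 (6 / 13 * n ^ 2)) ∧
      (∀ β ∈ Metric.ball (0 : ℂ) (6 / 13 * n ^ 2), g β ∈ paramDisc) ∧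
      ∀ β ∈ Metric.ball (0 : ℂ) (6 / 13 * n ^ 2),
        β * meanRoot (g β) ^ 2 / (n + τ (g β)) ^ 2 = g β := by
  have hn' : (10000 : ℝ) ≤ n := by exact_mod_cast hn
  have hnC : (n : ℂ) ≠ 0 := by
    rw [Nat.cast_ne_zero]; omega
  have hk0 : ∀ e ∈ paramDisc, (n : ℂ) + τ e ≠ 0 := fun e he => norm_pos_iff.1 (by
    linarith [norm_natCast_add_ge n (τ e), hτ' e he])
  have hsub : Metric.closedBall (0 : ℂ) (505 / 1000) ⊆ paramDisc :=
    Metric.closedBall_subset_ball (by norm_num)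
  -- Replacing `(n + τ)²` by `n²` costs a factor `1 + q`, with `q` of order `1 / (2n)`; `n ≥ 10000`
  -- makes it negligible.
  let q : ℂ → ℂ := fun e => ((n : ℂ) / (n + τ e)) ^ 2 - 1
  have hq : ∀ e ∈ paramDisc, ‖q e‖ ≤ 1 / 10000 := fun e he =>
    norm_sq_ratio_sub_one_le hn (hτ' e he)
  have hqd : DifferentiableOn ℂ q paramDisc :=
    (((differentiableOn_const _).div (hτ.const_add _) hk0).pow 2).sub_const _
  let T : ℂ → ℂ → ℂ := fun β e => β * meanRoot e ^ 2 / (n + τ e) ^ 2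
  have hT : ∀ β, ∀ e ∈ paramDisc, T β e = β / n ^ 2 * (meanRoot e ^ 2 * (1 + q e)) := by
    intro β e he
    have := hk0 e he
    simp only [T, q]
    field_simp
    ring
  have hβ : ∀ β ∈ Metric.ball (0 : ℂ) (6 / 13 * n ^ 2), ‖β / (n : ℂ) ^ 2‖ ≤ 6 / 13 := by
    intro β hβ
    rw [norm_div, norm_pow, Complex.norm_natCast, div_le_iff₀ (by positivity)]
    exact (mem_ball_zero_iff.1 hβ).le
  have hM : ∀ e ∈ paramDisc, ‖meanRoot e ^ 2‖ ≤ 10921 / 10000 := fun e he => by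
    rw [norm_pow]
    have := norm_meanRoot_le he
    nlinarith [norm_nonneg (meanRoot e)]
  have hq1 : ∀ e ∈ paramDisc, ‖1 + q e‖ ≤ 10001 / 10000 := fun e he => by
    refine (norm_add_le _ _).trans ?_
    rw [norm_one]
    linarith [hq e he]
  -- The constant `6/13` is spent here: `(6/13) · 1.0921 · 1.0001 < 0.505`, with `1.0921` bounding
  -- `1.045²`.
  have hmaps : ∀ β ∈ Metric.ball (0 : ℂ) (6 / 13 * n ^ 2),
      ∀ e ∈ Metric.closedBall (0 : ℂ) (505 / 1000),
        T β e ∈ Metric.closedBall (0 : ℂ) (505 / 1000) := by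
    intro β hb e he
    rw [mem_closedBall_zero_iff, hT β e (hsub he), norm_mul, norm_mul]
    calc _ ≤ (6 / 13 : ℝ) * (10921 / 10000 * (10001 / 10000)) := by
          have h1 := hβ β hb
          have h2 := hM e (hsub he)
          have h3 := hq1 e (hsub he)
          gcongr
      _ ≤ _ := by norm_num
  have hlip : ∀ β ∈ Metric.ball (0 : ℂ) (6 / 13 * n ^ 2),
      ∀ x ∈ Metric.closedBall (0 : ℂ) (505 / 1000), ∀ y ∈ Metric.closedBall (0 : ℂ) (505 / 1000),
        dist (T β x) (T β y) ≤ 3 / 4 * dist x y := by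
    intro β hb x hx y hy
    -- The gap `0.51 - 0.505` gives `q` the Lipschitz constant `0.04`. In total `(6/13)(1.494 ·
    -- 1.0001 + 1.0921 · 0.04) < 3/4`.
    have h1 := lipschitz_of_bounded (by norm_num : (505 / 1000 : ℝ) < 51 / 100) hqd hq hx hy
    have h2 := norm_meanRoot_sq_sub_le (hsub hx) (hsub hy)
    rw [dist_eq_norm, dist_eq_norm] at h1 ⊢
    have h3 : T β x - T β y = β / n ^ 2 * ((meanRoot x ^ 2 - meanRoot y ^ 2) * (1 + q x)
        + meanRoot y ^ 2 * (q x - q y)) := by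
      rw [hT β x (hsub hx), hT β y (hsub hy)]; ring
    rw [h3, norm_mul]
    have h4 : ‖(meanRoot x ^ 2 - meanRoot y ^ 2) * (1 + q x) + meanRoot y ^ 2 * (q x - q y)‖
        ≤ 1494 / 1000 * ‖x - y‖ * (10001 / 10000) + 10921 / 10000 * (4 / 100 * ‖x - y‖) := by
      refine (norm_add_le _ _).trans (add_le_add ?_ ?_)
      · rw [norm_mul]
        have := hq1 x (hsub hx)
        gcongr
      · rw [norm_mul]
        have h5 := hM y (hsub hy)
        have h6 : ‖q x - q y‖ ≤ 4 / 100 * ‖x - y‖ := h1.trans (by norm_num)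
        gcongr
    refine (mul_le_mul (hβ β hb) h4 (norm_nonneg _) (by norm_num)).trans ?_
    linarith [norm_nonneg (x - y)]
  obtain ⟨g, h1, h2, h3⟩ := exists_holomorphic_fixedPoint Metric.isOpen_ball
    (by norm_num : (0 : ℝ) ≤ 505 / 1000) (by norm_num : (3 / 4 : ℝ) < 1) hmaps hlip
    (fun g hg hgm => by
      have hgs : Set.MapsTo g (Metric.ball 0 (6 / 13 * (n : ℝ) ^ 2)) paramDisc := fun β hb =>
        hsub (hgm hb)
      exact (differentiableOn_id.mul ((differentiableOn_meanRoot.comp hg hgs).pow 2)).div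
        (((hτ.comp hg hgs).const_add _).pow 2) fun β hb => pow_ne_zero _ (hk0 _ (hgs hb)))
  exact ⟨g, h1, fun β hb => hsub (h2 hb), h3⟩

/-- On the disc of radius `6 n² / 13` there is a holomorphic branch of eigenvalues, for large
`n`. -/
lemma eventually_exists_branch (bc : BoundaryCondition) (γ₁ γ₂ : ℝ) :
    ∀ᶠ n : ℕ in atTop, ∃ (lam : ℝ) (Λ : ℂ → ℂ), IsNthEigenvalue bc γ₁ γ₂ n lam ∧
      DifferentiableOn ℂ Λ (Metric.ball 0 (6 / 13 * n ^ 2)) ∧ Λ 0 = lam ∧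
      ∀ β ∈ Metric.ball (0 : ℂ) (6 / 13 * n ^ 2), IsEigenvalue bc γ₁ γ₂ β (Λ β) := by
  filter_upwards [eventually_exists_phaseShift bc γ₁ γ₂, eventually_nthEigenvalue_close bc γ₁ γ₂,
    eventually_ge_atTop 10000, eventually_ge_atTop bc.firstIndex] with n hshift hclose hn hfirst
  obtain ⟨τ, hτ, hτ', hτz, hτu⟩ := hshift
  obtain ⟨g, hg, hgm, hgf⟩ := exists_inverse_param hn hτ hτ'
  obtain ⟨lam, hlam⟩ := (isRealCoeff_basePot γ₁ γ₂).exists_rot_shift_eq bc hfirst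
  have hnth := (isNthEigenvalue_iff bc γ₁ γ₂).2 ⟨hfirst, hlam⟩
  have hn' : (10000 : ℝ) ≤ n := by exact_mod_cast hn
  have hk0 : ∀ t : ℂ, ‖t‖ ≤ 1 / 4 → (n : ℂ) + t ≠ 0 := fun t ht => norm_pos_iff.1 (by
    linarith [norm_natCast_add_ge n t])
  have hball : (0 : ℂ) ∈ Metric.ball (0 : ℂ) (6 / 13 * n ^ 2) :=
    Metric.mem_ball_self (by positivity)
  have hM0 : ∀ e ∈ paramDisc, meanRoot e ^ 2 ≠ 0 := fun e he => pow_ne_zero _ (meanRoot_ne_zero he)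
  -- In the notation `λ = β + μ`, `e = β / μ`: here `L` is `μ` and `K` is `β`, both parametrized by
  -- `e`.
  let K : ℂ → ℂ := fun e => (n + τ e) ^ 2 * e / meanRoot e ^ 2
  let L : ℂ → ℂ := fun e => (n + τ e) ^ 2 / meanRoot e ^ 2
  have hK : DifferentiableOn ℂ K paramDisc :=
    (((hτ.const_add _).pow 2).mul differentiableOn_id).div (differentiableOn_meanRoot.pow 2) hM0
  have hL : DifferentiableOn ℂ L paramDisc :=
    ((hτ.const_add _).pow 2).div (differentiableOn_meanRoot.pow 2) hM0
  -- The left side is holomorphic in `e` and vanishes for real `e`, where the Liouville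
  -- transformation is a genuine change of variables; the identity theorem covers complex `e`.
  have hz : ∀ e ∈ paramDisc, hillChar bc γ₁ γ₂ (K e, K e + L e) = 0 := by
    have hd : DifferentiableOn ℂ (fun e => hillChar bc γ₁ γ₂ (K e, K e + L e)) paramDisc :=
      ((contDiff_hillChar bc γ₁ γ₂).differentiable one_ne_zero).comp_differentiableOn
        (hK.prodMk (hK.add hL))
    have hreal : ∀ e : ℝ, |e| < 51 / 100 → hillChar bc γ₁ γ₂ (K e, K e + L e) = 0 := fun e he => by
      have hec := ofReal_mem_paramDisc he
      exact (isEigenvalue_iff_hillChar bc γ₁ γ₂ _ _).1 (isEigenvalue_of_charFn_liouville he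
        ((normChar_eq_zero_iff bc (hk0 _ (hτ' _ hec)) _).1 (hτz _ hec)))
    refine (hd.analyticOnNhd Metric.isOpen_ball).eqOn_zero_of_preconnected_of_frequently_eq_zero
      (convex_ball _ _).isPreconnected zero_mem_paramDisc ?_
    have hseq : Tendsto (fun m : ℕ => (((1 : ℝ) / (m + 1) : ℝ) : ℂ)) atTop (𝓝[≠] 0) := by
      refine tendsto_nhdsWithin_iff.2 ⟨?_, Eventually.of_forall fun m => ?_⟩
      · rw [← Complex.ofReal_zero]
        exact (Complex.continuous_ofReal.tendsto 0).comp tendsto_one_div_add_atTop_nhds_zero_nat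
      · have : (1 : ℝ) / (m + 1) ≠ 0 := by positivity
        exact Complex.ofReal_ne_zero.2 this
    refine hseq.frequently (Eventually.frequently ?_)
    filter_upwards [eventually_ge_atTop 1] with m hm
    refine hreal _ ?_
    have hm' : (1 : ℝ) ≤ m := by exact_mod_cast hm
    rw [abs_of_pos (by positivity), div_lt_iff₀ (by positivity)]
    linarith
  have hKg : ∀ β ∈ Metric.ball (0 : ℂ) (6 / 13 * n ^ 2), K (g β) = β := by
    intro β hb
    have h1 := hM0 _ (hgm β hb)
    have h2 := pow_ne_zero 2 (hk0 _ (hτ' _ (hgm β hb)))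
    have h3 := hgf β hb
    rw [div_eq_iff h2] at h3
    simp only [K]
    rw [div_eq_iff h1, h3]
    ring
  refine ⟨lam, fun β => β + L (g β), hnth,
    differentiableOn_id.add (hL.comp hg hgm), ?_, fun β hb => ?_⟩
  · have hg0 : g 0 = 0 := by
      have := hgf 0 hball
      rwa [zero_mul, zero_div, eq_comm] at this
    obtain ⟨hl1, hl2⟩ := hclose lam hnth
    have hlam0 : 0 ≤ lam := (sq_nonneg _).trans hl1.le
    set κ := √lam with hκ
    have hκ2 : κ ^ 2 = lam := Real.sq_sqrt hlam0
    have hκ1 : (n : ℝ) - 1 / 4 ≤ κ := Real.le_sqrt_of_sq_le hl1.le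
    have hκ3 : κ ≤ n + 1 / 4 := Real.sqrt_le_iff.2 ⟨by linarith, hl2.le⟩
    have hκd : ‖((κ - n : ℝ) : ℂ)‖ ≤ 1 / 4 := by
      rw [Complex.norm_real, Real.norm_eq_abs, abs_le]
      constructor <;> linarith
    have hκn : (n : ℂ) + ((κ - n : ℝ) : ℂ) = κ := by push_cast; ring
    have hκC : (κ : ℂ) ^ 2 = lam := by rw [← Complex.ofReal_pow, hκ2]
    -- The root `√λ_n` lies within `1/4` of `n` and solves the quantization condition at `e = 0`,
    -- where `n + τ(0)` is the only such solution. Hence the branch starts at the eigenvalue of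
    -- index `n`.
    have hzero : normChar bc (n + ((κ - n : ℝ) : ℂ)) (liouvilleCoeff γ₁ γ₂ 0) = 0 := by
      rw [normChar_eq_zero_iff bc (hk0 _ hκd), hκn, liouvilleCoeff_zero, ← shift_eq_modelCoeff, hκC,
        ← hillCoeff_zero]
      exact (isEigenvalue_iff bc γ₁ γ₂ 0 lam).1 hnth.1
    have hτ0 := hτu 0 zero_mem_paramDisc _ hκd hzero
    simp only [L]
    rw [hg0, ← hτ0, hκn, meanRoot_zero, hκC, one_pow, div_one, zero_add]
  · rw [isEigenvalue_iff_hillChar]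
    have := hz _ (hgm β hb)
    rwa [hKg β hb] at this

end AngularHill

theorem theorem3p1 (E Z h : ℝ) (hh : 0 < h) (hE : 2 * |Z| < E)
    (bc : AngularHill.BoundaryCondition) :
    (∀ n : ℕ, bc.firstIndex ≤ n →
      ∃! p : FormalMultilinearSeries ℂ ℂ ℂ,
        AngularHill.IsPerturbationSeries bc (Z / h ^ 2) (E / (2 * h ^ 2)) n p) ∧
    (6 / 13 : ℝ≥0∞) ≤
      liminf (fun n : ℕ =>
        AngularHill.convergenceRadius bc (Z / h ^ 2) (E / (2 * h ^ 2)) n / (n : ℝ≥0∞) ^ 2)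
        atTop := by
  refine ⟨fun n hn => AngularHill.existsUnique_perturbationSeries bc _ _ hn, ?_⟩
  refine le_liminf_of_le (by isBoundedDefault) ?_
  filter_upwards [AngularHill.eventually_exists_branch bc (Z / h ^ 2) (E / (2 * h ^ 2)),
    eventually_ge_atTop 1] with n hbranch hn
  obtain ⟨lam, Λ, hnth, hΛ, h0, hev⟩ := hbranch
  have hn' : (0 : ℝ) < n := by exact_mod_cast hn
  have hρ := AngularHill.ofReal_le_convergenceRadius bc _ _ hnth hΛ h0
    (by filter_upwards [Metric.ball_mem_nhds (0 : ℂ) (by positivity : 0 < 6 / 13 * (n : ℝ) ^ 2)]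
          with β hb using hev β hb)
  rw [ENNReal.le_div_iff_mul_le (Or.inl (by simp; omega)) (Or.inl (by simp))]
  refine le_trans (le_of_eq ?_) hρ
  rw [ENNReal.ofReal_mul (by norm_num), ENNReal.ofReal_pow hn'.le, ENNReal.ofReal_natCast,
    ENNReal.ofReal_div_of_pos (by norm_num)]
  simp
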